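/- Let $\mathbb K$ be a field and let $A=\bigoplus_{n\ge 0}A_n$ be a graded associative $\mathbb K$-algebra that is connected, i.e. $A_0=\mathbb K$; write $\mathbb K=A/A_{\ge 1}$ for the trivial left $A$-module, placed in degree $0$. Call $A$ *weakly Artin–Schelter regular of global dimension $d$* if it is connected, generated in degree one, has (left) global dimension $d$, and satisfies $\operatorname{Ext}^d_A(\mathbb K,A)\cong\mathbb K$ (as vector spaces) and $\operatorname{Ext}^j_A(\mathbb K,A)=0$ for $j\ne d$ (these are the conditions of Artin–Schelter regularity without polynomial growth). Call $A$ *Koszul* if the minimal graded projective resolution $\cdots\to P_1\to P_0\to\mathbb K\to 0$ is linear, i.e. $P_n$ is generated in degree $n$ for every $n$. For $r\in\mathbb Z$ and $n\ge 0$ let $C^n_r(A)$ be the space of $\mathbb K$-linear maps $f:A^{\otimes n}\to A$ with $f(A_{p_1}\otimes\cdots\otimes A_{p_n})\subseteq A_{p_1+\cdots+p_n+r}$ (where $A_m=0$ for $m<0$), let $C^n_r(A)=0$ for $n<0$, and let $\operatorname{HH}^i_r(A)$, $i\in\mathbb Z$, be the $i$-th cohomology of $C^\bullet_r(A)$ with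 the Hochschild differential $$df(a_1\otimes\cdots\otimes a_{n+1})=a_1f(a_2\otimes\cdots\otimes a_{n+1})+\sum_{i=1}^n(-1)^if(a_1\otimes\cdots\otimes a_ia_{i+1}\otimes\cdots\otimes a_{n+1})+(-1)^{n+1}f(a_1\otimes\cdots\otimes a_n)a_{n+1}.$$ **Proposition.** Let $A$ be a Koszul, connected, weakly Artin–Schelter regular algebra of global dimension $d$. Then $\operatorname{HH}^i_r(A)=0$ for all $r\in\mathbb Z$ whenever $i<0$ or $i>d$; every $\operatorname{HH}^i_r(A)$ is finite-dimensional over $\mathbb K$; and for every $r\in\mathbb Z$ $$\sum_{i=0}^d(-1)^i\dim_{\mathbb K}\operatorname{HH}^i_r(A)=\begin{cases}(-1)^d&\text{if }r+d=0,\\0&\text{if }r+d\ne 0.\end{cases}$$ In particular, if $d\ge 1$, then $\sum_{i=0}^d(-1)^i\dim_{\mathbb K}\operatorname{HH}^i_0(A)=0$. -/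

import Mathlib

universe u v

noncomputable section

open CategoryTheory

namespace GradedHochschild

section Combinatorics

variable {α : Type*}

/-- Two contractions of adjacent entries of a tuple commute up to a shift of the index. -/
theorem contractNth_contractNth {n : ℕ} (op : α → α → α)
    (assoc : ∀ x y z, op (op x y) z = op x (op y z)) (b : Fin (n + 2) → α)
    (i : Fin (n + 2)) (j : Fin (n + 1)) (i' : Fin (n + 1)) (j' : Fin (n + 2))
    (hi : (i' : ℕ) = i) (hj : (j' : ℕ) = j + 1) (h : (i : ℕ) ≤ j) :
    Fin.contractNth j op (Fin.contractNth i op b) =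
      Fin.contractNth i' op (Fin.contractNth j' op b) := by
  funext k
  simp only [Fin.contractNth, Fin.val_castSucc, Fin.val_succ, hi, hj]
  split_ifs <;> first | rfl | omega | exact assoc _ _ _

/-- Changing one entry of a tuple and then contracting. -/
theorem contractNth_update {n : ℕ} (op : α → α → α) (a : Fin (n + 1) → α) (j : Fin n)
    (i : Fin (n + 1)) (x : α) :
    Fin.contractNth j.castSucc op (Function.update a i x) =
      Function.update (Fin.contractNth j.castSucc op a) (j.predAbove i)
        (if i = j.castSucc then op x (a j.succ)
          else if i = j.succ then op (a j.castSucc) x else x) := by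
  funext k
  have hp : ((j.predAbove i : Fin n) : ℕ) = if (j : ℕ) < i then (i : ℕ) - 1 else i := by
    simp only [Fin.predAbove, Fin.lt_def, Fin.val_castSucc]
    split_ifs <;> simp
  simp only [Fin.contractNth, Function.update_apply, Fin.ext_iff, Fin.val_castSucc, Fin.val_succ,
    hp]
  by_cases hkj : (k : ℕ) = j
  · obtain rfl : k = j := Fin.ext hkj
    split_ifs <;> first | rfl | omega
  · split_ifs <;> first | rfl | omega

/-- Contracting two adjacent entries does not change the sum of a tuple. -/
theorem sum_contractNth {M : Type*} [AddCommMonoid M] {n : ℕ} (p : Fin (n + 1) → M) (j : Fin n) :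
    ∑ k, Fin.contractNth j.castSucc (· + ·) p k = ∑ k, p k := by
  rw [Fin.sum_univ_succAbove p j.castSucc, ← Finset.add_sum_erase _ _ (Finset.mem_univ j),
    ← Finset.add_sum_erase _ (fun k => p (j.castSucc.succAbove k)) (Finset.mem_univ j),
    Fin.contractNth_apply_of_eq _ _ _ _ (by simp), ← add_assoc]
  congr 1
  · simp
  · refine Finset.sum_congr rfl fun k hk => ?_
    rw [Fin.contractNth_apply_of_ne]
    intro h
    exact Finset.ne_of_mem_erase hk (Fin.ext (by simpa using h.symm))

end Combinatorics

section Hochschild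

variable {K : Type v} {A : Type u} [Field K] [Ring A] [Algebra K A]

/-- The Hochschild cochains `Hom_K(A^{⊗ n}, A)`, as `K`-multilinear maps `A^n → A`. -/
abbrev Cochain (K : Type v) (A : Type u) [Field K] [Ring A] [Algebra K A] (n : ℕ) : Type u :=
  MultilinearMap K (fun _ : Fin n => A) A

/-- The multilinear map `(a_1, …, a_{n+1}) ↦ f (a_1, …, a_j a_{j+1}, …, a_{n+1})`, where the
factors that are multiplied are the entries `j` and `j + 1`, counted from `0`. -/
def innerFace {n : ℕ} (j : Fin n) (f : Cochain K A n) : Cochain K A (n + 1) where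
  toFun a := f (Fin.contractNth j.castSucc (· * ·) a)
  map_update_add' {dec} a i x y := by
    obtain rfl : dec = instDecidableEqFin (n + 1) := Subsingleton.elim _ _
    simp only [contractNth_update]
    split_ifs <;> simp [add_mul, mul_add]
  map_update_smul' {dec} a i c x := by
    obtain rfl : dec = instDecidableEqFin (n + 1) := Subsingleton.elim _ _
    simp only [contractNth_update]
    split_ifs <;> simp

/-- The multilinear map `(a_1, …, a_{n+1}) ↦ a_1 f (a_2, …, a_{n+1})`. -/
def leftFace {n : ℕ} (f : Cochain K A n) : Cochain K A (n + 1) where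
  toFun a := a 0 * f (fun k => a k.succ)
  map_update_add' {dec} a i x y := by
    obtain rfl : dec = instDecidableEqFin (n + 1) := Subsingleton.elim _ _
    refine Fin.cases ?_ (fun i => ?_) i
    · simp [add_mul]
    · have h (z : A) : (fun k : Fin n => Function.update a i.succ z k.succ) =
          Function.update (fun k => a k.succ) i z := by
        funext k; simp [Function.update_apply]
      have h0 (z : A) : Function.update a i.succ z 0 = a 0 := by
        simp [(Fin.succ_ne_zero i).symm]
      simp [mul_add, h, h0]
  map_update_smul' {dec} a i c x := by
    obtain rfl : dec = instDecidableEqFin (n + 1) := Subsingleton.elim _ _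
    refine Fin.cases ?_ (fun i => ?_) i
    · simp
    · have h (z : A) : (fun k : Fin n => Function.update a i.succ z k.succ) =
          Function.update (fun k => a k.succ) i z := by
        funext k; simp [Function.update_apply]
      have h0 (z : A) : Function.update a i.succ z 0 = a 0 := by
        simp [(Fin.succ_ne_zero i).symm]
      simp [h, h0]

/-- The multilinear map `(a_1, …, a_{n+1}) ↦ f (a_1, …, a_n) a_{n+1}`. -/
def rightFace {n : ℕ} (f : Cochain K A n) : Cochain K A (n + 1) where
  toFun a := f (fun k => a k.castSucc) * a (Fin.last n)
  map_update_add' {dec} a i x y := by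
    obtain rfl : dec = instDecidableEqFin (n + 1) := Subsingleton.elim _ _
    refine Fin.lastCases ?_ (fun i => ?_) i
    · simp [mul_add, Fin.castSucc_ne_last]
    · have h (z : A) : (fun k : Fin n => Function.update a i.castSucc z k.castSucc) =
          Function.update (fun k => a k.castSucc) i z := by
        funext k; simp [Function.update_apply]
      have h0 (z : A) : Function.update a i.castSucc z (Fin.last n) = a (Fin.last n) := by
        simp [(Fin.castSucc_ne_last i).symm]
      simp [add_mul, h, h0]
  map_update_smul' {dec} a i c x := by
    obtain rfl : dec = instDecidableEqFin (n + 1) := Subsingleton.elim _ _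
    refine Fin.lastCases ?_ (fun i => ?_) i
    · simp [Fin.castSucc_ne_last]
    · have h (z : A) : (fun k : Fin n => Function.update a i.castSucc z k.castSucc) =
          Function.update (fun k => a k.castSucc) i z := by
        funext k; simp [Function.update_apply]
      have h0 (z : A) : Function.update a i.castSucc z (Fin.last n) = a (Fin.last n) := by
        simp [(Fin.castSucc_ne_last i).symm]
      simp [h, h0]

/-- The Hochschild differential `C^n(A) → C^{n+1}(A)`. -/
def differential (K : Type v) (A : Type u) [Field K] [Ring A] [Algebra K A] (n : ℕ) :
    Cochain K A n →ₗ[K] Cochain K A (n + 1) where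
  toFun f := leftFace f + ∑ j : Fin n, (-1 : K) ^ ((j : ℕ) + 1) • innerFace j f +
    (-1 : K) ^ (n + 1) • rightFace f
  map_add' f g := by
    ext a
    simp only [leftFace, innerFace, rightFace, _root_.add_apply, _root_.sum_apply,
      _root_.smul_apply, MultilinearMap.coe_mk, mul_add, add_mul, smul_add,
      Finset.sum_add_distrib]
    abel
  map_smul' c f := by
    ext a
    simp only [leftFace, innerFace, rightFace, _root_.add_apply, _root_.sum_apply,
      _root_.smul_apply, MultilinearMap.coe_mk, mul_smul_comm, smul_mul_assoc, smul_add,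
      Finset.smul_sum, RingHom.id_apply, smul_comm c]

theorem differential_apply {n : ℕ} (f : Cochain K A n) (a : Fin (n + 1) → A) :
    differential K A n f a = a 0 * f (fun k => a k.succ) +
      ∑ j : Fin n, (-1 : K) ^ ((j : ℕ) + 1) • f (Fin.contractNth j.castSucc (· * ·) a) +
      (-1 : K) ^ (n + 1) • (f (fun k => a k.castSucc) * a (Fin.last n)) := by
  simp [differential, leftFace, innerFace, rightFace]

/-- The function `(b_0, …, b_{n+1}) ↦ b_0 f (b_1, …, b_n) b_{n+1}` attached to a cochain. -/
def sandwich {n : ℕ} (f : Cochain K A n) (b : Fin (n + 2) → A) : A :=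
  b 0 * f (fun k => b k.succ.castSucc) * b (Fin.last (n + 1))

theorem sandwich_differential {n : ℕ} (f : Cochain K A n) (b : Fin (n + 3) → A) :
    sandwich (differential K A n f) b =
      ∑ j : Fin (n + 2), (-1 : K) ^ (j : ℕ) •
        sandwich f (Fin.contractNth j.castSucc (· * ·) b) := by
  rw [Fin.sum_univ_succ, Fin.sum_univ_castSucc]
  simp only [sandwich, differential_apply, mul_add, add_mul, Finset.mul_sum, Finset.sum_mul,
    mul_smul_comm, smul_mul_assoc]
  rw [add_assoc]
  congr 1
  · simp [Fin.contractNth, mul_assoc]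
  congr 1
  · refine Finset.sum_congr rfl fun j _ => ?_
    have h : (fun k : Fin n => Fin.contractNth j.castSucc.succ.castSucc (· * ·) b
        k.succ.castSucc) =
        Fin.contractNth j.castSucc (· * ·) (fun k : Fin (n + 1) => b k.succ.castSucc) := by
      funext k
      simp [Fin.contractNth]
    rw [h]
    have h0 : Fin.contractNth j.castSucc.succ.castSucc (· * ·) b 0 = b 0 := by
      simp [Fin.contractNth]
    have h1 : Fin.contractNth j.castSucc.succ.castSucc (· * ·) b (Fin.last (n + 1)) =
        b (Fin.last (n + 2)) := by
      rw [Fin.contractNth_apply_of_gt]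
      · simp
      · simp
    rw [h0, h1]
    simp
  · have h : (fun k : Fin n => Fin.contractNth (Fin.last n).succ.castSucc (· * ·) b
        k.succ.castSucc) = fun k : Fin n => b k.castSucc.succ.castSucc := by
      funext k
      rw [Fin.contractNth_apply_of_lt]
      · simp
      · simp
    have h0 : Fin.contractNth (Fin.last n).succ.castSucc (· * ·) b 0 = b 0 := by
      simp [Fin.contractNth]
    have h1 : Fin.contractNth (Fin.last n).succ.castSucc (· * ·) b (Fin.last (n + 1)) =
        b (Fin.last (n + 1)).castSucc * b (Fin.last (n + 2)) := by
      rw [Fin.contractNth_apply_of_eq]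
      · simp
      · simp
    rw [h, h0, h1]
    simp [mul_assoc]

theorem sum_sum_contractNth_eq_zero {n : ℕ} (G : (Fin (n + 2) → A) → A) (b : Fin (n + 4) → A) :
    ∑ ij : Fin (n + 3) × Fin (n + 2), ((-1 : K) ^ (ij.1 : ℕ) * (-1 : K) ^ (ij.2 : ℕ)) •
      G (Fin.contractNth ij.2.castSucc (· * ·) (Fin.contractNth ij.1.castSucc (· * ·) b)) = 0 := by
  let S : Finset (Fin (n + 3) × Fin (n + 2)) := {ij | (ij.1 : ℕ) ≤ (ij.2 : ℕ)}
  rw [← Finset.sum_add_sum_compl S, ← eq_neg_iff_add_eq_zero, ← Finset.sum_neg_distrib]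
  refine Finset.sum_bij (fun ij hij => (ij.2.succ, ij.1.castLT
    (lt_of_le_of_lt (Finset.mem_filter.mp hij).2 ij.2.2))) ?_ ?_ ?_ ?_
  · rintro ⟨i, j⟩ hij
    simp only [S, Finset.compl_filter, Finset.mem_filter_univ, Fin.val_succ,
      Fin.val_castLT] at hij ⊢
    omega
  · rintro ⟨i, j⟩ hij ⟨i', j'⟩ hij' h
    simp only [Prod.mk.injEq, Fin.ext_iff, Fin.val_succ, Fin.val_castLT] at h ⊢
    omega
  · rintro ⟨i, j⟩ hij
    simp only [S, Finset.compl_filter, Finset.mem_filter_univ, not_le] at hij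
    refine ⟨(j.castSucc, i.pred ?_), ?_, ?_⟩
    · rintro rfl
      simp at hij
    · simp only [S, Finset.mem_filter_univ, Fin.val_castSucc, Fin.val_pred]
      omega
    · simp
  · rintro ⟨i, j⟩ hij
    simp only [S, Finset.mem_filter_univ] at hij
    rw [← neg_smul]
    congr 1
    · simp only [Fin.val_succ, Fin.val_castLT]
      ring
    · rw [contractNth_contractNth _ mul_assoc b _ _
        (Fin.castSucc (i.castLT (lt_of_le_of_lt hij j.2))) (j.succ.castSucc) (by simp) (by simp) (by simpa using hij)]

theorem differential_comp_differential (n : ℕ) :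
    differential K A (n + 1) ∘ₗ differential K A n = 0 := by
  ext f a
  have key : ∀ b : Fin (n + 4) → A,
      sandwich (differential K A (n + 1) (differential K A n f)) b = 0 := by
    intro b
    rw [sandwich_differential, ← sum_sum_contractNth_eq_zero (K := K) (sandwich f) b,
      Fintype.sum_prod_type]
    refine Finset.sum_congr rfl fun i _ => ?_
    rw [sandwich_differential, Finset.smul_sum]
    simp only [smul_smul]
  have h := key (Fin.cons 1 (Fin.snoc a 1))
  have e : (Fin.last (n + 3)) = (Fin.last (n + 2)).succ := rfl
  simp only [sandwich, Fin.cons_zero, one_mul, e, Fin.cons_succ, Fin.snoc_last, mul_one,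
    ← Fin.succ_castSucc, Fin.snoc_castSucc] at h
  simpa using h

/-- The homogeneous component of degree `m ∈ ℤ`; it is zero for `m < 0`. -/
def intComponent (𝒜 : ℕ → Submodule K A) : ℤ → Submodule K A
  | Int.ofNat m => 𝒜 m
  | Int.negSucc _ => ⊥

/-- The cochains `f` of internal degree `r`: those with
`f (a_1, …, a_n) ∈ A_{p_1 + ⋯ + p_n + r}` for all homogeneous `a_j ∈ A_{p_j}`. -/
def gradedCochain (𝒜 : ℕ → Submodule K A) (r : ℤ) (n : ℕ) : Submodule K (Cochain K A n) where
  carrier := {f | ∀ (p : Fin n → ℕ) (a : Fin n → A), (∀ j, a j ∈ 𝒜 (p j)) →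
    f a ∈ intComponent 𝒜 ((∑ j, p j : ℕ) + r)}
  add_mem' hf hg p a ha := add_mem (hf p a ha) (hg p a ha)
  zero_mem' _ _ _ := zero_mem _
  smul_mem' c _ hf p a ha := Submodule.smul_mem _ c (hf p a ha)

section Graded

variable (𝒜 : ℕ → Submodule K A) [GradedAlgebra 𝒜]

theorem mul_mem_intComponent_left {p : ℕ} {m : ℤ} {x y : A} (hx : x ∈ 𝒜 p)
    (hy : y ∈ intComponent 𝒜 m) : x * y ∈ intComponent 𝒜 (p + m) := by
  cases m with
  | ofNat m => exact SetLike.GradedMul.mul_mem (A := 𝒜) hx hy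
  | negSucc m =>
    obtain rfl : y = 0 := hy
    simp

theorem mul_mem_intComponent_right {p : ℕ} {m : ℤ} {x y : A} (hx : x ∈ 𝒜 p)
    (hy : y ∈ intComponent 𝒜 m) : y * x ∈ intComponent 𝒜 (m + p) := by
  cases m with
  | ofNat m => exact SetLike.GradedMul.mul_mem (A := 𝒜) hy hx
  | negSucc m =>
    obtain rfl : y = 0 := hy
    simp

theorem differential_mem_gradedCochain (r : ℤ) (n : ℕ) (f : Cochain K A n)
    (hf : f ∈ gradedCochain 𝒜 r n) : differential K A n f ∈ gradedCochain 𝒜 r (n + 1) := by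
  intro p a ha
  rw [differential_apply]
  refine add_mem (add_mem ?_ (sum_mem fun j _ => Submodule.smul_mem _ _ ?_))
    (Submodule.smul_mem _ _ ?_)
  · have h := mul_mem_intComponent_left 𝒜 (ha 0)
      (hf (fun k => p k.succ) (fun k => a k.succ) fun k => ha _)
    rw [Fin.sum_univ_succ]
    convert h using 1
    push_cast
    ring_nf
  · have h := hf (Fin.contractNth j.castSucc (· + ·) p) (Fin.contractNth j.castSucc (· * ·) a)
      (fun k => by
        simp only [Fin.contractNth]
        split_ifs
        · exact ha _
        · exact SetLike.mul_mem_graded (ha _) (ha _)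
        · exact ha _)
    rwa [sum_contractNth] at h
  · have h := mul_mem_intComponent_right 𝒜 (ha (Fin.last n))
      (hf (fun k => p k.castSucc) (fun k => a k.castSucc) fun k => ha _)
    rw [Fin.sum_univ_castSucc]
    convert h using 1
    push_cast
    ring_nf

/-- The complex of Hochschild cochains of internal degree `r`, indexed by `ℕ`. -/
def hochschildComplex (r : ℤ) : CochainComplex (ModuleCat.{u} K) ℕ :=
  CochainComplex.of (fun n => ModuleCat.of K (gradedCochain 𝒜 r n))
    (fun n => ModuleCat.ofHom
      ((differential K A n).restrict (differential_mem_gradedCochain 𝒜 r n)))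
    (fun n => by
      ext f : 2
      exact Subtype.ext (LinearMap.congr_fun (differential_comp_differential (K := K) (A := A) n)
        f.1))

/-- The bigraded Hochschild cohomology `HH^i_r(A)`, for `i : ℤ` and `r : ℤ`: the cohomology of the
complex of cochains of internal degree `r`, which is zero in negative cohomological degrees. -/
def HH (i r : ℤ) : ModuleCat.{u} K :=
  ((hochschildComplex 𝒜 r).extend ComplexShape.embeddingUpNat).homology i

end Graded

end Hochschild

section Regular

variable {K : Type v} {A : Type u} [Field K] [Ring A] [Algebra K A]

/-- `A_0 = K`, through the structure map. -/
def IsConnectedGraded (𝒜 : ℕ → Submodule K A) : Prop :=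
  Nontrivial A ∧ 𝒜 0 = 1

/-- `A` is generated in degree one as a `K`-algebra. -/
def IsGeneratedInDegreeOne (𝒜 : ℕ → Submodule K A) : Prop :=
  Algebra.adjoin K (𝒜 1 : Set A) = ⊤

/-- The left global dimension: the supremum of the projective dimensions of the left modules. -/
def globalDimension (A : Type u) [Ring A] : WithBot ℕ∞ :=
  ⨆ M : ModuleCat.{u} A, projectiveDimension M

variable (𝒜 : ℕ → Submodule K A) [GradedAlgebra 𝒜]

/-- The trivial left module `A / A_{≥ 1}`, which is `K` if `A` is connected. -/
abbrev TrivialModule : Type u :=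
  A ⧸ (HomogeneousIdeal.irrelevant 𝒜).toIdeal

/-- The Gorenstein condition: `Ext^d_A(K, A) = K` and `Ext^j_A(K, A) = 0` for `j ≠ d`, where
`Ext` is taken in the category of left `A`-modules. -/
def IsGorenstein (d : ℕ) : Prop :=
  Nonempty (Abelian.Ext (ModuleCat.of A (TrivialModule 𝒜)) (ModuleCat.of A A) d ≃ₗ[K] K) ∧
    ∀ j : ℕ, j ≠ d →
      Subsingleton (Abelian.Ext (ModuleCat.of A (TrivialModule 𝒜)) (ModuleCat.of A A) j)

/-- Weakly Artin–Schelter regular algebras of global dimension `d`: the conditions of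
Artin–Schelter regularity except for polynomial growth. -/
structure IsWeaklyASRegular (d : ℕ) : Prop where
  connected : IsConnectedGraded 𝒜
  generated : IsGeneratedInDegreeOne 𝒜
  globalDimension_eq : globalDimension A = d
  gorenstein : IsGorenstein 𝒜 d

/-- A graded projective resolution `⋯ → P_1 → P_0 → K → 0` of the trivial left module, where `K`
sits in degree zero and all maps preserve degrees. -/
structure GradedProjectiveResolution where
  /-- The modules of the resolution. -/
  P : ℕ → Type u
  [addCommGroup : ∀ n, AddCommGroup (P n)]
  [module : ∀ n, Module A (P n)]
  /-- The homogeneous components: `component n j` is the part of degree `j` of `P_n`. -/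
  component : ∀ n, ℕ → AddSubgroup (P n)
  isInternal : ∀ n, DirectSum.IsInternal (component n)
  smul_mem : ∀ n i j (a : A) (x : P n), a ∈ 𝒜 i → x ∈ component n j → a • x ∈ component n (i + j)
  projective : ∀ n, Module.Projective A (P n)
  /-- The differential `P_{n+1} → P_n`. -/
  d : ∀ n, P (n + 1) →ₗ[A] P n
  d_mem : ∀ n j x, x ∈ component (n + 1) j → d n x ∈ component n j
  /-- The augmentation `P_0 → K`. -/
  ε : P 0 →ₗ[A] TrivialModule 𝒜
  ε_eq_zero : ∀ j x, j ≠ 0 → x ∈ component 0 j → ε x = 0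
  ε_surjective : Function.Surjective ε
  exact_zero : Function.Exact (d 0) ε
  exact_succ : ∀ n, Function.Exact (d (n + 1)) (d n)

attribute [instance] GradedProjectiveResolution.addCommGroup GradedProjectiveResolution.module

variable {𝒜}

/-- Minimality: the image of each differential lies in `A_{≥ 1} P_n`. -/
def GradedProjectiveResolution.IsMinimal (Q : GradedProjectiveResolution 𝒜) : Prop :=
  ∀ n, LinearMap.range (Q.d n) ≤
    (HomogeneousIdeal.irrelevant 𝒜).toIdeal • (⊤ : Submodule A (Q.P n))

/-- Linearity: the `n`-th module is generated in degree `n`. -/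
def GradedProjectiveResolution.IsLinear (Q : GradedProjectiveResolution 𝒜) : Prop :=
  ∀ n, Submodule.span A (Q.component n n : Set (Q.P n)) = ⊤

variable (𝒜)

/-- Koszul algebras: the minimal graded projective resolution of the trivial module, which is
unique up to isomorphism, is linear. -/
def IsKoszul : Prop :=
  ∃ Q : GradedProjectiveResolution 𝒜, Q.IsMinimal ∧ Q.IsLinear

end Regular

end GradedHochschild

end

noncomputable section

open CategoryTheory

namespace GradedHochschild

/-- A bimodule over a graded algebra, with a family of homogeneous components indexed by `ℤ`.
The components are not required to form a direct sum decomposition. -/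
structure GradedBimodule {K : Type v} {A : Type u} [Field K] [Ring A] [Algebra K A]
    (𝒜 : ℕ → Submodule K A) where
  /-- The underlying vector space. -/
  carrier : Type u
  [addCommGroup : AddCommGroup carrier]
  [module : Module K carrier]
  /-- The left action. -/
  left : A →ₗ[K] carrier →ₗ[K] carrier
  /-- The right action. -/
  right : A →ₗ[K] carrier →ₗ[K] carrier
  left_one : ∀ x, left 1 x = x
  right_one : ∀ x, right 1 x = x
  left_mul : ∀ a b x, left (a * b) x = left a (left b x)
  right_mul : ∀ a b x, right (a * b) x = right b (right a x)
  left_right : ∀ a b x, left a (right b x) = right b (left a x)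
  /-- The homogeneous components. -/
  component : ℤ → Submodule K carrier
  left_mem : ∀ (p : ℕ) (m : ℤ) a x, a ∈ 𝒜 p → x ∈ component m → left a x ∈ component (p + m)
  right_mem : ∀ (p : ℕ) (m : ℤ) a x, a ∈ 𝒜 p → x ∈ component m → right a x ∈ component (m + p)

attribute [instance] GradedBimodule.addCommGroup GradedBimodule.module

namespace GradedBimodule

variable {K : Type v} {A : Type u} [Field K] [Ring A] [Algebra K A] {𝒜 : ℕ → Submodule K A}

/-- The Hochschild cochains with coefficients in a bimodule. -/
abbrev Cochain (B : GradedBimodule 𝒜) (n : ℕ) : Type u :=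
  MultilinearMap K (fun _ : Fin n => A) B.carrier

variable (B : GradedBimodule 𝒜)

/-- The multilinear map `(a_1, …, a_{n+1}) ↦ f (a_1, …, a_j a_{j+1}, …, a_{n+1})`. -/
def innerFace {n : ℕ} (j : Fin n) (f : B.Cochain n) : B.Cochain (n + 1) where
  toFun a := f (Fin.contractNth j.castSucc (· * ·) a)
  map_update_add' {dec} a i x y := by
    obtain rfl : dec = instDecidableEqFin (n + 1) := Subsingleton.elim _ _
    simp only [contractNth_update]
    split_ifs <;> simp [add_mul, mul_add]
  map_update_smul' {dec} a i c x := by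
    obtain rfl : dec = instDecidableEqFin (n + 1) := Subsingleton.elim _ _
    simp only [contractNth_update]
    split_ifs <;> simp

/-- The multilinear map `(a_1, …, a_{n+1}) ↦ a_1 f (a_2, …, a_{n+1})`. -/
def leftFace {n : ℕ} (f : B.Cochain n) : B.Cochain (n + 1) where
  toFun a := B.left (a 0) (f (fun k => a k.succ))
  map_update_add' {dec} a i x y := by
    obtain rfl : dec = instDecidableEqFin (n + 1) := Subsingleton.elim _ _
    refine Fin.cases ?_ (fun i => ?_) i
    · simp
    · have h (z : A) : (fun k : Fin n => Function.update a i.succ z k.succ) =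
          Function.update (fun k => a k.succ) i z := by
        funext k; simp [Function.update_apply]
      have h0 (z : A) : Function.update a i.succ z 0 = a 0 := by
        simp [(Fin.succ_ne_zero i).symm]
      simp [h, h0]
  map_update_smul' {dec} a i c x := by
    obtain rfl : dec = instDecidableEqFin (n + 1) := Subsingleton.elim _ _
    refine Fin.cases ?_ (fun i => ?_) i
    · simp
    · have h (z : A) : (fun k : Fin n => Function.update a i.succ z k.succ) =
          Function.update (fun k => a k.succ) i z := by
        funext k; simp [Function.update_apply]
      have h0 (z : A) : Function.update a i.succ z 0 = a 0 := by
        simp [(Fin.succ_ne_zero i).symm]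
      simp [h, h0]

/-- The multilinear map `(a_1, …, a_{n+1}) ↦ f (a_1, …, a_n) a_{n+1}`. -/
def rightFace {n : ℕ} (f : B.Cochain n) : B.Cochain (n + 1) where
  toFun a := B.right (a (Fin.last n)) (f (fun k => a k.castSucc))
  map_update_add' {dec} a i x y := by
    obtain rfl : dec = instDecidableEqFin (n + 1) := Subsingleton.elim _ _
    refine Fin.lastCases ?_ (fun i => ?_) i
    · simp [Fin.castSucc_ne_last]
    · have h (z : A) : (fun k : Fin n => Function.update a i.castSucc z k.castSucc) =
          Function.update (fun k => a k.castSucc) i z := by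
        funext k; simp [Function.update_apply]
      have h0 (z : A) : Function.update a i.castSucc z (Fin.last n) = a (Fin.last n) := by
        simp [(Fin.castSucc_ne_last i).symm]
      simp [h, h0]
  map_update_smul' {dec} a i c x := by
    obtain rfl : dec = instDecidableEqFin (n + 1) := Subsingleton.elim _ _
    refine Fin.lastCases ?_ (fun i => ?_) i
    · simp [Fin.castSucc_ne_last]
    · have h (z : A) : (fun k : Fin n => Function.update a i.castSucc z k.castSucc) =
          Function.update (fun k => a k.castSucc) i z := by
        funext k; simp [Function.update_apply]
      have h0 (z : A) : Function.update a i.castSucc z (Fin.last n) = a (Fin.last n) := by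
        simp [(Fin.castSucc_ne_last i).symm]
      simp [h, h0]

/-- The Hochschild differential with coefficients in a bimodule. -/
def differential (n : ℕ) : B.Cochain n →ₗ[K] B.Cochain (n + 1) where
  toFun f := B.leftFace f + ∑ j : Fin n, (-1 : K) ^ ((j : ℕ) + 1) • B.innerFace j f +
    (-1 : K) ^ (n + 1) • B.rightFace f
  map_add' f g := by
    ext a
    simp only [leftFace, innerFace, rightFace, _root_.add_apply, _root_.sum_apply,
      _root_.smul_apply, MultilinearMap.coe_mk, map_add, smul_add,
      Finset.sum_add_distrib]
    abel
  map_smul' c f := by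
    ext a
    simp only [leftFace, innerFace, rightFace, _root_.add_apply, _root_.sum_apply,
      _root_.smul_apply, MultilinearMap.coe_mk, map_smul, smul_add,
      Finset.smul_sum, RingHom.id_apply, smul_comm c]

theorem differential_apply {n : ℕ} (f : B.Cochain n) (a : Fin (n + 1) → A) :
    B.differential n f a = B.left (a 0) (f (fun k => a k.succ)) +
      ∑ j : Fin n, (-1 : K) ^ ((j : ℕ) + 1) • f (Fin.contractNth j.castSucc (· * ·) a) +
      (-1 : K) ^ (n + 1) • B.right (a (Fin.last n)) (f (fun k => a k.castSucc)) := by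
  simp [differential, leftFace, innerFace, rightFace]

/-- The function `(b_0, …, b_{n+1}) ↦ b_0 f (b_1, …, b_n) b_{n+1}` attached to a cochain. -/
def sandwich {n : ℕ} (f : B.Cochain n) (b : Fin (n + 2) → A) : B.carrier :=
  B.right (b (Fin.last (n + 1))) (B.left (b 0) (f (fun k => b k.succ.castSucc)))

theorem sandwich_differential {n : ℕ} (f : B.Cochain n) (b : Fin (n + 3) → A) :
    B.sandwich (B.differential n f) b =
      ∑ j : Fin (n + 2), (-1 : K) ^ (j : ℕ) •
        B.sandwich f (Fin.contractNth j.castSucc (· * ·) b) := by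
  rw [Fin.sum_univ_succ, Fin.sum_univ_castSucc]
  simp only [sandwich, differential_apply, map_add, map_sum, map_smul]
  rw [add_assoc]
  congr 1
  · simp [Fin.contractNth, B.left_mul]
  congr 1
  · refine Finset.sum_congr rfl fun j _ => ?_
    have h : (fun k : Fin n => Fin.contractNth j.castSucc.succ.castSucc (· * ·) b
        k.succ.castSucc) =
        Fin.contractNth j.castSucc (· * ·) (fun k : Fin (n + 1) => b k.succ.castSucc) := by
      funext k
      simp [Fin.contractNth]
    rw [h]
    have h0 : Fin.contractNth j.castSucc.succ.castSucc (· * ·) b 0 = b 0 := by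
      simp [Fin.contractNth]
    have h1 : Fin.contractNth j.castSucc.succ.castSucc (· * ·) b (Fin.last (n + 1)) =
        b (Fin.last (n + 2)) := by
      rw [Fin.contractNth_apply_of_gt]
      · simp
      · simp
    rw [h0, h1]
    simp
  · have h : (fun k : Fin n => Fin.contractNth (Fin.last n).succ.castSucc (· * ·) b
        k.succ.castSucc) = fun k : Fin n => b k.castSucc.succ.castSucc := by
      funext k
      rw [Fin.contractNth_apply_of_lt]
      · simp
      · simp
    have h0 : Fin.contractNth (Fin.last n).succ.castSucc (· * ·) b 0 = b 0 := by
      simp [Fin.contractNth]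
    have h1 : Fin.contractNth (Fin.last n).succ.castSucc (· * ·) b (Fin.last (n + 1)) =
        b (Fin.last (n + 1)).castSucc * b (Fin.last (n + 2)) := by
      rw [Fin.contractNth_apply_of_eq]
      · simp
      · simp
    rw [h, h0, h1]
    simp [B.right_mul, B.left_right]

theorem sum_sum_contractNth_eq_zero {n : ℕ} (G : (Fin (n + 2) → A) → B.carrier)
    (b : Fin (n + 4) → A) :
    ∑ ij : Fin (n + 3) × Fin (n + 2), ((-1 : K) ^ (ij.1 : ℕ) * (-1 : K) ^ (ij.2 : ℕ)) •
      G (Fin.contractNth ij.2.castSucc (· * ·) (Fin.contractNth ij.1.castSucc (· * ·) b)) = 0 := by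
  let S : Finset (Fin (n + 3) × Fin (n + 2)) := {ij | (ij.1 : ℕ) ≤ (ij.2 : ℕ)}
  rw [← Finset.sum_add_sum_compl S, ← eq_neg_iff_add_eq_zero, ← Finset.sum_neg_distrib]
  refine Finset.sum_bij (fun ij hij => (ij.2.succ, ij.1.castLT
    (lt_of_le_of_lt (Finset.mem_filter.mp hij).2 ij.2.2))) ?_ ?_ ?_ ?_
  · rintro ⟨i, j⟩ hij
    simp only [S, Finset.compl_filter, Finset.mem_filter_univ, Fin.val_succ,
      Fin.val_castLT] at hij ⊢
    omega
  · rintro ⟨i, j⟩ hij ⟨i', j'⟩ hij' h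
    simp only [Prod.mk.injEq, Fin.ext_iff, Fin.val_succ, Fin.val_castLT] at h ⊢
    omega
  · rintro ⟨i, j⟩ hij
    simp only [S, Finset.compl_filter, Finset.mem_filter_univ, not_le] at hij
    refine ⟨(j.castSucc, i.pred ?_), ?_, ?_⟩
    · rintro rfl
      simp at hij
    · simp only [S, Finset.mem_filter_univ, Fin.val_castSucc, Fin.val_pred]
      omega
    · simp
  · rintro ⟨i, j⟩ hij
    simp only [S, Finset.mem_filter_univ] at hij
    rw [← neg_smul]
    congr 1
    · simp only [Fin.val_succ, Fin.val_castLT]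
      ring
    · rw [contractNth_contractNth _ mul_assoc b _ _
        (Fin.castSucc (i.castLT (lt_of_le_of_lt hij j.2))) (j.succ.castSucc) (by simp) (by simp)
        (by simpa using hij)]

theorem differential_comp_differential (n : ℕ) :
    B.differential (n + 1) ∘ₗ B.differential n = 0 := by
  ext f a
  have key : ∀ b : Fin (n + 4) → A,
      B.sandwich (B.differential (n + 1) (B.differential n f)) b = 0 := by
    intro b
    rw [sandwich_differential, ← B.sum_sum_contractNth_eq_zero (B.sandwich f) b,
      Fintype.sum_prod_type]
    refine Finset.sum_congr rfl fun i _ => ?_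
    rw [sandwich_differential, Finset.smul_sum]
    simp only [smul_smul]
  have h := key (Fin.cons 1 (Fin.snoc a 1))
  have e : (Fin.last (n + 3)) = (Fin.last (n + 2)).succ := rfl
  simp only [sandwich, Fin.cons_zero, B.left_one, e, Fin.cons_succ, Fin.snoc_last, B.right_one,
    ← Fin.succ_castSucc, Fin.snoc_castSucc] at h
  simpa using h

/-- The cochains of internal degree `r`. -/
def gradedCochain (r : ℤ) (n : ℕ) : Submodule K (B.Cochain n) where
  carrier := {f | ∀ (p : Fin n → ℕ) (a : Fin n → A), (∀ j, a j ∈ 𝒜 (p j)) →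
    f a ∈ B.component ((∑ j, p j : ℕ) + r)}
  add_mem' hf hg p a ha := add_mem (hf p a ha) (hg p a ha)
  zero_mem' _ _ _ := zero_mem _
  smul_mem' c _ hf p a ha := Submodule.smul_mem _ c (hf p a ha)

/-- Degree-preserving maps of bimodules. -/
structure Hom (B B' : GradedBimodule 𝒜) where
  /-- The underlying linear map. -/
  toLinearMap : B.carrier →ₗ[K] B'.carrier
  map_left : ∀ a x, toLinearMap (B.left a x) = B'.left a (toLinearMap x)
  map_right : ∀ a x, toLinearMap (B.right a x) = B'.right a (toLinearMap x)
  map_mem : ∀ m x, x ∈ B.component m → toLinearMap x ∈ B'.component m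

theorem Hom.differential_comp {B B' : GradedBimodule 𝒜} (φ : Hom B B') {n : ℕ} (f : B.Cochain n) :
    B'.differential n (φ.toLinearMap.compMultilinearMap f) =
      φ.toLinearMap.compMultilinearMap (B.differential n f) := by
  ext a
  simp [differential_apply, φ.map_left, φ.map_right]

variable [GradedAlgebra 𝒜]

theorem differential_mem_gradedCochain (r : ℤ) (n : ℕ) (f : B.Cochain n)
    (hf : f ∈ B.gradedCochain r n) : B.differential n f ∈ B.gradedCochain r (n + 1) := by
  intro p a ha
  rw [differential_apply]
  refine add_mem (add_mem ?_ (sum_mem fun j _ => Submodule.smul_mem _ _ ?_))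
    (Submodule.smul_mem _ _ ?_)
  · have h := B.left_mem _ _ _ _ (ha 0)
      (hf (fun k => p k.succ) (fun k => a k.succ) fun k => ha _)
    rw [Fin.sum_univ_succ]
    convert h using 2
    push_cast
    ring
  · have h := hf (Fin.contractNth j.castSucc (· + ·) p) (Fin.contractNth j.castSucc (· * ·) a)
      (fun k => by
        simp only [Fin.contractNth]
        split_ifs
        · exact ha _
        · exact SetLike.mul_mem_graded (ha _) (ha _)
        · exact ha _)
    rwa [sum_contractNth] at h
  · have h := B.right_mem _ _ _ _ (ha (Fin.last n))
      (hf (fun k => p k.castSucc) (fun k => a k.castSucc) fun k => ha _)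
    rw [Fin.sum_univ_castSucc]
    convert h using 2
    push_cast
    ring

/-- The differential on the cochains of internal degree `r`. -/
def gradedDifferential (r : ℤ) (n : ℕ) : B.gradedCochain r n →ₗ[K] B.gradedCochain r (n + 1) :=
  (B.differential n).restrict (B.differential_mem_gradedCochain r n)

/-- The complex of Hochschild cochains of internal degree `r`. -/
def complex (r : ℤ) : CochainComplex (ModuleCat.{u} K) ℕ :=
  CochainComplex.of (fun n => ModuleCat.of K (B.gradedCochain r n))
    (fun n => ModuleCat.ofHom (B.gradedDifferential r n))
    (fun n => by
      ext f : 2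
      exact Subtype.ext (LinearMap.congr_fun (B.differential_comp_differential n) f.1))

theorem complex_d (r : ℤ) (n : ℕ) :
    (B.complex r).d n (n + 1) = ModuleCat.ofHom (B.gradedDifferential r n) :=
  CochainComplex.of_d (fun n => ModuleCat.of K (B.gradedCochain r n))
    (fun n => ModuleCat.ofHom (B.gradedDifferential r n)) n

theorem complex_exactAt_zero_iff (r : ℤ) :
    (B.complex r).ExactAt 0 ↔
      ∀ f ∈ B.gradedCochain r 0, B.differential 0 f = 0 → f = 0 := by
  rw [HomologicalComplex.exactAt_iff' _ 0 0 1 (by simp) (by simp),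
    ShortComplex.moduleCat_exact_iff]
  have h0 : (B.complex r).d 0 0 = 0 := (B.complex r).shape _ _ (by simp)
  constructor
  · intro h f hf hd
    obtain ⟨x, hx⟩ := h ⟨f, hf⟩ (by
      change (ConcreteCategory.hom ((B.complex r).d 0 (0 + 1))) _ = 0
      rw [complex_d]
      exact Subtype.ext hd)
    change (ConcreteCategory.hom ((B.complex r).d 0 0)) x = _ at hx
    rw [h0] at hx
    exact (congrArg Subtype.val hx).symm
  · intro h f hf
    refine ⟨0, ?_⟩
    rw [map_zero]
    change (ConcreteCategory.hom ((B.complex r).d 0 (0 + 1))) _ = 0 at hf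
    rw [complex_d] at hf
    exact (Subtype.ext (h f.1 f.2 (congrArg Subtype.val hf))).symm

theorem complex_exactAt_succ_iff (r : ℤ) (n : ℕ) :
    (B.complex r).ExactAt (n + 1) ↔
      ∀ f ∈ B.gradedCochain r (n + 1), B.differential (n + 1) f = 0 →
        ∃ g ∈ B.gradedCochain r n, B.differential n g = f := by
  rw [HomologicalComplex.exactAt_iff' _ n (n + 1) (n + 2) (by simp) (by simp),
    ShortComplex.moduleCat_exact_iff]
  constructor
  · intro h f hf hd
    obtain ⟨x, hx⟩ := h ⟨f, hf⟩ (by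
      change (ConcreteCategory.hom ((B.complex r).d (n + 1) (n + 1 + 1))) _ = 0
      rw [complex_d]
      exact Subtype.ext hd)
    change (ConcreteCategory.hom ((B.complex r).d n (n + 1))) x = _ at hx
    rw [complex_d] at hx
    exact ⟨x.1, x.2, congrArg Subtype.val hx⟩
  · intro h f hf
    change (ConcreteCategory.hom ((B.complex r).d (n + 1) (n + 1 + 1))) _ = 0 at hf
    rw [complex_d] at hf
    obtain ⟨g, hg, e⟩ := h f.1 f.2 (congrArg Subtype.val hf)
    refine ⟨⟨g, hg⟩, ?_⟩
    change (ConcreteCategory.hom ((B.complex r).d n (n + 1))) _ = _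
    rw [complex_d]
    exact Subtype.ext e

/-- The cohomology in degree zero is the kernel of the first differential. -/
theorem nonempty_homology_zero_equiv (r : ℤ) :
    Nonempty ((B.complex r).homology 0 ≃ₗ[K] LinearMap.ker (B.gradedDifferential r 0)) := by
  let S := (B.complex r).sc' 0 0 1
  have hg : S.g = ModuleCat.ofHom (B.gradedDifferential r 0) := B.complex_d r 0
  have hf : S.f = 0 := (B.complex r).shape _ _ (by simp)
  have e1 : (B.complex r).homology 0 ≅ S.homology :=
    ShortComplex.homologyMapIso ((B.complex r).isoSc' 0 0 1 (by simp) (by simp))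
  have e2 : S.cycles ≅ S.homology := by
    have := S.isIso_homologyπ hf
    exact asIso S.homologyπ
  have e3 : LinearMap.ker S.g.hom ≃ₗ[K] LinearMap.ker (B.gradedDifferential r 0) :=
    LinearEquiv.ofEq _ _ (by rw [hg]; rfl)
  exact ⟨(e1 ≪≫ e2.symm ≪≫ S.moduleCatCyclesIso).toLinearEquiv.trans e3⟩

variable {B} {B' B'' : GradedBimodule 𝒜}

/-- The map on cochains induced by a map of bimodules. -/
def Hom.mapCochain (φ : Hom B B') (r : ℤ) (n : ℕ) :
    B.gradedCochain r n →ₗ[K] B'.gradedCochain r n where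
  toFun f := ⟨φ.toLinearMap.compMultilinearMap f.1,
    fun p a ha => φ.map_mem _ _ (f.2 p a ha)⟩
  map_add' f g := by ext; simp
  map_smul' c f := by ext; simp

/-- The map of complexes induced by a map of bimodules. -/
def Hom.mapComplex (φ : Hom B B') (r : ℤ) : B.complex r ⟶ B'.complex r :=
  CochainComplex.ofHom (fun n => ModuleCat.ofHom (φ.mapCochain r n)) (fun n => by
    rw [complex_d, complex_d]
    ext f : 2
    exact Subtype.ext (φ.differential_comp f.1))

/-- A sequence `B → B' → B''` of maps of bimodules that is short exact, together with degree
preserving linear splittings. -/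
structure SplitExact (φ : Hom B B') (ψ : Hom B' B'') where
  /-- A splitting of `φ`, as a linear map. -/
  retraction : B'.carrier →ₗ[K] B.carrier
  /-- A splitting of `ψ`, as a linear map. -/
  sectionMap : B''.carrier →ₗ[K] B'.carrier
  injective : Function.Injective φ.toLinearMap
  comp_eq_zero : ∀ x, ψ.toLinearMap (φ.toLinearMap x) = 0
  retraction_spec : ∀ x, ψ.toLinearMap x = 0 → φ.toLinearMap (retraction x) = x
  retraction_mem : ∀ m x, x ∈ B'.component m → ψ.toLinearMap x = 0 → retraction x ∈ B.component m
  sectionMap_spec : ∀ x, ψ.toLinearMap (sectionMap x) = x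
  sectionMap_mem : ∀ m x, x ∈ B''.component m → sectionMap x ∈ B'.component m

variable {φ : Hom B B'} {ψ : Hom B' B''} (h : SplitExact φ ψ) (r : ℤ)

theorem SplitExact.mapComplex_comp (h : SplitExact φ ψ) (r : ℤ) :
    φ.mapComplex r ≫ ψ.mapComplex r = 0 := by
  ext n f : 3
  refine Subtype.ext (MultilinearMap.ext fun a => ?_)
  exact h.comp_eq_zero _

/-- The short complex of Hochschild complexes of a short exact sequence of bimodules. -/
def SplitExact.shortComplex : ShortComplex (CochainComplex (ModuleCat.{u} K) ℕ) :=
  ShortComplex.mk (φ.mapComplex r) (ψ.mapComplex r) (h.mapComplex_comp r)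

theorem SplitExact.shortExact : (h.shortComplex r).ShortExact := by
  refine HomologicalComplex.shortExact_of_degreewise_shortExact _ fun n =>
    ModuleCat.shortComplex_shortExact _ ?_ ?_ ?_
  · intro f
    constructor
    · intro hf
      have hf' : ∀ a, ψ.toLinearMap (f.1 a) = 0 := fun a =>
        congrArg (fun g => g.1 a) hf
      refine ⟨⟨h.retraction.compMultilinearMap f.1, fun p a ha =>
        h.retraction_mem _ _ (f.2 p a ha) (hf' a)⟩, ?_⟩
      exact Subtype.ext (MultilinearMap.ext fun a => h.retraction_spec _ (hf' a))
    · rintro ⟨g, rfl⟩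
      exact Subtype.ext (MultilinearMap.ext fun a => h.comp_eq_zero _)
  · intro f g hfg
    refine Subtype.ext (MultilinearMap.ext fun a => h.injective ?_)
    exact congrArg (fun g => g.1 a) hfg
  · intro f
    refine ⟨⟨h.sectionMap.compMultilinearMap f.1, fun p a ha =>
        h.sectionMap_mem _ _ (f.2 p a ha)⟩, ?_⟩
    exact Subtype.ext (MultilinearMap.ext fun a => h.sectionMap_spec _)

end GradedBimodule

end GradedHochschild

end

noncomputable section

open CategoryTheory

namespace GradedHochschild

variable {K : Type v} {A : Type u} [Field K] [Ring A] [Algebra K A]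

/-- A character of the algebra that vanishes in positive degrees. -/
structure Augmentation (𝒜 : ℕ → Submodule K A) where
  /-- The underlying algebra map. -/
  toAlgHom : A →ₐ[K] K
  map_eq_zero : ∀ p a, p ≠ 0 → a ∈ 𝒜 p → toAlgHom a = 0

/-- A left module over a graded algebra, with a family of homogeneous components. -/
structure GradedLeftModule (𝒜 : ℕ → Submodule K A) where
  /-- The underlying module. -/
  carrier : Type u
  [addCommGroup : AddCommGroup carrier]
  [moduleField : Module K carrier]
  [module : Module A carrier]
  [isScalarTower : IsScalarTower K A carrier]
  /-- The homogeneous components. -/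
  component : ℕ → Submodule K carrier
  smul_mem : ∀ i j (a : A) x, a ∈ 𝒜 i → x ∈ component j → a • x ∈ component (i + j)

attribute [instance] GradedLeftModule.addCommGroup GradedLeftModule.moduleField
  GradedLeftModule.module GradedLeftModule.isScalarTower

variable {𝒜 : ℕ → Submodule K A}

/-- The bimodule `Hom_K(N, W)`, where `A` acts on the left through the augmentation and on the
right through `N`. A map is homogeneous of degree `m` if it is supported in degree `-m`. -/
def homBimodule (ε : Augmentation 𝒜) (N : GradedLeftModule 𝒜) (W : Type u) [AddCommGroup W]
    [Module K W] : GradedBimodule 𝒜 where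
  carrier := N.carrier →ₗ[K] W
  left := LinearMap.mk₂ K (fun a φ => ε.toAlgHom a • φ) (by intros; simp [add_smul])
    (by intros; simp [mul_smul]) (by intros; simp) (fun c a φ => smul_comm _ _ _)
  right := LinearMap.mk₂ K (fun a φ => φ ∘ₗ Algebra.lsmul K K N.carrier a)
    (by intros; ext; simp) (by intros; ext; simp)
    (by intros; ext; simp) (by intros; ext; simp)
  left_one x := by simp
  right_one x := by ext; simp
  left_mul a b x := by
    simp only [LinearMap.mk₂_apply, map_mul, mul_smul]
  right_mul a b x := by ext; simp
  left_right a b x := by ext; simp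
  component m :=
    { carrier := {φ | ∀ q : ℕ, (q : ℤ) ≠ -m → ∀ x ∈ N.component q, φ x = 0}
      add_mem' := fun h h' q hq x hx => by simp [h q hq x hx, h' q hq x hx]
      zero_mem' := fun _ _ _ _ => rfl
      smul_mem' := fun c _ h q hq x hx => by simp [h q hq x hx] }
  left_mem p m a φ ha hφ := by
    by_cases hp : p = 0
    · subst hp
      simpa using Submodule.smul_mem _ _ hφ
    · simp [ε.map_eq_zero p a hp ha]
  right_mem p m a φ ha hφ := by
    intro q hq x hx
    refine hφ (p + q) (fun h => hq ?_) (a • x) (N.smul_mem _ _ _ _ ha hx)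
    push_cast at h
    linarith

section

variable (ε : Augmentation 𝒜) (N : GradedLeftModule 𝒜) (W : Type u) [AddCommGroup W] [Module K W]

/-- Evaluation of the elements of `homBimodule ε N W`. -/
def homEval (x : N.carrier) : (homBimodule ε N W).carrier →ₗ[K] W := LinearMap.applyₗ x

@[simp]
theorem homEval_left (a : A) (φ : (homBimodule ε N W).carrier) (x : N.carrier) :
    homEval ε N W x ((homBimodule ε N W).left a φ) = ε.toAlgHom a • homEval ε N W x φ := rfl

@[simp]
theorem homEval_right (a : A) (φ : (homBimodule ε N W).carrier) (x : N.carrier) :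
    homEval ε N W x ((homBimodule ε N W).right a φ) = homEval ε N W (a • x) φ := rfl

variable {ε N W}

theorem homEval_ext {φ ψ : (homBimodule ε N W).carrier}
    (h : ∀ x, homEval ε N W x φ = homEval ε N W x ψ) : φ = ψ :=
  LinearMap.ext h

theorem intComponent_of_neg {m : ℤ} (hm : m < 0) : intComponent 𝒜 m = ⊥ := by
  cases m with
  | ofNat m => exact absurd hm (by simp)
  | negSucc m => rfl

end

variable [GradedAlgebra 𝒜]

variable (𝒜) in
/-- The free module on a family of generators in degree `s`. -/
def freeModule (ι : Type u) (s : ℕ) : GradedLeftModule 𝒜 where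
  carrier := ι →₀ A
  component q :=
    { carrier := {x | ∀ i, x i ∈ intComponent 𝒜 ((q : ℤ) - s)}
      add_mem' := fun h h' i => add_mem (h i) (h' i)
      zero_mem' := fun i => zero_mem _
      smul_mem' := fun c x h i => Submodule.smul_mem _ c (h i) }
  smul_mem p q a x ha hx i := by
    have := mul_mem_intComponent_left 𝒜 ha (hx i)
    push_cast
    rwa [add_sub_assoc]

variable (𝒜) in
/-- The multiple `c • e i` of a generator of a free module. -/
def freeSingle {ι : Type u} (s : ℕ) (i : ι) (c : A) : (freeModule 𝒜 ι s).carrier :=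
  Finsupp.single i c

theorem smul_freeSingle {ι : Type u} (s : ℕ) (i : ι) (b c : A) :
    b • freeSingle 𝒜 s i c = freeSingle 𝒜 s i (b * c) :=
  Finsupp.smul_single _ _ _

theorem freeSingle_mem {ι : Type u} {s p : ℕ} {a : A} (ha : a ∈ 𝒜 p) (i : ι) :
    freeSingle 𝒜 s i a ∈ (freeModule 𝒜 ι s).component (p + s) := by
  classical
  intro j
  rw [show (((p + s : ℕ) : ℤ) - s) = (p : ℤ) by push_cast; ring, freeSingle, Finsupp.single_apply]
  split_ifs
  · exact ha
  · exact zero_mem _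

theorem freeSingle_one_mem {ι : Type u} (s : ℕ) (i : ι) :
    freeSingle 𝒜 s i 1 ∈ (freeModule 𝒜 ι s).component s := by
  simpa using freeSingle_mem (s := s) (SetLike.GradedOne.one_mem (A := 𝒜)) i

section Free

variable (ε : Augmentation 𝒜) (ι : Type u) (s : ℕ) (W : Type u) [AddCommGroup W] [Module K W]

/-- The map `g ↦ (x ↦ ∑ i, g (x i) (e i))`, which induces a contraction of the Hochschild complex
with coefficients in `Hom_K(F, W)` for `F` free. -/
def freeContraction : (A →ₗ[K] ((ι →₀ A) →ₗ[K] W)) →ₗ[K] ((ι →₀ A) →ₗ[K] W) where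
  toFun g := Finsupp.lsum K fun i => g.flip (Finsupp.single i 1)
  map_add' g g' := by ext; simp
  map_smul' c g := by ext; simp

theorem freeContraction_single (g : A →ₗ[K] ((ι →₀ A) →ₗ[K] W)) (i : ι) (c : A) :
    freeContraction ι W g (Finsupp.single i c) = g c (Finsupp.single i 1) := by
  simp [freeContraction]

theorem freeContraction_apply (g : A →ₗ[K] ((ι →₀ A) →ₗ[K] W)) (x : ι →₀ A) :
    freeContraction ι W g x = x.sum fun i c => g c (Finsupp.single i 1) := rfl

/-- The contraction on cochains. -/
def freeHomotopy {n : ℕ} (f : (homBimodule ε (freeModule 𝒜 ι s) W).Cochain (n + 1)) :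
    (homBimodule ε (freeModule 𝒜 ι s) W).Cochain n :=
  (freeContraction ι W).compMultilinearMap (MultilinearMap.curryRight (M := fun _ => A) f)

variable {ε ι s W} in
theorem homEval_freeModule_ext {φ ψ : (homBimodule ε (freeModule 𝒜 ι s) W).carrier}
    (h : ∀ i c, homEval ε (freeModule 𝒜 ι s) W (freeSingle 𝒜 s i c) φ =
      homEval ε (freeModule 𝒜 ι s) W (freeSingle 𝒜 s i c) ψ) : φ = ψ :=
  Finsupp.lhom_ext h

theorem freeHomotopy_apply_single {n : ℕ}
    (f : (homBimodule ε (freeModule 𝒜 ι s) W).Cochain (n + 1)) (a : Fin n → A) (i : ι) (c : A) :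
    homEval ε (freeModule 𝒜 ι s) W (freeSingle 𝒜 s i c) (freeHomotopy ε ι s W f a) =
      homEval ε (freeModule 𝒜 ι s) W (freeSingle 𝒜 s i 1) (f (Fin.snoc a c)) :=
  freeContraction_single ι W _ i c

theorem freeHomotopy_mem {n : ℕ} {r : ℤ}
    {f : (homBimodule ε (freeModule 𝒜 ι s) W).Cochain (n + 1)}
    (hf : f ∈ (homBimodule ε (freeModule 𝒜 ι s) W).gradedCochain r (n + 1)) :
    freeHomotopy ε ι s W f ∈ (homBimodule ε (freeModule 𝒜 ι s) W).gradedCochain r n := by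
  intro p a ha q hq (x : ι →₀ A) hx
  refine (freeContraction_apply ι W _ x).trans (Finset.sum_eq_zero fun i _ => ?_)
  rcases lt_or_ge q s with hqs | hqs
  · have : x i = 0 := by
      have := hx i
      rwa [intComponent_of_neg (by lia)] at this
    simp [this]
  · obtain ⟨k, rfl⟩ := Nat.exists_eq_add_of_le hqs
    have hk : x i ∈ 𝒜 k := by
      have := hx i
      rwa [show (((s + k : ℕ) : ℤ) - s) = (k : ℤ) by push_cast; ring] at this
    refine hf (Fin.snoc p k) (Fin.snoc a (x i)) (fun j => ?_) s (fun h => hq ?_)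
      (freeSingle 𝒜 s i 1) (freeSingle_one_mem s i)
    · refine Fin.lastCases ?_ (fun j => ?_) j
      · simpa using hk
      · simpa using ha j
    · simp only [Fin.sum_univ_castSucc, Fin.snoc_castSucc, Fin.snoc_last] at h
      push_cast at h ⊢
      linarith

theorem contractNth_castSucc_snoc {n : ℕ} (a : Fin (n + 1) → A) (c : A) (j : Fin n) :
    Fin.contractNth j.castSucc.castSucc (· * ·) (Fin.snoc a c : Fin (n + 2) → A) =
      (Fin.snoc (Fin.contractNth j.castSucc (· * ·) a) c : Fin (n + 1) → A) := by
  funext k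
  refine Fin.lastCases ?_ (fun k => ?_) k
  · rw [Fin.contractNth_apply_of_gt _ _ _ _ (by simp)]
    simp
  · simp only [Fin.contractNth, Fin.snoc_castSucc, Fin.val_castSucc, ← Fin.castSucc_succ]

theorem contractNth_last_snoc {n : ℕ} (a : Fin (n + 1) → A) (c : A) :
    Fin.contractNth (Fin.last n).castSucc (· * ·) (Fin.snoc a c : Fin (n + 2) → A) =
      (Fin.snoc (fun k : Fin n => a k.castSucc) (a (Fin.last n) * c) : Fin (n + 1) → A) := by
  funext k
  refine Fin.lastCases ?_ (fun k => ?_) k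
  · rw [Fin.contractNth_apply_of_eq _ _ _ _ (by simp)]
    simp
  · rw [Fin.contractNth_apply_of_lt _ _ _ _ (by simp)]
    simp

theorem differential_freeHomotopy {n : ℕ}
    (f : (homBimodule ε (freeModule 𝒜 ι s) W).Cochain (n + 1))
    (hf : (homBimodule ε (freeModule 𝒜 ι s) W).differential (n + 1) f = 0) :
    (homBimodule ε (freeModule 𝒜 ι s) W).differential n (freeHomotopy ε ι s W f) =
      (-1 : K) ^ (n + 1) • f := by
  ext a
  refine homEval_freeModule_ext fun i c => ?_
  have h : homEval ε (freeModule 𝒜 ι s) W (freeSingle 𝒜 s i 1)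
      ((homBimodule ε (freeModule 𝒜 ι s) W).differential (n + 1) f (Fin.snoc a c)) = 0 := by
    rw [hf]
    simp
  have e3 : (fun k : Fin (n + 1) => (Fin.snoc a c : Fin (n + 2) → A) k.succ) =
      (Fin.snoc (fun k : Fin n => a k.succ) c : Fin (n + 1) → A) := by
    funext k
    refine Fin.lastCases ?_ (fun k => ?_) k
    · rw [Fin.succ_last]
      simp
    · rw [Fin.succ_castSucc, Fin.snoc_castSucc, Fin.snoc_castSucc]
  have e4 : (Fin.snoc a c : Fin (n + 2) → A) 0 = a 0 := by
    rw [← Fin.castSucc_zero, Fin.snoc_castSucc]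
  rw [GradedBimodule.differential_apply, Fin.sum_univ_castSucc] at h
  simp only [contractNth_castSucc_snoc, contractNth_last_snoc, map_add, map_sum, map_smul,
    homEval_left, homEval_right,
    Fin.snoc_last, Fin.snoc_castSucc, smul_freeSingle, mul_one, e3, e4, Fin.val_castSucc, Fin.val_last] at h
  rw [GradedBimodule.differential_apply]
  simp only [map_add, map_sum, map_smul,
    homEval_left, homEval_right,
    freeHomotopy_apply_single, smul_freeSingle, _root_.smul_apply]
  rw [← sub_eq_zero, ← h]
  simp only [pow_succ]
  module

theorem freeModule_exactAt (r : ℤ) (n : ℕ) :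
    ((homBimodule ε (freeModule 𝒜 ι s) W).complex r).ExactAt (n + 1) := by
  rw [GradedBimodule.complex_exactAt_succ_iff]
  intro f hf hd
  refine ⟨(-1 : K) ^ (n + 1) • freeHomotopy ε ι s W f,
    Submodule.smul_mem _ _ (freeHomotopy_mem ε ι s W hf), ?_⟩
  rw [map_smul, differential_freeHomotopy ε ι s W f hd, smul_smul, ← mul_pow]
  simp

end Free

end GradedHochschild

end

noncomputable section

open CategoryTheory

namespace GradedHochschild

section LongExactSequence

variable {K : Type v} [Field K] {S : ShortComplex (CochainComplex (ModuleCat.{u} K) ℕ)}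

theorem mono_homologyMap_zero (hS : S.ShortExact) :
    Mono (HomologicalComplex.homologyMap S.f 0) := by
  have := hS.mono_f
  have h0 (X : CochainComplex (ModuleCat.{u} K) ℕ) : IsIso (X.homologyπ 0) :=
    ShortComplex.isIso_homologyπ _ (X.shape _ _ (by simp))
  have := h0 S.X₁
  have := h0 S.X₂
  have : Mono (HomologicalComplex.cyclesMap S.f 0 ≫ S.X₂.iCycles 0) := by
    rw [HomologicalComplex.cyclesMap_i]
    infer_instance
  have : Mono (HomologicalComplex.cyclesMap S.f 0) := mono_of_mono _ (S.X₂.iCycles 0)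
  have : Mono (S.X₁.homologyπ 0 ≫ HomologicalComplex.homologyMap S.f 0) := by
    rw [HomologicalComplex.homologyπ_naturality]
    infer_instance
  rw [show HomologicalComplex.homologyMap S.f 0 = inv (S.X₁.homologyπ 0) ≫
    (S.X₁.homologyπ 0 ≫ HomologicalComplex.homologyMap S.f 0) by simp]
  infer_instance

/-- The three dimension formulas of the long exact sequence, in terms of the ranks of the maps. -/
theorem exists_rank_longExactSequence (hS : S.ShortExact)
    (h₁ : ∀ i, Module.Finite K (S.X₁.homology i)) (h₃ : ∀ i, Module.Finite K (S.X₃.homology i)) :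
    (∀ i, Module.Finite K (S.X₂.homology i)) ∧ ∃ ρ : ℕ → ℕ, ρ 0 = 0 ∧
      (∀ i, ρ (i + 1) ≤ Module.finrank K (S.X₁.homology (i + 1))) ∧
      ∀ i, Module.finrank K (S.X₁.homology i) + Module.finrank K (S.X₃.homology i) =
        Module.finrank K (S.X₂.homology i) + ρ i + ρ (i + 1) := by
  have e₂ (i) : LinearMap.range (HomologicalComplex.homologyMap S.f i).hom =
      LinearMap.ker (HomologicalComplex.homologyMap S.g i).hom :=
    (hS.homology_exact₂ i).moduleCat_range_eq_ker
  have e₁ (i) : LinearMap.range (hS.δ i (i + 1) rfl).hom =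
      LinearMap.ker (HomologicalComplex.homologyMap S.f (i + 1)).hom :=
    (hS.homology_exact₁ i (i + 1) rfl).moduleCat_range_eq_ker
  have e₃ (i) : LinearMap.range (HomologicalComplex.homologyMap S.g i).hom =
      LinearMap.ker (hS.δ i (i + 1) rfl).hom :=
    (hS.homology_exact₃ i (i + 1) rfl).moduleCat_range_eq_ker
  have e₀ : LinearMap.ker (HomologicalComplex.homologyMap S.f 0).hom = ⊥ :=
    LinearMap.ker_eq_bot.2 ((ModuleCat.mono_iff_injective _).1 (mono_homologyMap_zero hS))
  have h₂ (i) : Module.Finite K (S.X₂.homology i) := by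
    have : Module.Finite K (LinearMap.ker (HomologicalComplex.homologyMap S.g i).hom) := by
      rw [← e₂]
      infer_instance
    have := Module.Finite.equiv
      (LinearMap.quotKerEquivRange (HomologicalComplex.homologyMap S.g i).hom).symm
    exact Module.Finite.of_submodule_quotient
      (LinearMap.ker (HomologicalComplex.homologyMap S.g i).hom)
  refine ⟨h₂, fun i => Module.finrank K
    (LinearMap.ker (HomologicalComplex.homologyMap S.f i).hom), ?_, ?_, ?_⟩
  · beta_reduce
    rw [e₀]
    simp
  · intro i
    exact Submodule.finrank_le _
  · intro i
    beta_reduce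
    have r₁ := LinearMap.finrank_range_add_finrank_ker (HomologicalComplex.homologyMap S.f i).hom
    have r₂ := LinearMap.finrank_range_add_finrank_ker (HomologicalComplex.homologyMap S.g i).hom
    have r₃ := LinearMap.finrank_range_add_finrank_ker (hS.δ i (i + 1) rfl).hom
    rw [e₂] at r₁
    rw [e₁, ← e₃] at r₃
    omega

theorem sum_finrank_homology (hS : S.ShortExact)
    (h₁ : ∀ i, Module.Finite K (S.X₁.homology i)) (h₃ : ∀ i, Module.Finite K (S.X₃.homology i))
    (D : ℕ) (hD : Module.finrank K (S.X₁.homology D) = 0) :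
    ∑ i ∈ Finset.range D, (-1 : ℤ) ^ i * (Module.finrank K (S.X₂.homology i) : ℤ) =
      ∑ i ∈ Finset.range D, (-1 : ℤ) ^ i * (Module.finrank K (S.X₁.homology i) : ℤ) +
      ∑ i ∈ Finset.range D, (-1 : ℤ) ^ i * (Module.finrank K (S.X₃.homology i) : ℤ) := by
  obtain ⟨-, ρ, hρ0, hρ, h⟩ := exists_rank_longExactSequence hS h₁ h₃
  have key : ∀ D, ∑ i ∈ Finset.range D, (-1 : ℤ) ^ i * (Module.finrank K (S.X₁.homology i) : ℤ) +
      ∑ i ∈ Finset.range D, (-1 : ℤ) ^ i * (Module.finrank K (S.X₃.homology i) : ℤ) =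
      ∑ i ∈ Finset.range D, (-1 : ℤ) ^ i * (Module.finrank K (S.X₂.homology i) : ℤ) -
        (-1) ^ D * ρ D := by
    intro D
    induction D with
    | zero => simp [hρ0]
    | succ D ih =>
      have := congrArg (fun n : ℕ => (n : ℤ)) (h D)
      push_cast at this
      simp only [Finset.sum_range_succ, pow_succ]
      linear_combination ih + (-1 : ℤ) ^ D * this
  have : ρ D = 0 := by
    cases D with
    | zero => exact hρ0
    | succ D => have := hρ D; omega
  rw [key, this]
  simp

end LongExactSequence

variable {K : Type v} {A : Type u} [Field K] [Ring A] [Algebra K A]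
variable {𝒜 : ℕ → Submodule K A} [GradedAlgebra 𝒜]

section DegreeZero

variable (ε : Augmentation 𝒜) {N : GradedLeftModule 𝒜} {W : Type u} [AddCommGroup W] [Module K W]

theorem homBimodule_differential_zero_eq_zero_iff {𝒜 : ℕ → Submodule K A}
    (ε : Augmentation 𝒜) {N : GradedLeftModule 𝒜} {W : Type u} [AddCommGroup W] [Module K W]
    (f : (homBimodule ε N W).Cochain 0) :
    (homBimodule ε N W).differential 0 f = 0 ↔
      ∀ a x, homEval ε N W (a • x) (f 0) = ε.toAlgHom a • homEval ε N W x (f 0) := by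
  constructor
  · intro h a x
    have := congrArg (homEval ε N W x) (DFunLike.congr_fun h fun _ => a)
    rw [GradedBimodule.differential_apply, Subsingleton.elim (fun k : Fin 0 => a) 0] at this
    simp only [Finset.univ_eq_empty, Finset.sum_empty, add_zero, zero_add, pow_one, neg_smul,
      one_smul, _root_.zero_apply, map_zero, ← sub_eq_add_neg] at this
    exact (sub_eq_zero.1 this).symm
  · intro h
    ext a
    refine homEval_ext fun x => ?_
    rw [GradedBimodule.differential_apply, Subsingleton.elim (fun k : Fin 0 => a k.succ) 0,
      Subsingleton.elim (fun k : Fin 0 => a k.castSucc) 0]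
    simp only [map_add, homEval_left, homEval_right, Finset.univ_eq_empty,
      Finset.sum_empty, add_zero, zero_add, pow_one, neg_smul, one_smul, map_neg,
      _root_.zero_apply, map_zero, h]
    exact add_neg_cancel _

theorem homBimodule_exactAt_zero {s : ℕ} (hN : Submodule.span A (N.component s : Set N.carrier) = ⊤)
    {r : ℤ} (hr : (s : ℤ) ≠ -r) : ((homBimodule ε N W).complex r).ExactAt 0 := by
  rw [GradedBimodule.complex_exactAt_zero_iff]
  intro f hf hd
  rw [homBimodule_differential_zero_eq_zero_iff] at hd
  ext a
  obtain rfl : a = 0 := Subsingleton.elim _ _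
  refine homEval_ext fun x => ?_
  have hx : x ∈ Submodule.span A (N.component s : Set N.carrier) := hN ▸ Submodule.mem_top
  change homEval ε N W x (f 0) = homEval ε N W x 0
  rw [(homEval ε N W x).map_zero]
  induction hx using Submodule.span_induction with
  | mem x hx => exact hf 0 0 (fun j => j.elim0) s (by simpa using hr) x hx
  | zero => exact (f 0 : N.carrier →ₗ[K] W).map_zero
  | add x y _ _ hx hy =>
    exact ((f 0 : N.carrier →ₗ[K] W).map_add x y).trans (by
      change homEval ε N W x (f 0) + homEval ε N W y (f 0) = 0
      rw [hx, hy, add_zero])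
  | smul a x _ hx => rw [hd, hx, smul_zero]

theorem freeModule_span (ι : Type u) (s : ℕ) :
    Submodule.span A ((freeModule 𝒜 ι s).component s : Set (freeModule 𝒜 ι s).carrier) = ⊤ := by
  rw [eq_top_iff]
  rintro (x : ι →₀ A) -
  induction x using Finsupp.induction_linear with
  | zero => exact zero_mem _
  | add x y hx hy => exact add_mem hx hy
  | single i a =>
    have : freeSingle 𝒜 s i a = a • freeSingle 𝒜 s i 1 := by rw [smul_freeSingle, mul_one]
    change freeSingle 𝒜 s i a ∈ _
    rw [this]
    exact Submodule.smul_mem _ _ (Submodule.subset_span (freeSingle_one_mem s i))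

theorem nonempty_freeModule_homology_zero_equiv (ι : Type u) (s : ℕ) :
    Nonempty (((homBimodule ε (freeModule 𝒜 ι s) W).complex (-(s : ℤ))).homology 0 ≃ₗ[K]
      (ι → W)) := by
  obtain ⟨e⟩ := (homBimodule ε (freeModule 𝒜 ι s) W).nonempty_homology_zero_equiv (-(s : ℤ))
  let B := homBimodule ε (freeModule 𝒜 ι s) W
  let T : LinearMap.ker (B.gradedDifferential (-(s : ℤ)) 0) →ₗ[K] (ι → W) :=
    { toFun := fun f i => homEval ε (freeModule 𝒜 ι s) W (freeSingle 𝒜 s i 1) (f.1.1 0)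
      map_add' := fun f g => by ext; simp
      map_smul' := fun c f => by ext; simp }
  refine ⟨e.trans (LinearEquiv.ofBijective T ⟨?_, ?_⟩)⟩
  · intro f g hfg
    have hd (f : LinearMap.ker (B.gradedDifferential (-(s : ℤ)) 0)) :=
      (homBimodule_differential_zero_eq_zero_iff ε f.1.1).1 (congrArg Subtype.val f.2)
    refine Subtype.ext (Subtype.ext (MultilinearMap.ext fun a => ?_))
    obtain rfl : a = 0 := Subsingleton.elim _ _
    refine homEval_freeModule_ext fun i c => ?_
    have : freeSingle 𝒜 s i c = c • freeSingle 𝒜 s i 1 := by rw [smul_freeSingle, mul_one]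
    rw [this, hd, hd]
    congr 1
    exact congrFun hfg i
  · intro w
    let φ : (ι →₀ A) →ₗ[K] W := Finsupp.lsum K fun i => ε.toAlgHom.toLinearMap.smulRight (w i)
    have hφ (x : ι →₀ A) : φ x = x.sum fun i c => ε.toAlgHom c • w i := rfl
    let f : B.Cochain 0 := MultilinearMap.constOfIsEmpty K _ φ
    have hf : f ∈ B.gradedCochain (-(s : ℤ)) 0 := by
      intro p a ha q hq (x : ι →₀ A) hx
      refine (hφ x).trans (Finset.sum_eq_zero fun i _ => ?_)
      have hq : q ≠ s := fun h => hq (by simp [h])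
      rcases lt_or_ge q s with hqs | hqs
      · have : x i = 0 := by
          have := hx i
          rwa [intComponent_of_neg (by lia)] at this
        simp [this]
      · obtain ⟨k, rfl⟩ := Nat.exists_eq_add_of_le hqs
        have hk : x i ∈ 𝒜 k := by
          have := hx i
          rwa [show (((s + k : ℕ) : ℤ) - s) = (k : ℤ) by push_cast; ring] at this
        beta_reduce
        rw [ε.map_eq_zero k _ (by omega) hk, zero_smul]
    have hd : B.differential 0 f = 0 := by
      rw [homBimodule_differential_zero_eq_zero_iff]
      intro a (x : ι →₀ A)
      change φ (a • x) = ε.toAlgHom a • φ x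
      induction x using Finsupp.induction_linear with
      | zero => simp
      | add x y hx hy => rw [smul_add, map_add, map_add, hx, hy, smul_add]
      | single i c =>
        have h (c : A) : φ (Finsupp.single i c) = ε.toAlgHom c • w i := by simp [φ]
        rw [Finsupp.smul_single, h, h, smul_eq_mul, map_mul, mul_smul]
    refine ⟨⟨⟨f, hf⟩, Subtype.ext hd⟩, ?_⟩
    funext i
    change φ (Finsupp.single i 1) = w i
    simp [φ]

end DegreeZero

section DimensionShift

/-- A short exact sequence `0 → Ω → P → N → 0` of graded modules, where the map `P → N` has a
degree preserving linear section. -/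
structure GradedShortExact (Ω P N : GradedLeftModule 𝒜) where
  /-- The inclusion of the kernel. -/
  incl : Ω.carrier →ₗ[A] P.carrier
  /-- The projection. -/
  proj : P.carrier →ₗ[A] N.carrier
  /-- The linear section. -/
  sectionMap : N.carrier →ₗ[K] P.carrier
  incl_injective : Function.Injective incl
  exact : Function.Exact incl proj
  proj_section : ∀ x, proj (sectionMap x) = x
  mem_iff : ∀ q x, x ∈ Ω.component q ↔ incl x ∈ P.component q
  proj_mem : ∀ q x, x ∈ P.component q → proj x ∈ N.component q
  section_mem : ∀ q x, x ∈ N.component q → sectionMap x ∈ P.component q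

variable (ε : Augmentation 𝒜) {Ω P N : GradedLeftModule 𝒜} (W : Type u) [AddCommGroup W]
  [Module K W]

variable {ε W} in
/-- The elements of `homBimodule ε N W` as linear maps. -/
def homToLinearMap (φ : (homBimodule ε N W).carrier) : N.carrier →ₗ[K] W := φ

/-- Functoriality of `homBimodule`. -/
def homBimoduleMap (g : P.carrier →ₗ[A] N.carrier)
    (hg : ∀ q x, x ∈ P.component q → g x ∈ N.component q) :
    GradedBimodule.Hom (homBimodule ε N W) (homBimodule ε P W) where
  toLinearMap := LinearMap.lcomp K W (g.restrictScalars K)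
  map_left _ _ := rfl
  map_right a φ := LinearMap.ext fun x =>
    congrArg (homToLinearMap φ) (g.map_smul a x).symm
  map_mem _ _ hφ q hq x hx := hφ q hq _ (hg q x hx)

namespace GradedShortExact

theorem exists_retraction {𝒜 : ℕ → Submodule K A} {Ω P N : GradedLeftModule 𝒜}
    (h : GradedShortExact Ω P N) : ∃ π : P.carrier →ₗ[K] Ω.carrier,
    ∀ x, h.incl (π x) = x - h.sectionMap (h.proj x) := by
  let ρ : P.carrier →ₗ[K] P.carrier :=
    LinearMap.id - h.sectionMap ∘ₗ h.proj.restrictScalars K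
  have hρ (x) : ρ x ∈ LinearMap.range (h.incl.restrictScalars K) := by
    obtain ⟨y, hy⟩ := (h.exact (ρ x)).1 (by simp [ρ, h.proj_section])
    exact ⟨y, hy⟩
  let e := LinearEquiv.ofInjective (h.incl.restrictScalars K) h.incl_injective
  refine ⟨e.symm.toLinearMap ∘ₗ ρ.codRestrict _ hρ, fun x => ?_⟩
  exact congrArg Subtype.val (e.apply_symm_apply (ρ.codRestrict _ hρ x))

/-- The short exact sequence of bimodules attached to a short exact sequence of modules. -/
def splitExact (h : GradedShortExact Ω P N) : GradedBimodule.SplitExact (homBimoduleMap ε W h.proj h.proj_mem)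
    (homBimoduleMap ε W h.incl fun q x => (h.mem_iff q x).1) where
  retraction := LinearMap.lcomp K W h.sectionMap
  sectionMap := LinearMap.lcomp K W h.exists_retraction.choose
  injective φ ψ hφψ := LinearMap.ext fun x => by
    have := LinearMap.congr_fun hφψ (h.sectionMap x)
    change homToLinearMap φ (h.proj _) = homToLinearMap ψ (h.proj _) at this
    rwa [h.proj_section] at this
  comp_eq_zero φ := LinearMap.ext fun x =>
    (congrArg (homToLinearMap φ) (h.exact.apply_apply_eq_zero x)).trans (map_zero (homToLinearMap φ))
  retraction_spec φ hφ := LinearMap.ext fun x => by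
    have hφ' (y) : homToLinearMap φ (h.incl y) = 0 := LinearMap.congr_fun hφ y
    have := hφ' (h.exists_retraction.choose x)
    rw [h.exists_retraction.choose_spec, map_sub, sub_eq_zero] at this
    exact this.symm
  retraction_mem m φ hφ _ q hq x hx := hφ q hq _ (h.section_mem q x hx)
  sectionMap_spec φ := LinearMap.ext fun x => by
    refine congrArg (homToLinearMap φ) (h.incl_injective ?_)
    change h.incl (h.exists_retraction.choose (h.incl x)) = _
    rw [h.exists_retraction.choose_spec, h.exact.apply_apply_eq_zero]
    simp
  sectionMap_mem m φ hφ q hq x hx := by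
    refine hφ q hq _ ((h.mem_iff q _).2 ?_)
    rw [h.exists_retraction.choose_spec]
    exact sub_mem hx (h.section_mem _ _ (h.proj_mem _ _ hx))

theorem nonempty_homology_succ_equiv {ι : Type u} {s : ℕ}
    (h : GradedShortExact Ω (freeModule 𝒜 ι s) N)
    (hΩ : Submodule.span A (Ω.component (s + 1) : Set Ω.carrier) = ⊤) (r : ℤ) (n : ℕ) :
    Nonempty (((homBimodule ε N W).complex r).homology (n + 1) ≃ₗ[K]
      ((homBimodule ε Ω W).complex r).homology n) := by
  have hS := (h.splitExact ε W).shortExact r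
  have hP (n) : Limits.IsZero (((homBimodule ε (freeModule 𝒜 ι s) W).complex r).homology (n + 1)) :=
    (HomologicalComplex.exactAt_iff_isZero_homology _ _).1 (freeModule_exactAt ε ι s W r n)
  by_cases hn : n = 0 ∧ (s : ℤ) = -r
  · obtain ⟨rfl, hr⟩ := hn
    have hΩ0 : Limits.IsZero (((homBimodule ε Ω W).complex r).homology 0) :=
      (HomologicalComplex.exactAt_iff_isZero_homology _ _).1
        (homBimodule_exactAt_zero ε hΩ (by push_cast; lia))
    have hepi := hS.epi_δ 0 1 rfl (hP 0)
    have hN1 : Limits.IsZero (((homBimodule ε N W).complex r).homology 1) :=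
      @Limits.IsZero.of_epi _ _ _ _ _ (hS.δ 0 1 rfl) hepi hΩ0
    exact ⟨(hN1.iso hΩ0).toLinearEquiv⟩
  · have hPn : Limits.IsZero (((homBimodule ε (freeModule 𝒜 ι s) W).complex r).homology n) := by
      cases n with
      | zero =>
        exact (HomologicalComplex.exactAt_iff_isZero_homology _ _).1
          (homBimodule_exactAt_zero ε (freeModule_span ι s) fun hr => hn ⟨rfl, hr⟩)
      | succ n => exact hP n
    exact ⟨(hS.δIso n (n + 1) rfl hPn (hP n)).symm.toLinearEquiv⟩

theorem nonempty_homology_zero_equiv {ι : Type u} {s : ℕ}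
    (h : GradedShortExact Ω (freeModule 𝒜 ι s) N)
    (hΩ : Submodule.span A (Ω.component (s + 1) : Set Ω.carrier) = ⊤) :
    Nonempty (((homBimodule ε N W).complex (-(s : ℤ))).homology 0 ≃ₗ[K] (ι → W)) := by
  have hS := (h.splitExact ε W).shortExact (-(s : ℤ))
  have hΩ0 : Limits.IsZero (((homBimodule ε Ω W).complex (-(s : ℤ))).homology 0) :=
    (HomologicalComplex.exactAt_iff_isZero_homology _ _).1
      (homBimodule_exactAt_zero ε hΩ (by push_cast; lia))
  have h1 := mono_homologyMap_zero hS
  have h2 := (hS.homology_exact₂ 0).epi_f (hΩ0.eq_of_tgt _ _)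
  have h3 := isIso_of_mono_of_epi
    (HomologicalComplex.homologyMap ((h.splitExact ε W).shortComplex (-(s : ℤ))).f 0)
  obtain ⟨e⟩ := nonempty_freeModule_homology_zero_equiv (W := W) ε ι s
  exact ⟨(asIso (HomologicalComplex.homologyMap
    ((h.splitExact ε W).shortComplex (-(s : ℤ))).f 0)).toLinearEquiv.trans e⟩

end GradedShortExact

end DimensionShift

end GradedHochschild

end

noncomputable section

open CategoryTheory

namespace GradedHochschild

variable {K : Type v} {A : Type u} [Field K] [Ring A] [Algebra K A]
variable {𝒜 : ℕ → Submodule K A} [GradedAlgebra 𝒜]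

section Trivial

theorem smul_trivialModule_eq_zero {p : ℕ} (hp : p ≠ 0) {a : A} (ha : a ∈ 𝒜 p)
    (x : TrivialModule 𝒜) : a • x = 0 := by
  obtain ⟨b, rfl⟩ := Submodule.Quotient.mk_surjective _ x
  rw [← Submodule.Quotient.mk_smul, Submodule.Quotient.mk_eq_zero]
  change a * b ∈ HomogeneousIdeal.irrelevant 𝒜
  rw [HomogeneousIdeal.mem_irrelevant_iff]
  change GradedRing.projZeroRingHom 𝒜 (a * b) = 0
  rw [map_mul]
  convert zero_mul _
  exact DirectSum.decompose_of_mem_ne 𝒜 ha hp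

variable (𝒜) in
/-- The trivial module, placed in degree zero. -/
def trivialGradedModule : GradedLeftModule 𝒜 where
  carrier := TrivialModule 𝒜
  component q := if q = 0 then ⊤ else ⊥
  smul_mem p q a x ha hx := by
    by_cases hp : p = 0
    · subst hp
      rw [zero_add]
      split_ifs at hx ⊢ with hq
      · trivial
      · rw [(Submodule.mem_bot K).1 hx, smul_zero]
        exact zero_mem _
    · rw [smul_trivialModule_eq_zero hp ha]
      exact zero_mem _

end Trivial

section Glue

variable {ι : Type u} {t : ℕ}

theorem eq_zero_of_mem_freeModule_component {q : ℕ} (hq : q < t) {x : (freeModule 𝒜 ι t).carrier}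
    (hx : x ∈ (freeModule 𝒜 ι t).component q) : x = 0 := by
  refine Finsupp.ext (f := x) (g := 0) fun i => ?_
  have := hx i
  rwa [intComponent_of_neg (by lia)] at this

theorem apply_mem_of_mem_freeModule_component {k : ℕ} {x : ι →₀ A}
    (hx : x ∈ (freeModule 𝒜 ι t).component (k + t)) (i : ι) : x i ∈ 𝒜 k := by
  have := hx i
  rwa [show (((k + t : ℕ) : ℤ) - t) = (k : ℤ) by push_cast; ring] at this

/-- Linear maps on the homogeneous components of a free module glue to a linear map. -/
theorem exists_linearMap_freeModule {P : Type*} [AddCommGroup P] [Module K P]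
    (σ : ∀ q, (freeModule 𝒜 ι t).component q →ₗ[K] P) :
    ∃ s : (freeModule 𝒜 ι t).carrier →ₗ[K] P,
      ∀ q (x : (freeModule 𝒜 ι t).component q), s x.1 = σ q x := by
  classical
  let c (i : ι) (k : ℕ) : 𝒜 k →ₗ[K] (freeModule 𝒜 ι t).component (k + t) :=
    { toFun := fun a => ⟨freeSingle 𝒜 t i a.1, freeSingle_mem a.2 i⟩
      map_add' := fun a b => Subtype.ext (Finsupp.single_add i a.1 b.1)
      map_smul' := fun r a => Subtype.ext (Finsupp.smul_single r i a.1).symm }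
  let s : (ι →₀ A) →ₗ[K] P := Finsupp.lsum K fun i =>
    DirectSum.toModule K ℕ P (fun k => σ (k + t) ∘ₗ c i k) ∘ₗ
      (DirectSum.decomposeLinearEquiv 𝒜).toLinearMap
  have hs (i k) (a : 𝒜 k) : s (Finsupp.single i a.1) = σ (k + t) (c i k a) := by
    simp [s]
  refine ⟨s, fun q x => ?_⟩
  rcases lt_or_ge q t with hq | hq
  · have : x = 0 := Subtype.ext (eq_zero_of_mem_freeModule_component hq x.2)
    rw [this, map_zero]
    exact s.map_zero
  · obtain ⟨k, rfl⟩ := Nat.exists_eq_add_of_le' hq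
    obtain ⟨(x : ι →₀ A), hx⟩ := x
    have hxi := apply_mem_of_mem_freeModule_component hx
    have hsum : (⟨x, hx⟩ : (freeModule 𝒜 ι t).component (k + t)) =
        ∑ i ∈ x.support, c i k ⟨x i, hxi i⟩ := by
      refine Subtype.ext ?_
      rw [Submodule.coe_sum]
      exact (Finsupp.sum_single x).symm
    conv_rhs => rw [hsum, map_sum]
    simp only [← hs]
    change s x = _
    conv_lhs => rw [← Finsupp.sum_single x]
    exact map_sum s _ _

theorem exists_pseudoInverse {V V' : Type*} [AddCommGroup V] [Module K V] [AddCommGroup V']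
    [Module K V'] (g : V →ₗ[K] V') : ∃ σ : V' →ₗ[K] V, ∀ x, g (σ (g x)) = g x := by
  obtain ⟨τ, hτ⟩ := g.rangeRestrict.exists_rightInverse_of_surjective g.range_rangeRestrict
  obtain ⟨σ, hσ⟩ := LinearMap.exists_extend τ
  refine ⟨σ, fun x => ?_⟩
  have h1 : σ (g x) = τ (g.rangeRestrict x) := LinearMap.congr_fun hσ (g.rangeRestrict x)
  rw [h1]
  exact congrArg Subtype.val (LinearMap.congr_fun hτ (g.rangeRestrict x))

theorem freeModule_induction {p : (freeModule 𝒜 ι t).carrier → Prop} (zero : p 0)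
    (add : ∀ x y, p x → p y → p (x + y))
    (single : ∀ k i, ∀ a ∈ 𝒜 k, p (freeSingle 𝒜 t i a)) (x) : p x := by
  classical
  change ι →₀ A at x
  induction x using Finsupp.induction_linear with
  | zero => exact zero
  | add x y hx hy => exact add x y hx hy
  | single i a =>
    induction a using DirectSum.Decomposition.inductionOn 𝒜 with
    | zero => rw [Finsupp.single_zero]; exact zero
    | homogeneous a => exact single _ i a.1 a.2
    | add a b ha hb => rw [Finsupp.single_add]; exact add _ _ ha hb

/-- A degree preserving map to a free module has a degree preserving pseudo-inverse. -/
theorem exists_gradedPseudoInverse {ι' : Type u} {t' : ℕ}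
    (g : (freeModule 𝒜 ι' t').carrier →ₗ[K] (freeModule 𝒜 ι t).carrier)
    (hg : ∀ q x, x ∈ (freeModule 𝒜 ι' t').component q → g x ∈ (freeModule 𝒜 ι t).component q) :
    ∃ s : (freeModule 𝒜 ι t).carrier →ₗ[K] (freeModule 𝒜 ι' t').carrier,
      (∀ q x, x ∈ (freeModule 𝒜 ι t).component q → s x ∈ (freeModule 𝒜 ι' t').component q) ∧
      ∀ x, g (s (g x)) = g x := by
  choose σ hσ using fun q => exists_pseudoInverse (g.restrict (hg q))
  obtain ⟨s, hs⟩ := exists_linearMap_freeModule fun q => Submodule.subtype _ ∘ₗ σ q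
  refine ⟨s, fun q x hx => ?_, fun x => ?_⟩
  · rw [hs q ⟨x, hx⟩]
    exact (σ q ⟨x, hx⟩).2
  · induction x using freeModule_induction with
    | zero => simp
    | add x y hx hy => simp [hx, hy]
    | single k i a ha =>
      have hx := freeSingle_mem (s := t') ha i
      rw [hs (k + t') ⟨g (freeSingle 𝒜 t' i a), hg _ _ hx⟩]
      exact congrArg Subtype.val (hσ _ ⟨_, hx⟩)

end Glue

variable (𝒜) in
/-- A linear free resolution of the trivial module: the `n`-th module is free on generators of
degree `n`, so that the entries of the matrices of the differentials have degree one. -/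
structure LinearResolution where
  /-- The generators. -/
  ι : ℕ → Type u
  /-- The matrices of the differentials. -/
  rel : ∀ n, ι (n + 1) → ι n →₀ A
  rel_mem : ∀ n i j, rel n i j ∈ 𝒜 1
  /-- The augmentation. -/
  aug : (ι 0 →₀ A) →ₗ[A] TrivialModule 𝒜
  aug_surjective : Function.Surjective aug
  exact_zero : Function.Exact (Finsupp.linearCombination A (rel 0)) aug
  exact_succ : ∀ n, Function.Exact (Finsupp.linearCombination A (rel (n + 1)))
    (Finsupp.linearCombination A (rel n))

namespace LinearResolution

variable (R : LinearResolution 𝒜)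

/-- The modules of the resolution, with their grading. -/
abbrev F (n : ℕ) : GradedLeftModule 𝒜 := freeModule 𝒜 (R.ι n) n

/-- The differentials. -/
def d (n : ℕ) : (R.F (n + 1)).carrier →ₗ[A] (R.F n).carrier :=
  Finsupp.linearCombination A (R.rel n)

theorem rel_mem_component (n : ℕ) (i : R.ι (n + 1)) : R.rel n i ∈ (R.F n).component (n + 1) := by
  intro j
  rw [show (((n + 1 : ℕ) : ℤ) - n) = ((1 : ℕ) : ℤ) by push_cast; ring]
  exact R.rel_mem n i j

theorem d_mem (n q : ℕ) (x : (R.F (n + 1)).carrier) (hx : x ∈ (R.F (n + 1)).component q) :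
    R.d n x ∈ (R.F n).component q := by
  rcases lt_or_ge q (n + 1) with hq | hq
  · rw [eq_zero_of_mem_freeModule_component hq hx, map_zero]
    exact zero_mem _
  · obtain ⟨k, rfl⟩ := Nat.exists_eq_add_of_le' hq
    change R.ι (n + 1) →₀ A at x
    refine Submodule.sum_mem ((R.F n).component _) fun i _ => ?_
    exact (R.F n).smul_mem k (n + 1) (x i) _ (apply_mem_of_mem_freeModule_component hx i)
      (R.rel_mem_component n i)

/-- The syzygies of the trivial module. -/
def syzygy : ℕ → GradedLeftModule 𝒜
  | 0 => trivialGradedModule 𝒜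
  | n + 1 =>
    { carrier := LinearMap.range (R.d n)
      component := fun q => ((R.F n).component q).comap
        ((LinearMap.range (R.d n)).subtype.restrictScalars K)
      smul_mem := fun p q a x ha hx => (R.F n).smul_mem p q a x.1 ha hx }

theorem syzygy_span (n : ℕ) :
    Submodule.span A ((R.syzygy n).component n : Set (R.syzygy n).carrier) = ⊤ := by
  cases n with
  | zero =>
    rw [eq_top_iff]
    intro x _
    exact Submodule.subset_span
      (show x ∈ (R.syzygy 0).component 0 by trivial)
  | succ n =>
    rw [eq_top_iff]
    rintro ⟨_, x, rfl⟩ -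
    let ρ : (R.F (n + 1)).carrier →ₗ[A] (R.syzygy (n + 1)).carrier := (R.d n).rangeRestrict
    change ρ x ∈ _
    induction x using freeModule_induction with
    | zero => rw [map_zero]; exact zero_mem _
    | add x y hx hy => rw [map_add]; exact add_mem hx hy
    | single k i a ha =>
      have : freeSingle 𝒜 (n + 1) i a = a • freeSingle 𝒜 (n + 1) i 1 := by
        rw [smul_freeSingle, mul_one]
      rw [this, map_smul]
      refine Submodule.smul_mem _ _ (Submodule.subset_span ?_)
      exact R.d_mem n (n + 1) _ (freeSingle_one_mem _ i)

theorem aug_freeSingle_eq_zero {k : ℕ} (hk : k ≠ 0) (i : R.ι 0) {a : A} (ha : a ∈ 𝒜 k) :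
    R.aug (freeSingle 𝒜 0 i a) = 0 := by
  have : (freeSingle 𝒜 0 i a) = a • freeSingle 𝒜 0 i 1 := by rw [smul_freeSingle, mul_one]
  rw [this]
  exact (R.aug.map_smul a _).trans (smul_trivialModule_eq_zero hk ha _)

theorem exists_aug_eq (x : (R.F 0).carrier) : ∃ y ∈ (R.F 0).component 0, R.aug y = R.aug x := by
  induction x using freeModule_induction with
  | zero => exact ⟨0, zero_mem _, rfl⟩
  | add x y hx hy =>
    obtain ⟨x', hx', ex⟩ := hx
    obtain ⟨y', hy', ey⟩ := hy
    exact ⟨x' + y', add_mem hx' hy', (R.aug.map_add _ _).trans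
      ((congrArg₂ _ ex ey).trans (R.aug.map_add _ _).symm)⟩
  | single k i a ha =>
    by_cases hk : k = 0
    · subst hk
      exact ⟨_, freeSingle_mem (s := 0) ha i, rfl⟩
    · exact ⟨0, zero_mem _, (R.aug.map_zero).trans (R.aug_freeSingle_eq_zero hk i ha).symm⟩

theorem aug_eq_zero {q : ℕ} (hq : q ≠ 0) {x : (R.F 0).carrier} (hx : x ∈ (R.F 0).component q) :
    R.aug x = 0 := by
  obtain ⟨(x : R.ι 0 →₀ A), rfl⟩ : ∃ y, y = x := ⟨x, rfl⟩
  rw [← Finsupp.sum_single x]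
  refine (map_sum R.aug _ _).trans (Finset.sum_eq_zero fun i _ => ?_)
  exact R.aug_freeSingle_eq_zero hq i (apply_mem_of_mem_freeModule_component (k := q) (t := 0) hx i)

theorem nonempty_gradedShortExact (n : ℕ) :
    Nonempty (GradedShortExact (R.syzygy (n + 1)) (R.F n) (R.syzygy n)) := by
  cases n with
  | zero =>
    let g : (R.F 0).component 0 →ₗ[K] TrivialModule 𝒜 :=
      (R.aug.restrictScalars K) ∘ₗ Submodule.subtype _
    obtain ⟨s, hs⟩ := g.exists_rightInverse_of_surjective (LinearMap.range_eq_top.2 fun y => by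
      obtain ⟨x, rfl⟩ := R.aug_surjective y
      obtain ⟨y, hy, e⟩ := R.exists_aug_eq x
      exact ⟨⟨y, hy⟩, e⟩)
    exact ⟨{
      incl := (LinearMap.range (R.d 0)).subtype
      proj := R.aug
      sectionMap := Submodule.subtype _ ∘ₗ s
      incl_injective := Subtype.val_injective
      exact := fun x => ⟨fun h => by
          obtain ⟨y, hy⟩ := (R.exact_zero x).1 h
          exact ⟨⟨x, y, hy⟩, rfl⟩, by
          rintro ⟨⟨_, y, rfl⟩, rfl⟩
          exact (R.exact_zero _).2 ⟨y, rfl⟩⟩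
      proj_section := fun x => LinearMap.congr_fun hs x
      mem_iff := fun q x => Iff.rfl
      proj_mem := fun q x hx => by
        by_cases hq : q = 0
        · subst hq
          trivial
        · change R.aug x ∈ (if q = 0 then ⊤ else ⊥ : Submodule K (TrivialModule 𝒜))
          rw [if_neg hq]
          exact R.aug_eq_zero hq hx
      section_mem := fun q x hx => by
        by_cases hq : q = 0
        · subst hq
          exact (s x).2
        · have : x = 0 := by
            change x ∈ (if q = 0 then ⊤ else ⊥ : Submodule K (TrivialModule 𝒜)) at hx
            rw [if_neg hq] at hx
            exact hx
          rw [this, map_zero]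
          exact zero_mem _ }⟩
  | succ n =>
    obtain ⟨s, hs, hs'⟩ := exists_gradedPseudoInverse ((R.d n).restrictScalars K) (R.d_mem n)
    exact ⟨{
      incl := (LinearMap.range (R.d (n + 1))).subtype
      proj := (R.d n).rangeRestrict
      sectionMap := s ∘ₗ (LinearMap.range (R.d n)).subtype.restrictScalars K
      incl_injective := Subtype.val_injective
      exact := fun x => by
        refine Iff.trans Subtype.ext_iff ⟨fun h => ?_, ?_⟩
        · obtain ⟨y, hy⟩ := (R.exact_succ n x).1 h
          exact ⟨⟨x, y, hy⟩, rfl⟩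
        · rintro ⟨⟨_, y, rfl⟩, rfl⟩
          exact (R.exact_succ n _).2 ⟨y, rfl⟩
      proj_section := by
        rintro ⟨_, x, rfl⟩
        exact Subtype.ext (hs' x)
      mem_iff := fun q x => Iff.rfl
      proj_mem := fun q x hx => R.d_mem n q x hx
      section_mem := fun q x hx => hs q x.1 hx }⟩

variable (ε : Augmentation 𝒜) (W : Type u) [AddCommGroup W] [Module K W]

theorem syzygy_homology (n s : ℕ) (r : ℤ) :
    (r ≠ -((n + s : ℕ) : ℤ) → ((homBimodule ε (R.syzygy s) W).complex r).ExactAt n) ∧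
    (r = -((n + s : ℕ) : ℤ) →
      Nonempty (((homBimodule ε (R.syzygy s) W).complex r).homology n ≃ₗ[K] (R.ι (n + s) → W))) := by
  induction n generalizing s with
  | zero =>
    rw [zero_add]
    constructor
    · intro hr
      exact homBimodule_exactAt_zero ε (R.syzygy_span s) (by lia)
    · rintro rfl
      exact (R.nonempty_gradedShortExact s).some.nonempty_homology_zero_equiv ε W
        (R.syzygy_span (s + 1))
  | succ n ih =>
    obtain ⟨e⟩ := (R.nonempty_gradedShortExact s).some.nonempty_homology_succ_equiv ε W
      (R.syzygy_span (s + 1)) r n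
    obtain ⟨h1, h2⟩ := ih (s + 1)
    rw [show n + 1 + s = n + (s + 1) by ring]
    constructor
    · intro hr
      have := h1 hr
      rw [HomologicalComplex.exactAt_iff_isZero_homology] at this ⊢
      exact this.of_iso e.toModuleIso
    · intro hr
      exact ⟨e.trans (h2 hr).some⟩

end LinearResolution

end GradedHochschild

end

noncomputable section

open CategoryTheory

namespace GradedHochschild

variable {K : Type v} {A : Type u} [Field K] [Ring A] [Algebra K A]
variable {𝒜 : ℕ → Submodule K A}

section FiltrationComponents

variable (𝒜) in
/-- The homogeneous components of the ideal `A_{≥ m}`. -/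
def filtComponent (m : ℕ) (j : ℤ) : Submodule K A :=
  if (m : ℤ) ≤ j then intComponent 𝒜 j else ⊥

theorem filtComponent_eq_bot {m : ℕ} {j : ℤ} (h : j < m) : filtComponent 𝒜 m j = ⊥ :=
  if_neg (not_le.2 h)

theorem filtComponent_of_le {m : ℕ} {j : ℤ} (h : (m : ℤ) ≤ j) :
    filtComponent 𝒜 m j = intComponent 𝒜 j :=
  if_pos h

theorem filtComponent_antitone {m m' : ℕ} (h : m ≤ m') (j : ℤ) :
    filtComponent 𝒜 m' j ≤ filtComponent 𝒜 m j := by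
  unfold filtComponent
  split_ifs with h1 h2
  · exact le_rfl
  · lia
  · exact bot_le
  · exact bot_le

theorem filtComponent_succ {m : ℕ} {j : ℤ} (h : j ≠ m) :
    filtComponent 𝒜 (m + 1) j = filtComponent 𝒜 m j := by
  unfold filtComponent
  push_cast
  split_ifs with h1 h2 <;> first | rfl | lia

variable (𝒜) in
/-- The ideal `A_{≥ m}`, as a subspace. -/
def geSubmodule (m : ℕ) : Submodule K A := ⨆ j : {j : ℕ // m ≤ j}, 𝒜 j

theorem mem_geSubmodule {m j : ℕ} (h : m ≤ j) {x : A} (hx : x ∈ 𝒜 j) : x ∈ geSubmodule 𝒜 m :=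
  Submodule.mem_iSup_of_mem (⟨j, h⟩ : {j : ℕ // m ≤ j}) hx

theorem filtComponent_le_geSubmodule (m : ℕ) (j : ℤ) : filtComponent 𝒜 m j ≤ geSubmodule 𝒜 m := by
  intro x hx
  rcases lt_or_ge j m with h | h
  · rw [filtComponent_eq_bot h] at hx
    rw [(Submodule.mem_bot K).1 hx]
    exact zero_mem _
  · lift j to ℕ using by lia
    rw [filtComponent_of_le h] at hx
    exact mem_geSubmodule (by lia) hx

theorem geSubmodule_induction {m : ℕ} {p : A → Prop} {x : A} (hx : x ∈ geSubmodule 𝒜 m)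
    (zero : p 0) (add : ∀ x y, p x → p y → p (x + y)) (mem : ∀ j, m ≤ j → ∀ x ∈ 𝒜 j, p x) : p x :=
  Submodule.iSup_induction (motive := p) _ hx (fun j x hx => mem j.1 j.2 x hx) zero add

end FiltrationComponents

/-- The bimodule with all degrees raised by `e`. -/
def GradedBimodule.shift (B : GradedBimodule 𝒜) (e : ℤ) : GradedBimodule 𝒜 where
  __ := B
  component j := B.component (j - e)
  left_mem p m a x ha hx := by
    have := B.left_mem p _ a x ha hx
    rwa [← add_sub_assoc] at this
  right_mem p m a x ha hx := by
    have := B.right_mem p _ a x ha hx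
    rwa [sub_add_eq_add_sub] at this

theorem GradedBimodule.shift_gradedCochain (B : GradedBimodule 𝒜) (e r : ℤ) (n : ℕ) :
    (B.shift e).gradedCochain r n = B.gradedCochain (r - e) n := by
  ext f
  change (∀ p a, _ → f a ∈ B.component (_ + r - e)) ↔ (∀ p a, _ → f a ∈ B.component (_ + (r - e)))
  simp only [add_sub_assoc]

variable [GradedAlgebra 𝒜]

section Augmentation

theorem exists_augmentation (h : IsConnectedGraded 𝒜) :
    ∃ ε : Augmentation 𝒜, ∀ a ∈ 𝒜 0, algebraMap K A (ε.toAlgHom a) = a := by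
  obtain ⟨_, h⟩ := h
  have hinj : Function.Injective (Algebra.linearMap K A) := FaithfulSMul.algebraMap_injective K A
  let e := LinearEquiv.ofInjective (Algebra.linearMap K A) hinj
  have hmem (a : A) : GradedAlgebra.proj 𝒜 0 a ∈ LinearMap.range (Algebra.linearMap K A) := by
    rw [← Submodule.one_eq_range, ← h]
    exact SetLike.coe_mem _
  let ε₀ : A →ₗ[K] K := e.symm.toLinearMap ∘ₗ (GradedAlgebra.proj 𝒜 0).codRestrict _ hmem
  have hε (a : A) : algebraMap K A (ε₀ a) = GradedRing.projZeroRingHom 𝒜 a :=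
    congrArg Subtype.val (e.apply_symm_apply ((GradedAlgebra.proj 𝒜 0).codRestrict _ hmem a))
  refine ⟨⟨AlgHom.ofLinearMap ε₀ (hinj ?_) fun a b => hinj ?_, fun p a hp ha => hinj ?_⟩, ?_⟩
  · exact (hε 1).trans ((map_one _).trans (map_one (algebraMap K A)).symm)
  · exact (hε (a * b)).trans (by rw [map_mul, ← hε, ← hε, ← map_mul]; rfl)
  · change algebraMap K A (ε₀ a) = algebraMap K A 0
    rw [hε, map_zero]
    exact DirectSum.decompose_of_mem_ne 𝒜 ha hp
  · intro a ha
    refine (hε a).trans ?_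
    exact DirectSum.decompose_of_mem_same 𝒜 ha

theorem Augmentation.eq_zero_of_mem_irrelevant (ε : Augmentation 𝒜) {a : A}
    (ha : a ∈ HomogeneousIdeal.irrelevant 𝒜) : ε.toAlgHom a = 0 := by
  classical
  rw [HomogeneousIdeal.mem_irrelevant_iff] at ha
  rw [← DirectSum.sum_support_decompose 𝒜 a, map_sum]
  refine Finset.sum_eq_zero fun i _ => ?_
  by_cases hi : i = 0
  · subst hi
    change ((DirectSum.decompose 𝒜 a) 0 : A) = 0 at ha
    rw [ha, map_zero]
  · exact ε.map_eq_zero i _ hi (SetLike.coe_mem _)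

theorem Augmentation.exists_trivialModule (ε : Augmentation 𝒜) :
    ∃ η : TrivialModule 𝒜 →ₗ[K] K, ∀ a : A, η (Submodule.Quotient.mk a) = ε.toAlgHom a := by
  let I := (HomogeneousIdeal.irrelevant 𝒜).toIdeal
  refine ⟨(I.restrictScalars K).liftQ ε.toAlgHom.toLinearMap
    (fun a ha => ε.eq_zero_of_mem_irrelevant ha) ∘ₗ
      (Submodule.Quotient.restrictScalarsEquiv K I).symm.toLinearMap, fun a => rfl⟩

/-- The map `A / A_{≥ 1} → K` induced by the augmentation. -/
def Augmentation.onTrivial (ε : Augmentation 𝒜) : TrivialModule 𝒜 →ₗ[K] K :=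
  ε.exists_trivialModule.choose

theorem Augmentation.onTrivial_mk (ε : Augmentation 𝒜) (a : A) :
    ε.onTrivial (Submodule.Quotient.mk a) = ε.toAlgHom a :=
  ε.exists_trivialModule.choose_spec a

theorem Augmentation.onTrivial_smul (ε : Augmentation 𝒜)
    (hε : ∀ a ∈ 𝒜 0, algebraMap K A (ε.toAlgHom a) = a) (y : TrivialModule 𝒜) :
    ε.onTrivial y • (Submodule.Quotient.mk 1 : TrivialModule 𝒜) = y := by
  obtain ⟨a, rfl⟩ := Submodule.Quotient.mk_surjective _ y
  rw [ε.onTrivial_mk, ← Submodule.Quotient.mk_smul, Submodule.Quotient.eq,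
    ← Algebra.algebraMap_eq_smul_one]
  change _ ∈ HomogeneousIdeal.irrelevant 𝒜
  have h0 : ε.toAlgHom a = ε.toAlgHom (DirectSum.decompose 𝒜 a 0) := by
    rw [← sub_eq_zero, ← map_sub]
    refine ε.eq_zero_of_mem_irrelevant ?_
    rw [HomogeneousIdeal.mem_irrelevant_iff]
    change ((DirectSum.decompose 𝒜 (a - _)) 0 : A) = 0
    simp [DirectSum.decompose_sub]
  rw [h0, hε _ (SetLike.coe_mem _), HomogeneousIdeal.mem_irrelevant_iff]
  change ((DirectSum.decompose 𝒜 (_ - a)) 0 : A) = 0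
  simp [DirectSum.decompose_sub]

end Augmentation

section Expansion

variable {M : Type*} [AddCommGroup M] [Module K M]

variable (𝒜) in
/-- A multilinear map is determined by its values on homogeneous elements. -/
theorem multilinearMap_expand {n : ℕ} (f : MultilinearMap K (fun _ : Fin n => A) M)
    [∀ i (x : 𝒜 i), Decidable (x ≠ 0)] (a : Fin n → A) :
    f a = ∑ κ ∈ Fintype.piFinset fun j => (DirectSum.decompose 𝒜 (a j)).support,
      f fun j => (DirectSum.decompose 𝒜 (a j) (κ j) : A) := by
  rw [← MultilinearMap.map_sum_finset f (fun j k => (DirectSum.decompose 𝒜 (a j) k : A))]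
  congr 1
  funext j
  exact (DirectSum.sum_support_decompose 𝒜 (a j)).symm

theorem multilinearMap_mem {n : ℕ} (f : MultilinearMap K (fun _ : Fin n => A) M)
    (S : Submodule K M) (h : ∀ (p : Fin n → ℕ) (a : Fin n → A), (∀ j, a j ∈ 𝒜 (p j)) → f a ∈ S)
    (a : Fin n → A) : f a ∈ S := by
  classical
  rw [multilinearMap_expand 𝒜]
  exact sum_mem fun κ _ => h κ _ fun j => SetLike.coe_mem _

end Expansion

section Filtration

theorem mul_mem_geSubmodule_left {m : ℕ} (a : A) {x : A} (hx : x ∈ geSubmodule 𝒜 m) :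
    a * x ∈ geSubmodule 𝒜 m := by
  classical
  induction a using DirectSum.Decomposition.inductionOn 𝒜 with
  | zero => rw [zero_mul]; exact zero_mem _
  | add a b ha hb => rw [add_mul]; exact add_mem ha hb
  | homogeneous a =>
    refine geSubmodule_induction (p := fun x => a.1 * x ∈ geSubmodule 𝒜 m) hx ?_ ?_ ?_
    · rw [mul_zero]; exact zero_mem _
    · intro x y hx hy; rw [mul_add]; exact add_mem hx hy
    · intro j hj x hx
      exact mem_geSubmodule (le_add_left hj) (SetLike.mul_mem_graded a.2 hx)

theorem mul_mem_geSubmodule_right {m : ℕ} (a : A) {x : A} (hx : x ∈ geSubmodule 𝒜 m) :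
    x * a ∈ geSubmodule 𝒜 m := by
  classical
  induction a using DirectSum.Decomposition.inductionOn 𝒜 with
  | zero => rw [mul_zero]; exact zero_mem _
  | add a b ha hb => rw [mul_add]; exact add_mem ha hb
  | homogeneous a =>
    refine geSubmodule_induction (p := fun x => x * a.1 ∈ geSubmodule 𝒜 m) hx ?_ ?_ ?_
    · rw [zero_mul]; exact zero_mem _
    · intro x y hx hy; rw [add_mul]; exact add_mem hx hy
    · intro j hj x hx
      exact mem_geSubmodule (le_add_right hj) (SetLike.mul_mem_graded hx a.2)

variable (𝒜) in
/-- The ideal `A_{≥ m}`, as a bimodule. -/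
def filtBimodule (m : ℕ) : GradedBimodule 𝒜 where
  carrier := geSubmodule 𝒜 m
  left := LinearMap.mk₂ K (fun a x => ⟨a * x.1, mul_mem_geSubmodule_left a x.2⟩)
    (fun _ _ _ => Subtype.ext (add_mul _ _ _)) (fun _ _ _ => Subtype.ext (smul_mul_assoc _ _ _))
    (fun _ _ _ => Subtype.ext (mul_add _ _ _)) (fun _ _ _ => Subtype.ext (mul_smul_comm _ _ _))
  right := LinearMap.mk₂ K (fun a x => ⟨x.1 * a, mul_mem_geSubmodule_right a x.2⟩)
    (fun _ _ _ => Subtype.ext (mul_add _ _ _)) (fun _ _ _ => Subtype.ext (mul_smul_comm _ _ _))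
    (fun _ _ _ => Subtype.ext (add_mul _ _ _)) (fun _ _ _ => Subtype.ext (smul_mul_assoc _ _ _))
  left_one x := Subtype.ext (one_mul _)
  right_one x := Subtype.ext (mul_one _)
  left_mul a b x := Subtype.ext (mul_assoc _ _ _)
  right_mul a b x := Subtype.ext (mul_assoc _ _ _).symm
  left_right a b x := Subtype.ext (mul_assoc _ _ _).symm
  component j := (filtComponent 𝒜 m j).comap (Submodule.subtype _)
  left_mem p j a x ha hx := by
    change a * x.1 ∈ filtComponent 𝒜 m (p + j)
    change x.1 ∈ filtComponent 𝒜 m j at hx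
    rcases lt_or_ge j m with h | h
    · rw [filtComponent_eq_bot h, Submodule.mem_bot] at hx
      rw [hx, mul_zero]
      exact zero_mem _
    · rw [filtComponent_of_le h] at hx
      rw [filtComponent_of_le (by lia)]
      exact mul_mem_intComponent_left 𝒜 ha hx
  right_mem p j a x ha hx := by
    change x.1 * a ∈ filtComponent 𝒜 m (j + p)
    change x.1 ∈ filtComponent 𝒜 m j at hx
    rcases lt_or_ge j m with h | h
    · rw [filtComponent_eq_bot h, Submodule.mem_bot] at hx
      rw [hx, zero_mul]
      exact zero_mem _
    · rw [filtComponent_of_le h] at hx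
      rw [filtComponent_of_le (by lia)]
      exact mul_mem_intComponent_right 𝒜 ha hx

/-- The complex of a shifted bimodule. -/
def GradedBimodule.shiftComplexIso (B : GradedBimodule 𝒜) (e r : ℤ) :
    (B.shift e).complex r ≅ B.complex (r - e) :=
  HomologicalComplex.Hom.isoOfComponents
    (fun n => (LinearEquiv.ofEq _ _ (B.shift_gradedCochain e r n)).toModuleIso) (by
      rintro n _ rfl
      rw [complex_d, complex_d]
      ext f : 2
      exact Subtype.ext rfl)

/-- The projection to the component of degree `m` as a linear map to `𝒜 m`. -/
def projComponent (𝒜 : ℕ → Submodule K A) [GradedAlgebra 𝒜] (m : ℕ) : A →ₗ[K] 𝒜 m :=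
  DirectSum.component K ℕ (fun i => 𝒜 i) m ∘ₗ (DirectSum.decomposeLinearEquiv 𝒜).toLinearMap

theorem projComponent_same {m : ℕ} (x : 𝒜 m) : projComponent 𝒜 m x = x :=
  Subtype.ext (DirectSum.decompose_of_mem_same 𝒜 x.2)

theorem projComponent_ne {m j : ℕ} (h : j ≠ m) {x : A} (hx : x ∈ 𝒜 j) : projComponent 𝒜 m x = 0 :=
  Subtype.ext (DirectSum.decompose_of_mem_ne 𝒜 hx h)

theorem projComponent_mul {ε : Augmentation 𝒜}
    (hε : ∀ a ∈ 𝒜 0, algebraMap K A (ε.toAlgHom a) = a) {m : ℕ} (a : A) {x : A}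
    (hx : x ∈ geSubmodule 𝒜 m) :
    projComponent 𝒜 m (a * x) = ε.toAlgHom a • projComponent 𝒜 m x ∧
      projComponent 𝒜 m (x * a) = ε.toAlgHom a • projComponent 𝒜 m x := by
  classical
  induction a using DirectSum.Decomposition.inductionOn 𝒜 with
  | zero => simp
  | add a b ha hb => simp [add_mul, mul_add, add_smul, ha, hb]
  | @homogeneous p a =>
    refine geSubmodule_induction (p := fun x =>
      projComponent 𝒜 m (a.1 * x) = ε.toAlgHom a.1 • projComponent 𝒜 m x ∧
        projComponent 𝒜 m (x * a.1) = ε.toAlgHom a.1 • projComponent 𝒜 m x) hx ?_ ?_ ?_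
    · simp
    · intro x y hx hy
      simp [mul_add, add_mul, hx, hy]
    · intro j hj x hx
      by_cases hp : p = 0
      · subst hp
        rw [← hε a.1 a.2, ← Algebra.commutes, ← Algebra.smul_def, hε a.1 a.2]
        simp
      · rw [ε.map_eq_zero p a hp a.2, zero_smul,
          projComponent_ne (j := p + j) (by lia) (SetLike.mul_mem_graded a.2 hx),
          projComponent_ne (j := j + p) (by lia) (SetLike.mul_mem_graded hx a.2)]
        simp

/-- The inclusion `A_{≥ m+1} → A_{≥ m}`. -/
def filtIncl (𝒜 : ℕ → Submodule K A) [GradedAlgebra 𝒜] (m : ℕ) :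
    GradedBimodule.Hom (filtBimodule 𝒜 (m + 1)) (filtBimodule 𝒜 m) where
  toLinearMap := Submodule.inclusion (p := geSubmodule 𝒜 (m + 1)) (p' := geSubmodule 𝒜 m)
    (iSup_le fun j _ hx => mem_geSubmodule (le_trans (Nat.le_succ m) j.2) hx)
  map_left _ _ := rfl
  map_right _ _ := rfl
  map_mem j _ hx := filtComponent_antitone (Nat.le_succ m) j hx

/-- The bimodule `A_{≥ m} / A_{≥ m+1}`. -/
def grBimodule (ε : Augmentation 𝒜) (m : ℕ) : GradedBimodule 𝒜 :=
  (homBimodule ε (trivialGradedModule 𝒜) (𝒜 m)).shift m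

end Filtration

end GradedHochschild

end

noncomputable section

open CategoryTheory

namespace GradedHochschild

variable {K : Type v} {A : Type u} [Field K] [Ring A] [Algebra K A]
variable {𝒜 : ℕ → Submodule K A} [GradedAlgebra 𝒜]

section AssociatedGraded

variable {ε : Augmentation 𝒜} (hε : ∀ a ∈ 𝒜 0, algebraMap K A (ε.toAlgHom a) = a)

/-- The projection `A_{≥ m} → A_{≥ m} / A_{≥ m+1}`. -/
def filtQuot (hε : ∀ a ∈ 𝒜 0, algebraMap K A (ε.toAlgHom a) = a) (m : ℕ) :
    GradedBimodule.Hom (filtBimodule 𝒜 m) (grBimodule ε m) where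
  toLinearMap :=
    { toFun := fun x => ε.onTrivial.smulRight (projComponent 𝒜 m x.1)
      map_add' := fun x y => LinearMap.ext fun z => by
        change ε.onTrivial z • projComponent 𝒜 m (x.1 + y.1) =
          ε.onTrivial z • projComponent 𝒜 m x.1 + ε.onTrivial z • projComponent 𝒜 m y.1
        rw [map_add, smul_add]
      map_smul' := fun c x => LinearMap.ext fun z => by
        change ε.onTrivial z • projComponent 𝒜 m (c • x.1) = c • ε.onTrivial z • projComponent 𝒜 m x.1
        rw [map_smul, smul_comm] }
  map_left a x := LinearMap.ext fun z => by
    change ε.onTrivial z • projComponent 𝒜 m (a * x.1) =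
      ε.toAlgHom a • ε.onTrivial z • projComponent 𝒜 m x.1
    rw [(projComponent_mul hε a x.2).1, smul_comm]
  map_right a x := LinearMap.ext fun z => by
    change ε.onTrivial z • projComponent 𝒜 m (x.1 * a) =
      ε.onTrivial (a • z) • projComponent 𝒜 m x.1
    have hz : ε.onTrivial (a • z) = ε.toAlgHom a * ε.onTrivial z := by
      obtain ⟨b, rfl⟩ := Submodule.Quotient.mk_surjective _ z
      exact (ε.onTrivial_mk (a * b)).trans (by rw [map_mul, ε.onTrivial_mk])
    rw [(projComponent_mul hε a x.2).2, hz, smul_smul, mul_comm]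
  map_mem j x hx q hq z hz := by
    change ε.onTrivial z • projComponent 𝒜 m x.1 = 0
    change x.1 ∈ filtComponent 𝒜 m j at hx
    change z ∈ (if q = 0 then ⊤ else ⊥ : Submodule K (TrivialModule 𝒜)) at hz
    by_cases hq0 : q = 0
    · subst hq0
      have hjm : j ≠ m := fun h => hq (by simp [h])
      rcases lt_or_ge j m with h | h
      · rw [filtComponent_eq_bot h, Submodule.mem_bot] at hx
        rw [hx, map_zero, smul_zero]
      · lift j to ℕ using by lia
        rw [filtComponent_of_le h] at hx
        rw [projComponent_ne (j := j) (by lia) hx, smul_zero]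
    · rw [if_neg hq0] at hz
      have hz0 : z = 0 := hz
      rw [hz0]
      exact (congrArg (· • projComponent 𝒜 m x.1) ε.onTrivial.map_zero).trans (zero_smul _ _)

theorem projComponent_eq_zero_of_filtQuot {m : ℕ} {x : (filtBimodule 𝒜 m).carrier}
    (hx : (filtQuot hε m).toLinearMap x = 0) : projComponent 𝒜 m x.1 = 0 := by
  have : ε.onTrivial (Submodule.Quotient.mk 1) • projComponent 𝒜 m x.1 = 0 :=
    LinearMap.congr_fun (f := (filtQuot hε m).toLinearMap x) hx (Submodule.Quotient.mk 1)
  rwa [ε.onTrivial_mk, map_one, one_smul] at this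

theorem sub_projComponent_mem {m : ℕ} {x : A} (hx : x ∈ geSubmodule 𝒜 m) :
    x - projComponent 𝒜 m x ∈ geSubmodule 𝒜 (m + 1) := by
  refine geSubmodule_induction (p := fun x => x - (projComponent 𝒜 m x : A) ∈
    geSubmodule 𝒜 (m + 1)) hx ?_ ?_ ?_
  · simp
  · intro x y hx hy
    have := add_mem hx hy
    rwa [sub_add_sub_comm, ← Submodule.coe_add, ← map_add] at this
  · intro j hj y hy
    by_cases h : j = m
    · subst h
      rw [projComponent_same ⟨y, hy⟩]
      simp
    · rw [projComponent_ne h hy]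
      simpa using mem_geSubmodule (by lia) hy

/-- The exact sequence `0 → A_{≥ m+1} → A_{≥ m} → A_{≥ m} / A_{≥ m+1} → 0`. -/
def filtSplitExact (m : ℕ) : GradedBimodule.SplitExact (filtIncl 𝒜 m) (filtQuot hε m) where
  retraction := LinearMap.codRestrict (geSubmodule 𝒜 (m + 1))
    ((LinearMap.id - Submodule.subtype _ ∘ₗ projComponent 𝒜 m) ∘ₗ (geSubmodule 𝒜 m).subtype)
    fun x => sub_projComponent_mem x.2
  sectionMap :=
    { toFun := fun χ => ⟨(homEval ε (trivialGradedModule 𝒜) (𝒜 m)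
        (Submodule.Quotient.mk 1 : TrivialModule 𝒜) χ).1,
        mem_geSubmodule le_rfl (homEval ε (trivialGradedModule 𝒜) (𝒜 m)
        (Submodule.Quotient.mk 1 : TrivialModule 𝒜) χ).2⟩
      map_add' := fun _ _ => rfl
      map_smul' := fun _ _ => rfl }
  injective := fun x y h => Subtype.ext (congrArg (fun z : geSubmodule 𝒜 m => z.1) h)
  comp_eq_zero x := LinearMap.ext fun z => by
    change ε.onTrivial z • projComponent 𝒜 m x.1 = 0
    have : projComponent 𝒜 m x.1 = 0 := by
      refine geSubmodule_induction (p := fun x => projComponent 𝒜 m x = 0) x.2 (map_zero _) ?_ ?_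
      · intro x y hx hy
        rw [map_add, hx, hy, add_zero]
      · intro j hj x hx
        exact projComponent_ne (by lia) hx
    rw [this, smul_zero]
  retraction_spec x hx := Subtype.ext (by
    change x.1 - (projComponent 𝒜 m x.1 : A) = x.1
    rw [projComponent_eq_zero_of_filtQuot hε hx]
    simp)
  retraction_mem j x hx h0 := by
    change x.1 - (projComponent 𝒜 m x.1 : A) ∈ filtComponent 𝒜 (m + 1) j
    have h1 := projComponent_eq_zero_of_filtQuot hε h0
    rw [h1, Submodule.coe_zero, sub_zero]
    change x.1 ∈ filtComponent 𝒜 m j at hx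
    by_cases hj : j = m
    · subst hj
      rw [filtComponent_of_le le_rfl] at hx
      have h2 := projComponent_same (⟨x.1, hx⟩ : 𝒜 m)
      rw [h1] at h2
      rw [← congrArg Subtype.val h2]
      exact zero_mem _
    · rwa [filtComponent_succ hj]
  sectionMap_spec χ := LinearMap.ext fun z => by
    change ε.onTrivial z • projComponent 𝒜 m (homToLinearMap (ε := ε) χ (Submodule.Quotient.mk 1)).1 =
      homToLinearMap (ε := ε) χ z
    rw [projComponent_same]
    refine ((homToLinearMap (ε := ε) χ).map_smul _ _).symm.trans ?_
    exact congrArg _ (ε.onTrivial_smul hε z)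
  sectionMap_mem j χ hχ := by
    change (homToLinearMap (ε := ε) χ (Submodule.Quotient.mk 1)).1 ∈ filtComponent 𝒜 m j
    by_cases hj : j = m
    · subst hj
      rw [filtComponent_of_le le_rfl]
      exact (homToLinearMap (ε := ε) χ (Submodule.Quotient.mk 1)).2
    · have : homToLinearMap (ε := ε) χ (Submodule.Quotient.mk 1) = 0 :=
        hχ 0 (by simp; lia) _ (by trivial)
      rw [this]
      exact zero_mem _

end AssociatedGraded

section FilteredCochains

variable (𝒜) in
/-- The cochains of internal degree `r` with values in `A_{≥ m}`. -/
def filtCochain (m : ℕ) (r : ℤ) (n : ℕ) : Submodule K (Cochain K A n) where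
  carrier := {f | ∀ (p : Fin n → ℕ) (a : Fin n → A), (∀ j, a j ∈ 𝒜 (p j)) →
    f a ∈ filtComponent 𝒜 m ((∑ j, p j : ℕ) + r)}
  add_mem' hf hg p a ha := add_mem (hf p a ha) (hg p a ha)
  zero_mem' _ _ _ := zero_mem _
  smul_mem' c _ hf p a ha := Submodule.smul_mem _ c (hf p a ha)

variable (𝒜) in
/-- The cochains with values in `A_{≥ m}`, as cochains with values in `A`. -/
def filtVal (m n : ℕ) : (filtBimodule 𝒜 m).Cochain n →ₗ[K] Cochain K A n where
  toFun f := (geSubmodule 𝒜 m).subtype.compMultilinearMap f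
  map_add' _ _ := rfl
  map_smul' _ _ := rfl

theorem filtVal_injective (m n : ℕ) : Function.Injective (filtVal 𝒜 m n) := fun _ _ h =>
  MultilinearMap.ext fun a => Subtype.ext (DFunLike.congr_fun h a)

theorem filtVal_mem_iff {m n : ℕ} {r : ℤ} {f : (filtBimodule 𝒜 m).Cochain n} :
    filtVal 𝒜 m n f ∈ filtCochain 𝒜 m r n ↔ f ∈ (filtBimodule 𝒜 m).gradedCochain r n := Iff.rfl

theorem exists_filtVal_eq {m n : ℕ} {r : ℤ} {f : Cochain K A n} (hf : f ∈ filtCochain 𝒜 m r n) :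
    ∃ f' ∈ (filtBimodule 𝒜 m).gradedCochain r n, filtVal 𝒜 m n f' = f := by
  have h (a) : f a ∈ geSubmodule 𝒜 m := multilinearMap_mem f _
    (fun p a ha => filtComponent_le_geSubmodule m _ (hf p a ha)) a
  exact ⟨f.codRestrict _ h, hf, rfl⟩

theorem filtVal_differential {m n : ℕ} (f : (filtBimodule 𝒜 m).Cochain n) :
    filtVal 𝒜 m (n + 1) ((filtBimodule 𝒜 m).differential n f) =
      differential K A n (filtVal 𝒜 m n f) := by
  ext a
  rw [differential_apply]
  change (geSubmodule 𝒜 m).subtype ((filtBimodule 𝒜 m).differential n f a) = _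
  rw [GradedBimodule.differential_apply]
  refine (map_add (geSubmodule 𝒜 m).subtype _ _).trans (congrArg₂ _
    ((map_add (geSubmodule 𝒜 m).subtype _ _).trans (congrArg₂ _ rfl ?_)) rfl)
  exact map_sum (geSubmodule 𝒜 m).subtype _ _

theorem differential_mem_filtCochain {m n : ℕ} {r : ℤ} {f : Cochain K A n}
    (hf : f ∈ filtCochain 𝒜 m r n) : differential K A n f ∈ filtCochain 𝒜 m r (n + 1) := by
  obtain ⟨f', hf', rfl⟩ := exists_filtVal_eq hf
  rw [← filtVal_differential]
  exact filtVal_mem_iff.2 ((filtBimodule 𝒜 m).differential_mem_gradedCochain r n f' hf')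

/-- The filtration is separated. -/
theorem eq_zero_of_forall_mem_filtCochain {n : ℕ} {r : ℤ} {f : Cochain K A n} {m : ℕ}
    (hf : ∀ N, f ∈ filtCochain 𝒜 (m + N) r n) : f = 0 := by
  ext a
  refine multilinearMap_mem (𝒜 := 𝒜) f ⊥ (fun p a ha => ?_) a
  have := hf ((∑ j, p j : ℕ) + r + 1).toNat p a ha
  rwa [filtComponent_eq_bot (by push_cast; lia)] at this

/-- The filtration is complete. -/
theorem exists_limit_filtCochain {n m : ℕ} {r : ℤ} {g : ℕ → Cochain K A n}
    (hg : ∀ k, g k ∈ filtCochain 𝒜 (m + k) r n) :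
    ∃ G : Cochain K A n, ∀ N, G - ∑ k ∈ Finset.range N, g k ∈ filtCochain 𝒜 (m + N) r n := by
  classical
  have hfin (a : Fin n → A) : (Function.support fun k => g k a).Finite := by
    refine Set.Finite.subset (Set.Finite.biUnion
      (Fintype.piFinset fun j => (DirectSum.decompose 𝒜 (a j)).support).finite_toSet
      fun κ _ => Set.finite_le_nat ((∑ j, κ j : ℕ) + r).toNat) ?_
    intro k hk
    by_contra h
    refine hk ?_
    simp only [Set.mem_iUnion, Set.mem_ofPred_eq, not_exists] at h
    change g k a = 0
    rw [multilinearMap_expand 𝒜]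
    refine Finset.sum_eq_zero fun κ hκ => ?_
    have h1 := h κ hκ
    have h2 := hg k κ _ fun j => SetLike.coe_mem (DirectSum.decompose 𝒜 (a j) (κ j))
    rwa [filtComponent_eq_bot (by lia)] at h2
  let G : Cochain K A n :=
    { toFun := fun a => ∑ᶠ k, g k a
      map_update_add' := fun a i x y => by
        simp only [MultilinearMap.map_update_add]
        exact finsum_add_distrib (hfin _) (hfin _)
      map_update_smul' := fun a i c x => by
        simp only [MultilinearMap.map_update_smul]
        exact (smul_finsum' c (hfin _)).symm }
  refine ⟨G, fun N p a ha => ?_⟩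
  obtain ⟨b, hb⟩ := (hfin a).bddAbove
  have hG : G a = ∑ k ∈ Finset.range (N + (b + 1)), g k a :=
    finsum_eq_sum_of_support_subset _ fun k hk => by
      have := hb hk
      simp only [Finset.coe_range, Set.mem_Iio]
      omega
  rw [_root_.sub_apply, hG, _root_.sum_apply, Finset.sum_range_add, add_sub_cancel_left]
  exact sum_mem fun k _ => filtComponent_antitone (by omega) _ (hg (N + k) p a ha)

variable {ε : Augmentation 𝒜}

theorem filtVal_mem_succ (hε : ∀ a ∈ 𝒜 0, algebraMap K A (ε.toAlgHom a) = a)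
    {m n : ℕ} {r : ℤ} {f : (filtBimodule 𝒜 m).Cochain n}
    (hf : f ∈ (filtBimodule 𝒜 m).gradedCochain r n)
    (h0 : (filtQuot hε m).toLinearMap.compMultilinearMap f = 0) :
    filtVal 𝒜 m n f ∈ filtCochain 𝒜 (m + 1) r n := by
  intro p a ha
  have h := filtSplitExact hε m
  have h1 : (filtQuot hε m).toLinearMap (f a) = 0 := DFunLike.congr_fun h0 a
  have h2 := h.retraction_mem _ _ (hf p a ha) h1
  have h3 := h.retraction_spec _ h1
  change (f a).1 ∈ _
  rw [← h3]
  exact h2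

theorem mem_filtCochain_succ (hε : ∀ a ∈ 𝒜 0, algebraMap K A (ε.toAlgHom a) = a)
    {m : ℕ} {r : ℤ} (hex : ((grBimodule ε m).complex r).ExactAt 0)
    {f : Cochain K A 0} (hf : f ∈ filtCochain 𝒜 m r 0) (hd : differential K A 0 f = 0) :
    f ∈ filtCochain 𝒜 (m + 1) r 0 := by
  rw [GradedBimodule.complex_exactAt_zero_iff] at hex
  obtain ⟨f', hf', rfl⟩ := exists_filtVal_eq hf
  have hd' : (filtBimodule 𝒜 m).differential 0 f' = 0 :=
    filtVal_injective _ _ (by rw [filtVal_differential, hd, map_zero])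
  refine filtVal_mem_succ hε hf' (hex _ ((filtQuot hε m).mapCochain r 0 ⟨f', hf'⟩).2 ?_)
  refine ((filtQuot hε m).differential_comp f').trans ?_
  rw [hd']
  exact MultilinearMap.ext fun a => (filtQuot hε m).toLinearMap.map_zero

theorem exists_sub_mem_filtCochain_succ (hε : ∀ a ∈ 𝒜 0, algebraMap K A (ε.toAlgHom a) = a)
    {m n : ℕ} {r : ℤ}
    (hex : ((grBimodule ε m).complex r).ExactAt (n + 1)) {f : Cochain K A (n + 1)}
    (hf : f ∈ filtCochain 𝒜 m r (n + 1)) (hd : differential K A (n + 1) f = 0) :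
    ∃ g ∈ filtCochain 𝒜 m r n, f - differential K A n g ∈ filtCochain 𝒜 (m + 1) r (n + 1) := by
  rw [GradedBimodule.complex_exactAt_succ_iff] at hex
  obtain ⟨f', hf', rfl⟩ := exists_filtVal_eq hf
  have hd' : (filtBimodule 𝒜 m).differential (n + 1) f' = 0 :=
    filtVal_injective _ _ (by rw [filtVal_differential, hd, map_zero])
  obtain ⟨h, hh, e⟩ := hex _ ((filtQuot hε m).mapCochain r (n + 1) ⟨f', hf'⟩).2 (by
    refine ((filtQuot hε m).differential_comp f').trans ?_
    rw [hd']
    exact MultilinearMap.ext fun a => (filtQuot hε m).toLinearMap.map_zero)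
  have S := filtSplitExact hε m
  let g' : (filtBimodule 𝒜 m).Cochain n := S.sectionMap.compMultilinearMap h
  have hg' : g' ∈ (filtBimodule 𝒜 m).gradedCochain r n := fun p a ha =>
    S.sectionMap_mem _ _ (hh p a ha)
  have hqg : (filtQuot hε m).toLinearMap.compMultilinearMap g' = h :=
    MultilinearMap.ext fun a => S.sectionMap_spec _
  refine ⟨filtVal 𝒜 m n g', filtVal_mem_iff.2 hg', ?_⟩
  rw [← filtVal_differential, ← map_sub]
  refine filtVal_mem_succ hε (sub_mem hf' ((filtBimodule 𝒜 m).differential_mem_gradedCochain r n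
    g' hg')) ?_
  refine MultilinearMap.ext fun a => ?_
  refine (map_sub (filtQuot hε m).toLinearMap _ _).trans (sub_eq_zero.2 ?_)
  have e1 := (filtQuot hε m).differential_comp g'
  rw [hqg, e] at e1
  exact DFunLike.congr_fun e1 a

/-- If the associated graded complexes are acyclic from `m` on, then so is the `m`-th step of the
filtration. -/
theorem filtBimodule_exactAt (hε : ∀ a ∈ 𝒜 0, algebraMap K A (ε.toAlgHom a) = a)
    {m : ℕ} {r : ℤ}
    (hex : ∀ m', m ≤ m' → ∀ n, ((grBimodule ε m').complex r).ExactAt n) (n : ℕ) :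
    ((filtBimodule 𝒜 m).complex r).ExactAt n := by
  cases n with
  | zero =>
    rw [GradedBimodule.complex_exactAt_zero_iff]
    intro f hf hd
    refine filtVal_injective _ _ ?_
    have hd' : differential K A 0 (filtVal 𝒜 m 0 f) = 0 := by
      rw [← filtVal_differential, hd, map_zero]
    rw [map_zero]
    refine eq_zero_of_forall_mem_filtCochain (𝒜 := 𝒜) (m := m) (r := r) fun N => ?_
    induction N with
    | zero => exact filtVal_mem_iff.2 hf
    | succ N ih => exact mem_filtCochain_succ hε (hex (m + N) (Nat.le_add_right m N) 0) ih hd'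
  | succ n =>
    rw [GradedBimodule.complex_exactAt_succ_iff]
    intro f hf hd
    have hd' : differential K A (n + 1) (filtVal 𝒜 m _ f) = 0 := by
      rw [← filtVal_differential, hd, map_zero]
    have step (k : ℕ) (F : {F : Cochain K A (n + 1) // F ∈ filtCochain 𝒜 (m + k) r (n + 1) ∧
        differential K A (n + 1) F = 0}) : ∃ g ∈ filtCochain 𝒜 (m + k) r n,
        F.1 - differential K A n g ∈ filtCochain 𝒜 (m + (k + 1)) r (n + 1) :=
      exists_sub_mem_filtCochain_succ hε (hex (m + k) (Nat.le_add_right m k) _) F.2.1 F.2.2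
    choose c hc hc' using step
    let seq (k : ℕ) : {F : Cochain K A (n + 1) // F ∈ filtCochain 𝒜 (m + k) r (n + 1) ∧
        differential K A (n + 1) F = 0} :=
      Nat.rec ⟨filtVal 𝒜 m _ f, filtVal_mem_iff.2 hf, hd'⟩
        (fun k F => ⟨F.1 - differential K A n (c k F), hc' k F, by
          rw [map_sub, F.2.2, zero_sub, neg_eq_zero]
          exact LinearMap.congr_fun (differential_comp_differential n) _⟩) k
    obtain ⟨G, hG⟩ := exists_limit_filtCochain (𝒜 := 𝒜) (m := m) (r := r) fun k => hc k (seq k)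
    have hseq (N : ℕ) : (seq N).1 = filtVal 𝒜 m _ f -
        differential K A n (∑ k ∈ Finset.range N, c k (seq k)) := by
      induction N with
      | zero => simp [seq]
      | succ N ih =>
        rw [Finset.sum_range_succ, map_add, ← sub_sub, ← ih]
    have hfG : filtVal 𝒜 m _ f - differential K A n G = 0 := by
      refine eq_zero_of_forall_mem_filtCochain (𝒜 := 𝒜) (m := m) (r := r) fun N => ?_
      have h1 := sub_mem (seq N).2.1 (differential_mem_filtCochain (hG N))
      rwa [hseq, map_sub, sub_sub, add_sub_cancel] at h1
    obtain ⟨g, hg, rfl⟩ := exists_filtVal_eq (m := m) (r := r) (f := G) (by simpa using hG 0)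
    refine ⟨g, hg, filtVal_injective _ _ ?_⟩
    rw [filtVal_differential]
    exact (sub_eq_zero.1 hfG).symm

end FilteredCochains

end GradedHochschild

end

noncomputable section

open CategoryTheory

namespace GradedHochschild

variable {K : Type v} {A : Type u} [Field K] [Ring A] [Algebra K A]
variable {𝒜 : ℕ → Submodule K A} [GradedAlgebra 𝒜]

theorem subsingleton_homology_of_exactAt {ι : Type*} {c : ComplexShape ι}
    {C : HomologicalComplex (ModuleCat.{u} K) c} {n : ι} (h : C.ExactAt n) :
    Subsingleton (C.homology n) :=
  ModuleCat.isZero_iff_subsingleton.1 h.isZero_homology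

section HochschildIso

theorem filtCochain_zero {𝒜 : ℕ → Submodule K A} (r : ℤ) (n : ℕ) : filtCochain 𝒜 0 r n = gradedCochain 𝒜 r n := by
  have h (j : ℤ) : filtComponent 𝒜 0 j = intComponent 𝒜 j := by
    rcases lt_or_ge j 0 with hj | hj
    · rw [filtComponent_eq_bot (by simpa using hj), intComponent_of_neg hj]
    · exact filtComponent_of_le (by simpa using hj)
  ext f
  change (∀ (p : Fin n → ℕ) (a : Fin n → A), (∀ j, a j ∈ 𝒜 (p j)) →
    f a ∈ filtComponent 𝒜 0 ((∑ j, p j : ℕ) + r)) ↔ _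
  simp only [h]
  rfl

variable (𝒜) in
/-- Cochains with values in `A_{≥ 0}` are the same as cochains with values in `A`. -/
def filtZeroEquiv (r : ℤ) (n : ℕ) :
    (filtBimodule 𝒜 0).gradedCochain r n ≃ₗ[K] gradedCochain 𝒜 r n :=
  LinearEquiv.ofBijective
    ((filtVal 𝒜 0 n).restrict fun f hf => (filtCochain_zero (𝒜 := 𝒜) r n).le (filtVal_mem_iff.2 hf))
    ⟨fun f g h => Subtype.ext (filtVal_injective 0 n (congrArg Subtype.val h)), fun f => by
      obtain ⟨f', hf', e⟩ := exists_filtVal_eq ((filtCochain_zero (𝒜 := 𝒜) r n).ge f.2)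
      exact ⟨⟨f', hf'⟩, Subtype.ext e⟩⟩

theorem hochschildComplex_d (r : ℤ) (n : ℕ) :
    (hochschildComplex 𝒜 r).d n (n + 1) = ModuleCat.ofHom
      ((differential K A n).restrict (differential_mem_gradedCochain 𝒜 r n)) :=
  CochainComplex.of_d (fun n => ModuleCat.of K (gradedCochain 𝒜 r n))
    (fun n => ModuleCat.ofHom
      ((differential K A n).restrict (differential_mem_gradedCochain 𝒜 r n))) n

variable (𝒜) in
/-- The Hochschild complex is the complex of cochains with values in `A_{≥ 0}`. -/
def filtZeroIso (r : ℤ) : (filtBimodule 𝒜 0).complex r ≅ hochschildComplex 𝒜 r :=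
  HomologicalComplex.Hom.isoOfComponents (fun n => (filtZeroEquiv 𝒜 r n).toModuleIso) (by
    rintro n _ rfl
    rw [hochschildComplex_d, GradedBimodule.complex_d]
    ext f : 2
    exact Subtype.ext (filtVal_differential f.1).symm)

theorem subsingleton_HH_of_neg {i : ℤ} (hi : i < 0) (r : ℤ) : Subsingleton (HH 𝒜 i r) := by
  refine subsingleton_homology_of_exactAt (HomologicalComplex.extend_exactAt _ _ _ fun n h => ?_)
  have : (n : ℤ) = i := h
  lia

variable (𝒜) in
theorem nonempty_HH_equiv (n : ℕ) (r : ℤ) :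
    Nonempty (HH 𝒜 n r ≃ₗ[K] ((filtBimodule 𝒜 0).complex r).homology n) :=
  ⟨((HomologicalComplex.extendHomologyIso (hochschildComplex 𝒜 r) ComplexShape.embeddingUpNat
    (j := n) (j' := (n : ℤ)) rfl) ≪≫
      HomologicalComplex.homologyMapIso (filtZeroIso 𝒜 r).symm n).toLinearEquiv⟩

end HochschildIso

section Euler

variable (R : LinearResolution 𝒜) {ε : Augmentation 𝒜}

theorem grBimodule_exactAt (R : LinearResolution 𝒜) {m n : ℕ} {r : ℤ} (h : (m : ℤ) ≠ n + r) :
    ((grBimodule ε m).complex r).ExactAt n :=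
  ((R.syzygy_homology ε (𝒜 m) n 0 (r - m)).1 (by push_cast; lia)).of_iso
    ((homBimodule ε (trivialGradedModule 𝒜) (𝒜 m)).shiftComplexIso m r).symm

theorem nonempty_grBimodule_homology_equiv {m n : ℕ} {r : ℤ} (h : (m : ℤ) = n + r) :
    Nonempty (((grBimodule ε m).complex r).homology n ≃ₗ[K] (R.ι n → 𝒜 m)) := by
  obtain ⟨e⟩ := (R.syzygy_homology ε (𝒜 m) n 0 (r - m)).2 (by push_cast; lia)
  exact ⟨(HomologicalComplex.homologyMapIso
    ((homBimodule ε (trivialGradedModule 𝒜) (𝒜 m)).shiftComplexIso m r) n).toLinearEquiv.trans e⟩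

theorem finite_grBimodule_homology (hι : ∀ n, Finite (R.ι n))
    (hA : ∀ m, Module.Finite K (𝒜 m)) (m n : ℕ) (r : ℤ) :
    Module.Finite K (((grBimodule ε m).complex r).homology n) := by
  by_cases h : (m : ℤ) = n + r
  · obtain ⟨e⟩ := nonempty_grBimodule_homology_equiv R (ε := ε) h
    exact Module.Finite.equiv e.symm
  · have := subsingleton_homology_of_exactAt (grBimodule_exactAt R (ε := ε) h)
    infer_instance

theorem finrank_grBimodule_homology (hι : ∀ n, Finite (R.ι n))
    (hA : ∀ m, Module.Finite K (𝒜 m)) (m n : ℕ) (r : ℤ) :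
    Module.finrank K (((grBimodule ε m).complex r).homology n) =
      if (m : ℤ) = n + r then Nat.card (R.ι n) * Module.finrank K (𝒜 m) else 0 := by
  split_ifs with h
  · obtain ⟨e⟩ := nonempty_grBimodule_homology_equiv R (ε := ε) h
    have := Fintype.ofFinite (R.ι n)
    rw [e.finrank_eq, Module.finrank_pi_fintype, Finset.sum_const, Finset.card_univ,
      Nat.card_eq_fintype_card, smul_eq_mul]
  · have := subsingleton_homology_of_exactAt (grBimodule_exactAt R (ε := ε) h)
    exact Module.finrank_zero_of_subsingleton

theorem filtBimodule_exactAt_of_lt (hε : ∀ a ∈ 𝒜 0, algebraMap K A (ε.toAlgHom a) = a)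
    {d : ℕ} (hd : ∀ n, d < n → IsEmpty (R.ι n)) {m : ℕ} {r : ℤ}
    (hm : d + r < m) (n : ℕ) : ((filtBimodule 𝒜 m).complex r).ExactAt n := by
  refine filtBimodule_exactAt hε (fun m' hm' n => ?_) n
  by_cases h : (m' : ℤ) = n + r
  · obtain ⟨e⟩ := nonempty_grBimodule_homology_equiv R (ε := ε) h
    have := hd n (by lia)
    rw [HomologicalComplex.exactAt_iff_isZero_homology, ModuleCat.isZero_iff_subsingleton]
    exact e.toEquiv.subsingleton
  · exact grBimodule_exactAt R h

/-- The homology of the steps of the filtration, by descending induction. -/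
theorem filtBimodule_homology (hε : ∀ a ∈ 𝒜 0, algebraMap K A (ε.toAlgHom a) = a)
    {d : ℕ} (hd : ∀ n, d < n → IsEmpty (R.ι n))
    (hι : ∀ n, Finite (R.ι n)) (hA : ∀ m, Module.Finite K (𝒜 m)) {M : ℕ} {r : ℤ}
    (hM : d + r < M) (m : ℕ) (hm : m ≤ M) :
    (∀ n, Module.Finite K (((filtBimodule 𝒜 m).complex r).homology n)) ∧
    (∀ n, d < n → Module.finrank K (((filtBimodule 𝒜 m).complex r).homology n) = 0) ∧
    ∑ n ∈ Finset.range (d + 1), (-1 : ℤ) ^ n *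
        (Module.finrank K (((filtBimodule 𝒜 m).complex r).homology n) : ℤ) =
      ∑ m' ∈ Finset.Ico m M, ∑ n ∈ Finset.range (d + 1), (-1 : ℤ) ^ n *
        ((if (m' : ℤ) = n + r then Nat.card (R.ι n) * Module.finrank K (𝒜 m') else 0 : ℕ) : ℤ) := by
  induction hm using Nat.decreasingInduction with
  | self =>
    have h (n : ℕ) : Subsingleton (((filtBimodule 𝒜 M).complex r).homology n) :=
      subsingleton_homology_of_exactAt (filtBimodule_exactAt_of_lt R hε hd hM n)
    refine ⟨fun n => inferInstance, fun n _ => Module.finrank_zero_of_subsingleton, ?_⟩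
    simp [Module.finrank_zero_of_subsingleton]
  | of_succ m hm ih =>
    obtain ⟨ih1, ih2, ih3⟩ := ih
    have hS := (filtSplitExact hε m).shortExact r
    have h3 := fun n => finite_grBimodule_homology R (ε := ε) hι hA m n r
    obtain ⟨fin, ρ, -, -, hρ⟩ := exists_rank_longExactSequence hS ih1 h3
    refine ⟨fin, fun n hn => ?_, ?_⟩
    · have h1 := hρ n
      have h2 : Module.finrank K (((grBimodule ε m).complex r).homology n) = 0 := by
        have := hd n hn
        rw [finrank_grBimodule_homology R hι hA]
        simp
      change Module.finrank K (((filtBimodule 𝒜 (m + 1)).complex r).homology n) +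
        Module.finrank K (((grBimodule ε m).complex r).homology n) =
        Module.finrank K (((filtBimodule 𝒜 m).complex r).homology n) + _ + _ at h1
      rw [ih2 n hn, h2] at h1
      omega
    · have h1 := sum_finrank_homology hS ih1 h3 (d + 1) (ih2 _ (Nat.lt_succ_self d))
      refine h1.trans ?_
      rw [← Finset.insert_Ico_add_one_left_eq_Ico hm, Finset.sum_insert (by simp), add_comm]
      refine congrArg₂ _ (Finset.sum_congr rfl fun n _ => ?_) ih3
      rw [← finrank_grBimodule_homology R (ε := ε) hι hA]
      rfl

theorem finrank_intComponent {𝒜 : ℕ → Submodule K A} (M : ℕ) {j : ℤ} (hj : j < M) (c : ℕ) :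
    ∑ m ∈ Finset.range M, (if (m : ℤ) = j then c * Module.finrank K (𝒜 m) else 0) =
      c * Module.finrank K (intComponent 𝒜 j) := by
  rcases lt_or_ge j 0 with h | h
  · rw [intComponent_of_neg h, finrank_bot, mul_zero]
    exact Finset.sum_eq_zero fun m _ => if_neg (by lia)
  · lift j to ℕ using h
    rw [Finset.sum_eq_single j, if_pos rfl]
    · rfl
    · intro m _ hm
      exact if_neg (by lia)
    · intro h
      exact absurd (Finset.mem_range.2 (by lia)) h

/-- Vanishing, finiteness and Euler characteristic of the Hochschild cohomology, in terms of a
finite linear free resolution of the trivial module. -/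
theorem HH_of_linearResolution (hε : ∀ a ∈ 𝒜 0, algebraMap K A (ε.toAlgHom a) = a)
    {d : ℕ} (hd : ∀ n, d < n → IsEmpty (R.ι n))
    (hι : ∀ n, Finite (R.ι n)) (hA : ∀ m, Module.Finite K (𝒜 m)) (r : ℤ) :
    (∀ i : ℤ, i < 0 ∨ (d : ℤ) < i → Subsingleton (HH 𝒜 i r)) ∧
    (∀ i : ℤ, Module.Finite K (HH 𝒜 i r)) ∧
    ∑ i ∈ Finset.range (d + 1), (-1 : ℤ) ^ i * (Module.finrank K (HH 𝒜 (i : ℤ) r) : ℤ) =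
      ∑ i ∈ Finset.range (d + 1), (-1 : ℤ) ^ i *
        ((Nat.card (R.ι i) * Module.finrank K (intComponent 𝒜 (i + r)) : ℕ) : ℤ) := by
  obtain ⟨fin, van, sum⟩ := filtBimodule_homology R hε hd hι hA
    (M := (d + r + 1).toNat) (r := r) (by lia) 0 (Nat.zero_le _)
  have hfin (i : ℤ) : Module.Finite K (HH 𝒜 i r) := by
    rcases lt_or_ge i 0 with hi | hi
    · have := subsingleton_HH_of_neg (𝒜 := 𝒜) hi r
      infer_instance
    · lift i to ℕ using hi
      obtain ⟨e⟩ := nonempty_HH_equiv 𝒜 i r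
      have := fin i
      exact Module.Finite.equiv e.symm
  refine ⟨fun i hi => ?_, hfin, ?_⟩
  · rcases hi with hi | hi
    · exact subsingleton_HH_of_neg hi r
    · lift i to ℕ using by lia
      obtain ⟨e⟩ := nonempty_HH_equiv 𝒜 i r
      have := fin i
      have := Module.finrank_zero_iff.1 (van i (by lia))
      exact e.toEquiv.subsingleton
  · have (i : ℕ) : Module.finrank K (HH 𝒜 i r) =
        Module.finrank K (((filtBimodule 𝒜 0).complex r).homology i) := by
      obtain ⟨e⟩ := nonempty_HH_equiv 𝒜 i r
      exact e.finrank_eq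
    simp only [this]
    rw [sum, Finset.sum_comm]
    refine Finset.sum_congr rfl fun i hi => ?_
    rw [← Finset.mul_sum, ← Nat.cast_sum, ← Finset.range_eq_Ico, finrank_intComponent]
    have := Finset.mem_range.1 hi
    lia

end Euler

end GradedHochschild

end

noncomputable section

open CategoryTheory

namespace GradedHochschild

variable {K : Type v} {A : Type u} [Field K] [Ring A] [Algebra K A]
variable {𝒜 : ℕ → Submodule K A} [GradedAlgebra 𝒜]

section GeSubmodule

theorem projComponent_of_geSubmodule {m k : ℕ} (h : k < m) {x : A} (hx : x ∈ geSubmodule 𝒜 m) :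
    projComponent 𝒜 k x = 0 := by
  refine geSubmodule_induction (p := fun x => projComponent 𝒜 k x = 0) hx (map_zero _) ?_ ?_
  · intro x y hx hy
    rw [map_add, hx, hy, add_zero]
  · intro j hj x hx
    exact projComponent_ne (by lia) hx

theorem eq_zero_of_projComponent {x : A} (h : ∀ k, projComponent 𝒜 k x = 0) : x = 0 := by
  refine (DirectSum.decompose 𝒜).injective ?_
  ext k
  rw [DirectSum.decompose_zero]
  exact congrArg Subtype.val (h k)

theorem eq_zero_of_forall_mem_geSubmodule {x : A} (h : ∀ k, x ∈ geSubmodule 𝒜 k) : x = 0 :=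
  eq_zero_of_projComponent fun k => projComponent_of_geSubmodule (Nat.lt_succ_self k) (h (k + 1))

theorem mem_geSubmodule_zero (x : A) : x ∈ geSubmodule 𝒜 0 := by
  induction x using DirectSum.Decomposition.inductionOn 𝒜 with
  | zero => exact zero_mem _
  | homogeneous a => exact mem_geSubmodule (Nat.zero_le _) a.2
  | add x y hx hy => exact add_mem hx hy

theorem mul_mem_geSubmodule {m k : ℕ} {x y : A} (hx : x ∈ geSubmodule 𝒜 m)
    (hy : y ∈ geSubmodule 𝒜 k) : x * y ∈ geSubmodule 𝒜 (m + k) := by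
  refine geSubmodule_induction (p := fun x => x * y ∈ geSubmodule 𝒜 (m + k)) hx ?_ ?_ ?_
  · rw [zero_mul]
    exact zero_mem _
  · intro x x' h h'
    rw [add_mul]
    exact add_mem h h'
  · intro i hi x hx
    refine geSubmodule_induction (p := fun y => x * y ∈ geSubmodule 𝒜 (m + k)) hy ?_ ?_ ?_
    · rw [mul_zero]
      exact zero_mem _
    · intro y y' h h'
      rw [mul_add]
      exact add_mem h h'
    · intro j hj y hy
      exact mem_geSubmodule (by lia) (SetLike.mul_mem_graded hx hy)

theorem mem_geSubmodule_one {x : A} (h : projComponent 𝒜 0 x = 0) : x ∈ geSubmodule 𝒜 1 := by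
  have := sub_projComponent_mem (mem_geSubmodule_zero (𝒜 := 𝒜) x)
  rwa [h, Submodule.coe_zero, sub_zero] at this

end GeSubmodule

section GradedProjective

variable {P : Type u} [AddCommGroup P] [Module A P] {comp : ℕ → AddSubgroup P}

/-- Projection to a homogeneous component. -/
theorem exists_projection (hcomp : DirectSum.IsInternal comp) (k : ℕ) :
    ∃ π : P →+ P, (∀ x ∈ comp k, π x = x) ∧ ∀ j ≠ k, ∀ x ∈ comp j, π x = 0 := by
  have := hcomp.chooseDecomposition
  refine ⟨(comp k).subtype.comp ((DFinsupp.evalAddMonoidHom k).comp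
    (DirectSum.decomposeAddEquiv comp).toAddMonoidHom), fun x hx => ?_, fun j hj x hx => ?_⟩
  · exact DirectSum.decompose_of_mem_same comp hx
  · exact DirectSum.decompose_of_mem_ne comp hx hj

theorem projection_smul
    (hsmul : ∀ i j (a : A) (x : P), a ∈ 𝒜 i → x ∈ comp j → a • x ∈ comp (i + j)) {n k : ℕ}
    {π : P →+ P} (hπ : ∀ x ∈ comp (k + n), π x = x) (hπ' : ∀ j ≠ k + n, ∀ x ∈ comp j, π x = 0)
    (a : A) {x : P} (hx : x ∈ comp n) : π (a • x) = (projComponent 𝒜 k a : A) • x := by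
  induction a using DirectSum.Decomposition.inductionOn 𝒜 with
  | zero => simp
  | add a b ha hb => rw [add_smul, map_add, ha, hb, map_add, Submodule.coe_add, add_smul]
  | @homogeneous j a =>
    by_cases h : j = k
    · subst h
      rw [projComponent_same, hπ _ (hsmul _ _ _ _ a.2 hx)]
    · rw [projComponent_ne h a.2, hπ' (j + n) (by lia) _ (hsmul _ _ _ _ a.2 hx)]
      simp

/-- A graded projective module that is generated in degree `n` is free on generators of
degree `n`. -/
theorem exists_free_generators (hconn : IsConnectedGraded 𝒜)
    (hcomp : DirectSum.IsInternal comp)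
    (hsmul : ∀ i j (a : A) (x : P), a ∈ 𝒜 i → x ∈ comp j → a • x ∈ comp (i + j))
    [Module.Projective A P] {n : ℕ} (hspan : Submodule.span A (comp n : Set P) = ⊤) :
    ∃ (ι : Type u) (b : ι → P), (∀ i, b i ∈ comp n) ∧
      Function.Bijective (Finsupp.linearCombination A b) := by
  obtain ⟨ε, hε⟩ := exists_augmentation hconn
  let _ : Module K P := Module.compHom P (algebraMap K A)
  have hKA (c : K) (x : P) : c • x = algebraMap K A c • x := rfl
  let V : Submodule K P :=
    { comp n with
      smul_mem' := fun c x hx => by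
        have := hsmul 0 n (algebraMap K A c) x (SetLike.algebraMap_mem_graded 𝒜 c) hx
        rwa [zero_add] at this }
  let β := Module.Basis.ofVectorSpace K V
  let b : Module.Basis.ofVectorSpaceIndex K V → P := fun i => (β i : P)
  have hb (i) : b i ∈ comp n := (β i).2
  let φ := Finsupp.linearCombination A b
  have hsurj : Function.Surjective φ := by
    rw [← LinearMap.range_eq_top, eq_top_iff, ← hspan, Submodule.span_le]
    intro x hx
    have h1 := β.linearCombination_repr ⟨x, hx⟩
    have h2 := congrArg V.subtype h1
    rw [Finsupp.linearCombination_apply, Finsupp.sum, map_sum] at h2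
    rw [show x = V.subtype ⟨x, hx⟩ from rfl, ← h2]
    refine sum_mem fun i _ => ?_
    rw [map_smul]
    refine Submodule.smul_mem (LinearMap.range φ) (algebraMap K A _) ⟨Finsupp.single i 1, ?_⟩
    rw [Finsupp.linearCombination_single, one_smul]
    rfl
  have hker (x : Module.Basis.ofVectorSpaceIndex K V →₀ A) (hx : φ x = 0) (i) :
      x i ∈ geSubmodule 𝒜 1 := by
    obtain ⟨π, hπ, hπ'⟩ := exists_projection hcomp n
    have h1 : π (φ x) = 0 := by rw [hx, map_zero]
    rw [Finsupp.linearCombination_apply, Finsupp.sum, map_sum] at h1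
    have h2 : ∑ j ∈ x.support, ε.toAlgHom (projComponent 𝒜 0 (x j) : A) • β j = 0 := by
      refine Subtype.ext ?_
      rw [Submodule.coe_sum, Submodule.coe_zero, ← h1]
      refine Finset.sum_congr rfl fun j _ => ?_
      rw [projection_smul hsmul (k := 0) (by rwa [zero_add]) (by rwa [zero_add]) _ (hb j),
        Submodule.coe_smul, hKA, hε _ (projComponent 𝒜 0 (x j)).2]
    refine mem_geSubmodule_one ?_
    by_cases hi : i ∈ x.support
    · have := linearIndependent_iff'.1 β.linearIndependent _ _ h2 i hi
      refine Subtype.ext ?_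
      rw [← hε _ (projComponent 𝒜 0 (x i)).2, this, map_zero]
      rfl
    · rw [Finsupp.notMem_support_iff.1 hi, map_zero]
  refine ⟨_, b, hb, ?_, hsurj⟩
  obtain ⟨s, hs⟩ := Module.projective_lifting_property φ LinearMap.id hsurj
  have hs' (y : P) : φ (s y) = y := LinearMap.congr_fun hs y
  have key (k : ℕ) : ∀ x, φ x = 0 → ∀ i, x i ∈ geSubmodule 𝒜 k := by
    induction k with
    | zero => exact fun x _ i => mem_geSubmodule_zero _
    | succ k ih =>
      intro x hx i
      let e := LinearMap.id - s ∘ₗ φ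
      have he (y) : φ (e y) = 0 := by
        simp [e, hs']
      have hx' : x = x.sum fun j a => a • e (Finsupp.single j 1) := by
        have : e x = x := by simp [e, hx]
        conv_lhs => rw [← this, ← Finsupp.sum_single x, map_finsuppSum]
        refine Finsupp.sum_congr fun j _ => ?_
        rw [← map_smul, Finsupp.smul_single, smul_eq_mul, mul_one]
      rw [hx', Finsupp.sum, Finsupp.finsetSum_apply]
      refine sum_mem fun j _ => ?_
      rw [Finsupp.smul_apply, smul_eq_mul, add_comm k 1]
      exact mul_mem_geSubmodule (hker x hx j) (ih _ (he _) i)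
  refine (injective_iff_map_eq_zero φ).2 fun x hx => Finsupp.ext fun i => ?_
  exact eq_zero_of_forall_mem_geSubmodule fun k => key k x hx i

/-- The coordinates of an element of degree `k + n` with respect to free generators of degree `n`
have degree `k`. -/
theorem coordinates_mem (hcomp : DirectSum.IsInternal comp)
    (hsmul : ∀ i j (a : A) (x : P), a ∈ 𝒜 i → x ∈ comp j → a • x ∈ comp (i + j))
    {ι : Type u} {b : ι → P} {n : ℕ} (hb : ∀ i, b i ∈ comp n)
    (hinj : Function.Injective (Finsupp.linearCombination A b)) {k : ℕ} {x : ι →₀ A}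
    (hx : Finsupp.linearCombination A b x ∈ comp (k + n)) (i : ι) : x i ∈ 𝒜 k := by
  obtain ⟨π, hπ, hπ'⟩ := exists_projection hcomp (k + n)
  have h : x.mapRange (fun a => (projComponent 𝒜 k a : A)) (by simp) = x := by
    refine hinj ?_
    rw [← hπ _ hx, Finsupp.linearCombination_apply, Finsupp.linearCombination_apply,
      Finsupp.sum_mapRange_index (by simp), Finsupp.sum, Finsupp.sum, map_sum]
    exact Finset.sum_congr rfl fun j _ => (projection_smul hsmul hπ hπ' _ (hb j)).symm
  rw [← h]
  exact (projComponent 𝒜 k (x i)).2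

end GradedProjective

/-- A Koszul algebra has a linear free resolution. -/
theorem IsKoszul.nonempty_linearResolution (hconn : IsConnectedGraded 𝒜) (h : IsKoszul 𝒜) :
    Nonempty (LinearResolution 𝒜) := by
  obtain ⟨Q, -, hQ⟩ := h
  have hfree (n : ℕ) : ∃ (ι : Type u) (b : ι → Q.P n), (∀ i, b i ∈ Q.component n n) ∧
      Function.Bijective (Finsupp.linearCombination A b) :=
    have := Q.projective n
    exists_free_generators hconn (Q.isInternal n) (Q.smul_mem n) (hQ n)
  choose ι b hb hbij using hfree
  let e (n : ℕ) : (ι n →₀ A) ≃ₗ[A] Q.P n := LinearEquiv.ofBijective _ (hbij n)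
  let rel (n : ℕ) (i : ι (n + 1)) : ι n →₀ A := (e n).symm (Q.d n (b (n + 1) i))
  have he (n : ℕ) (x) : e n (Finsupp.linearCombination A (rel n) x) = Q.d n (e (n + 1) x) := by
    change (e n).toLinearMap _ = Q.d n (Finsupp.linearCombination A (b (n + 1)) x)
    rw [Finsupp.apply_linearCombination, Finsupp.apply_linearCombination]
    congr 2
    funext i
    exact (e n).apply_symm_apply _
  refine ⟨{ ι := ι, rel := rel, rel_mem := ?_, aug := Q.ε ∘ₗ (e 0).toLinearMap,
            aug_surjective := Q.ε_surjective.comp (e 0).surjective,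
            exact_zero := ?_, exact_succ := ?_ }⟩
  · intro n i j
    refine coordinates_mem (Q.isInternal n) (Q.smul_mem n) (hb n) (hbij n).1 ?_ j
    have : Finsupp.linearCombination A (b n) (rel n i) = Q.d n (b (n + 1) i) :=
      (e n).apply_symm_apply _
    rw [this, add_comm]
    exact Q.d_mem _ _ _ (hb _ _)
  · intro x
    rw [LinearMap.comp_apply, LinearEquiv.coe_coe, Q.exact_zero]
    constructor
    · rintro ⟨y, hy⟩
      refine ⟨(e 1).symm y, (e 0).injective ?_⟩
      rw [he, LinearEquiv.apply_symm_apply, hy]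
    · rintro ⟨y, rfl⟩
      exact ⟨e 1 y, (he 0 y).symm⟩
  · intro n x
    rw [← (e n).map_eq_zero_iff, he, Q.exact_succ]
    constructor
    · rintro ⟨y, hy⟩
      refine ⟨(e (n + 2)).symm y, (e (n + 1)).injective ?_⟩
      rw [he, LinearEquiv.apply_symm_apply, hy]
    · rintro ⟨y, rfl⟩
      exact ⟨e (n + 2) y, (he (n + 1) y).symm⟩

end GradedHochschild

end

noncomputable section

open CategoryTheory

namespace GradedHochschild

variable {K : Type v} {A : Type u} [Field K] [Ring A] [Algebra K A]
variable {𝒜 : ℕ → Submodule K A} [GradedAlgebra 𝒜]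

open CochainComplex.HomComplex in
/-- In degree zero, the class of a cocycle vanishes only if the cocycle does. -/
theorem extMk_zero_eq_zero_iff {C : Type*} [Category* C] [Abelian C] [HasExt.{u} C] {X Y : C}
    (R : ProjectiveResolution X) (f : R.complex.X 0 ⟶ Y) (m : ℕ) (hm : 0 + 1 = m)
    (hf : R.complex.d m 0 ≫ f = 0) : R.extMk f m hm hf = 0 ↔ f = 0 := by
  simp only [← R.extEquivCohomologyClass.apply_eq_iff_eq,
    ProjectiveResolution.extEquivCohomologyClass_extMk,
    ProjectiveResolution.extEquivCohomologyClass_zero, CohomologyClass.mk_eq_zero_iff]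
  rw [Cocycle.toSingleMk_mem_coboundaries_iff _ _ _ _ _ 1 (by simp)]
  have h0 : Limits.IsZero (R.cochainComplex.X 1) := R.cochainComplex.isZero_of_isStrictlyLE 0 1
  have hd : R.cochainComplex.d (-(0 : ℕ)) 1 = 0 := h0.eq_of_tgt _ _
  refine ⟨fun ⟨g, hg⟩ => ?_, fun h => ⟨0, by simp [h]⟩⟩
  rw [hd, Limits.zero_comp] at hg
  rw [← cancel_epi (R.cochainComplexXIso (-(0 : ℕ)) 0 rfl).hom, ← hg, Limits.comp_zero]

namespace LinearResolution

variable (R : LinearResolution 𝒜)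

theorem linearCombination_rel_comp (n : ℕ) :
    Finsupp.linearCombination A (R.rel n) ∘ₗ Finsupp.linearCombination A (R.rel (n + 1)) = 0 :=
  (R.exact_succ n).linearMap_comp_eq_zero

/-- The chain complex of a linear free resolution. -/
def chainComplex : ChainComplex (ModuleCat.{u} A) ℕ :=
  ChainComplex.of (fun n => ModuleCat.of A (R.ι n →₀ A))
    (fun n => ModuleCat.ofHom (Finsupp.linearCombination A (R.rel n)))
    (fun n => by
      rw [← ModuleCat.ofHom_comp, R.linearCombination_rel_comp]
      rfl)

theorem chainComplex_d (n : ℕ) : R.chainComplex.d (n + 1) n =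
    ModuleCat.ofHom (Finsupp.linearCombination A (R.rel n)) :=
  ChainComplex.of_d (fun n => ModuleCat.of A (R.ι n →₀ A))
    (fun n => ModuleCat.ofHom (Finsupp.linearCombination A (R.rel n))) n

theorem chainComplex_d_comp_aug :
    R.chainComplex.d 1 0 ≫ (ModuleCat.ofHom R.aug : R.chainComplex.X 0 ⟶ _) = 0 := by
  rw [show R.chainComplex.d 1 0 = _ from R.chainComplex_d 0]
  refine (ModuleCat.ofHom_comp _ _).symm.trans ?_
  rw [R.exact_zero.linearMap_comp_eq_zero]
  rfl

/-- A linear free resolution, as a projective resolution. -/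
def projectiveResolution : ProjectiveResolution (ModuleCat.of A (TrivialModule 𝒜)) where
  complex := R.chainComplex
  projective n := (IsProjective.iff_projective (R.ι n →₀ A)).1 inferInstance
  π := (ChainComplex.toSingle₀Equiv _ _).symm ⟨ModuleCat.ofHom R.aug, R.chainComplex_d_comp_aug⟩
  quasiIso := ⟨fun n => by
    cases n with
    | zero =>
      rw [ChainComplex.quasiIsoAt₀_iff, ShortComplex.quasiIso_iff_of_zeros']
      · have h0 : (ShortComplex.mk (ModuleCat.ofHom (Finsupp.linearCombination A (R.rel 0)))
            (ModuleCat.ofHom R.aug) (by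
              rw [← ModuleCat.ofHom_comp, R.exact_zero.linearMap_comp_eq_zero]; rfl)).Exact :=
          (ShortComplex.moduleCat_exact_iff _).2 fun x hx => (R.exact_zero x).1 hx
        refine (ShortComplex.exact_and_epi_g_iff_of_iso ?_).2
          ⟨h0, (ModuleCat.epi_iff_surjective _).2 R.aug_surjective⟩
        exact ShortComplex.isoMk (Iso.refl _) (Iso.refl _) (Iso.refl _)
          ((Category.id_comp _).trans ((R.chainComplex_d 0).symm.trans (Category.comp_id _).symm))
          ((Category.id_comp _).trans
            ((ChainComplex.toSingle₀Equiv_symm_apply_f_zero _ R.chainComplex_d_comp_aug).symm.trans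
              (Category.comp_id _).symm))
      all_goals rfl
    | succ n =>
      rw [quasiIsoAt_iff_exactAt' _ _ (ChainComplex.exactAt_succ_single_obj _ _),
        HomologicalComplex.exactAt_iff' _ (n + 1 + 1) (n + 1) n (by simp) (by simp),
        ShortComplex.moduleCat_exact_iff]
      intro (x : R.ι (n + 1) →₀ A) hx
      change R.chainComplex.d (n + 1) n x = 0 at hx
      rw [chainComplex_d] at hx
      obtain ⟨y, hy⟩ := (R.exact_succ n x).1 hx
      refine ⟨y, ?_⟩
      change R.chainComplex.d (n + 1 + 1) (n + 1) y = x
      rw [chainComplex_d]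
      exact hy⟩

section Ext

variable {Y : Type u} [AddCommGroup Y] [Module A Y]

/-- A morphism from a module of the resolution. -/
def homOf {n : ℕ} (f : (R.ι n →₀ A) →ₗ[A] Y) :
    R.projectiveResolution.complex.X n ⟶ ModuleCat.of A Y :=
  ModuleCat.ofHom f

theorem homOf_surjective {n : ℕ} :
    Function.Surjective (R.homOf (Y := Y) : ((R.ι n →₀ A) →ₗ[A] Y) → _) := fun f =>
  let f' : ModuleCat.of A (R.ι n →₀ A) ⟶ ModuleCat.of A Y := f
  ⟨f'.hom, rfl⟩

theorem homOf_injective {n : ℕ} :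
    Function.Injective (R.homOf (Y := Y) : ((R.ι n →₀ A) →ₗ[A] Y) → _) := fun _ _ h =>
  congrArg (ModuleCat.Hom.hom (R := A)) h

theorem d_comp_homOf {n : ℕ} (f : (R.ι n →₀ A) →ₗ[A] Y) :
    R.projectiveResolution.complex.d (n + 1) n ≫ R.homOf f =
      R.homOf (f ∘ₗ Finsupp.linearCombination A (R.rel n)) := by
  refine Eq.trans ?_ (ModuleCat.ofHom_comp _ _).symm
  exact congrArg (· ≫ ModuleCat.ofHom f) (R.chainComplex_d n)

/-- The extension class of a cocycle. -/
def extClass {n : ℕ} (f : (R.ι n →₀ A) →ₗ[A] Y)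
    (hf : f ∘ₗ Finsupp.linearCombination A (R.rel n) = 0) :
    Abelian.Ext (ModuleCat.of A (TrivialModule 𝒜)) (ModuleCat.of A Y) n :=
  R.projectiveResolution.extMk (R.homOf f) (n + 1) rfl (by
    rw [d_comp_homOf, hf]
    rfl)

theorem extClass_add {n : ℕ} (f g : (R.ι n →₀ A) →ₗ[A] Y)
    (hf : f ∘ₗ Finsupp.linearCombination A (R.rel n) = 0)
    (hg : g ∘ₗ Finsupp.linearCombination A (R.rel n) = 0)
    (hfg : (f + g) ∘ₗ Finsupp.linearCombination A (R.rel n) = 0) :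
    R.extClass (f + g) hfg = R.extClass f hf + R.extClass g hg :=
  (R.projectiveResolution.add_extMk (R.homOf f) (R.homOf g) (n + 1) rfl _ _).symm

theorem extClass_surjective {n : ℕ}
    (α : Abelian.Ext (ModuleCat.of A (TrivialModule 𝒜)) (ModuleCat.of A Y) n) :
    ∃ f hf, R.extClass f hf = α := by
  obtain ⟨f, hf, rfl⟩ := R.projectiveResolution.extMk_surjective α (n + 1) rfl
  obtain ⟨f, rfl⟩ := R.homOf_surjective f
  rw [d_comp_homOf] at hf
  exact ⟨f, R.homOf_injective hf, rfl⟩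

theorem extClass_succ_eq_zero_iff {n : ℕ} (f : (R.ι (n + 1) →₀ A) →ₗ[A] Y)
    (hf : f ∘ₗ Finsupp.linearCombination A (R.rel (n + 1)) = 0) :
    R.extClass f hf = 0 ↔ ∃ g, g ∘ₗ Finsupp.linearCombination A (R.rel n) = f := by
  refine (R.projectiveResolution.extMk_eq_zero_iff _ _ _ _ n rfl).trans ⟨?_, ?_⟩
  · rintro ⟨g, hg⟩
    obtain ⟨g, rfl⟩ := R.homOf_surjective g
    rw [d_comp_homOf] at hg
    exact ⟨g, R.homOf_injective hg⟩
  · rintro ⟨g, rfl⟩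
    exact ⟨R.homOf g, R.d_comp_homOf g⟩

theorem extClass_zero_eq_zero_iff (f : (R.ι 0 →₀ A) →ₗ[A] Y)
    (hf : f ∘ₗ Finsupp.linearCombination A (R.rel 0) = 0) :
    R.extClass f hf = 0 ↔ f = 0 := by
  refine (extMk_zero_eq_zero_iff R.projectiveResolution _ _ _ _).trans ⟨fun h => ?_, fun h => ?_⟩
  · exact R.homOf_injective h
  · rw [h]
    rfl

theorem extClass_smul {n : ℕ} (c : K) (x : R.ι n → A)
    (hx : Finsupp.linearCombination A x ∘ₗ Finsupp.linearCombination A (R.rel n) = 0)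
    (hcx : Finsupp.linearCombination A (c • x) ∘ₗ Finsupp.linearCombination A (R.rel n) = 0) :
    R.extClass (Finsupp.linearCombination A (c • x)) hcx =
      c • R.extClass (Finsupp.linearCombination A x) hx := by
  rw [Abelian.Ext.smul_eq_comp_mk₀]
  refine Eq.trans ?_ (R.projectiveResolution.extMk_comp_mk₀ _ _ _ _ _).symm
  unfold extClass
  congr 1
  refine ModuleCat.hom_ext (Finsupp.lhom_ext fun j a => ?_)
  change Finsupp.linearCombination A (c • x) (Finsupp.single j a) =
    algebraMap K A c • Finsupp.linearCombination A x (Finsupp.single j a)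
  rw [Finsupp.linearCombination_single, Finsupp.linearCombination_single, Pi.smul_apply,
    algebraMap_smul, smul_eq_mul, smul_eq_mul, mul_smul_comm]

end Ext

end LinearResolution

end GradedHochschild

end

noncomputable section

open CategoryTheory

namespace GradedHochschild

variable {K : Type v} {A : Type u} [Field K] [Ring A] [Algebra K A]
variable {𝒜 : ℕ → Submodule K A} [GradedAlgebra 𝒜]

section IntProj

variable (𝒜) in
/-- The projection of `A` to its component of degree `j ∈ ℤ`. -/
def intProj (j : ℤ) : A →ₗ[K] A :=
  if 0 ≤ j then (𝒜 j.toNat).subtype ∘ₗ projComponent 𝒜 j.toNat else 0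

theorem intProj_of_mem {p : ℕ} {x : A} (hx : x ∈ 𝒜 p) (j : ℤ) :
    intProj 𝒜 j x = if (p : ℤ) = j then x else 0 := by
  unfold intProj
  split_ifs with h1 h2 h2
  · subst h2
    exact congrArg Subtype.val (projComponent_same (⟨x, hx⟩ : 𝒜 p))
  · change (projComponent 𝒜 j.toNat x : A) = 0
    rw [projComponent_ne (j := p) (by lia) hx, Submodule.coe_zero]
  · lia
  · rfl

theorem intProj_of_mem_intComponent {j : ℤ} {x : A} (hx : x ∈ intComponent 𝒜 j) (k : ℤ) :
    intProj 𝒜 k x = if j = k then x else 0 := by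
  rcases lt_or_ge j 0 with h | h
  · rw [intComponent_of_neg h, Submodule.mem_bot] at hx
    simp [hx]
  · lift j to ℕ using h
    exact intProj_of_mem hx k

theorem intProj_mem (j : ℤ) (x : A) : intProj 𝒜 j x ∈ intComponent 𝒜 j := by
  unfold intProj
  split_ifs with h
  · lift j to ℕ using h
    exact (projComponent 𝒜 j x).2
  · exact zero_mem _

theorem intProj_mul {p : ℕ} {a : A} (ha : a ∈ 𝒜 p) (j : ℤ) (x : A) :
    intProj 𝒜 (p + j) (a * x) = a * intProj 𝒜 j x := by
  induction x using DirectSum.Decomposition.inductionOn 𝒜 with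
  | zero => simp
  | add x y hx hy => rw [mul_add, map_add, hx, hy, map_add, mul_add]
  | @homogeneous q x =>
    rw [intProj_of_mem (SetLike.mul_mem_graded ha x.2), intProj_of_mem x.2]
    split_ifs with h1 h2 h2
    · rfl
    · push_cast at h1; lia
    · push_cast at h1; lia
    · rw [mul_zero]

end IntProj

namespace LinearResolution

variable (R : LinearResolution 𝒜)

/-- The differentials of the dual complex `Hom_A(F, A)`, in coordinates. -/
def dual (n : ℕ) : (R.ι n → A) →ₗ[K] (R.ι (n + 1) → A) where
  toFun x i := Finsupp.linearCombination A x (R.rel n i)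
  map_add' x y := funext fun i => by
    simp [Finsupp.linearCombination_apply, Finsupp.sum, mul_add, Finset.sum_add_distrib]
  map_smul' c x := funext fun i => by
    simp [Finsupp.linearCombination_apply, Finsupp.sum, Finset.smul_sum]

theorem dual_apply (n : ℕ) (x : R.ι n → A) (i : R.ι (n + 1)) :
    R.dual n x i = ∑ j ∈ (R.rel n i).support, R.rel n i j * x j := rfl

theorem linearCombination_dual (n : ℕ) (x : R.ι n → A) :
    Finsupp.linearCombination A x ∘ₗ Finsupp.linearCombination A (R.rel n) =
      Finsupp.linearCombination A (R.dual n x) := by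
  refine Finsupp.lhom_ext fun i a => ?_
  rw [LinearMap.comp_apply, Finsupp.linearCombination_single, Finsupp.linearCombination_single,
    map_smul]
  rfl

theorem linearCombination_injective {ι Y : Type*} [AddCommGroup Y] [Module A Y] {x y : ι → Y}
    (h : Finsupp.linearCombination A x = Finsupp.linearCombination A y) : x = y := by
  funext i
  simpa using LinearMap.congr_fun h (Finsupp.single i 1)

theorem exists_linearCombination {ι Y : Type*} [AddCommGroup Y] [Module A Y]
    (f : (ι →₀ A) →ₗ[A] Y) : ∃ x, Finsupp.linearCombination A x = f :=
  ⟨fun i => f (Finsupp.single i 1), Finsupp.lhom_ext fun i a => by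
    rw [Finsupp.linearCombination_single, ← map_smul, Finsupp.smul_single, smul_eq_mul, mul_one]⟩

/-- The boundaries of the dual complex. -/
def boundaries : ∀ n, Submodule K (R.ι n → A)
  | 0 => ⊥
  | n + 1 => LinearMap.range (R.dual n)

theorem linearCombination_comp_eq_zero {n : ℕ} {x : R.ι n → A} (hx : R.dual n x = 0) :
    Finsupp.linearCombination A x ∘ₗ Finsupp.linearCombination A (R.rel n) = 0 := by
  rw [linearCombination_dual, hx]
  exact Finsupp.lhom_ext fun i a => by simp

theorem extClass_linearCombination_eq_zero_iff {n : ℕ} {x : R.ι n → A} (hx : R.dual n x = 0) :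
    R.extClass _ (R.linearCombination_comp_eq_zero hx) = 0 ↔ x ∈ R.boundaries n := by
  cases n with
  | zero =>
    rw [extClass_zero_eq_zero_iff]
    refine Iff.trans ⟨fun h => ?_, fun h => ?_⟩ (Submodule.mem_bot K).symm
    · refine linearCombination_injective (A := A) (h.trans ?_)
      exact Finsupp.lhom_ext fun i a => by simp
    · rw [h]
      exact Finsupp.lhom_ext fun i a => by simp
  | succ n =>
    rw [extClass_succ_eq_zero_iff]
    constructor
    · rintro ⟨g, hg⟩
      obtain ⟨y, rfl⟩ := exists_linearCombination g
      rw [linearCombination_dual] at hg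
      exact ⟨y, linearCombination_injective hg⟩
    · rintro ⟨y, rfl⟩
      exact ⟨_, R.linearCombination_dual n y⟩

theorem mem_boundaries_of_subsingleton_ext {n : ℕ}
    (h : Subsingleton (Abelian.Ext (ModuleCat.of A (TrivialModule 𝒜)) (ModuleCat.of A A) n))
    {x : R.ι n → A} (hx : R.dual n x = 0) : x ∈ R.boundaries n :=
  (R.extClass_linearCombination_eq_zero_iff hx).1 (Subsingleton.elim _ _)

/-- If the last differential of the dual complex is zero, then the top `Ext` is its cokernel. -/
theorem exists_functional {n : ℕ} (h0 : ∀ x, R.dual n x = 0)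
    (e : Abelian.Ext (ModuleCat.of A (TrivialModule 𝒜)) (ModuleCat.of A A) n ≃ₗ[K] K) :
    ∃ Θ : (R.ι n → A) →ₗ[K] K, Function.Surjective Θ ∧ ∀ x, Θ x = 0 → x ∈ R.boundaries n := by
  let θ : (R.ι n → A) →ₗ[K]
      Abelian.Ext (ModuleCat.of A (TrivialModule 𝒜)) (ModuleCat.of A A) n :=
    { toFun := fun x => R.extClass _ (R.linearCombination_comp_eq_zero (h0 x))
      map_add' := fun x y => by
        have hxy : Finsupp.linearCombination A (x + y) =
            Finsupp.linearCombination A x + Finsupp.linearCombination A y :=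
          Finsupp.lhom_ext fun i a => by simp [mul_add]
        rw [← R.extClass_add _ _ _ _ (by
          rw [← hxy]
          exact R.linearCombination_comp_eq_zero (h0 _))]
        congr 1
      map_smul' := fun c x => R.extClass_smul c x _ _ }
  refine ⟨e.toLinearMap ∘ₗ θ, e.surjective.comp fun α => ?_, fun x hx => ?_⟩
  · obtain ⟨f, hf, rfl⟩ := R.extClass_surjective α
    obtain ⟨x, rfl⟩ := exists_linearCombination f
    exact ⟨x, rfl⟩
  · exact (R.extClass_linearCombination_eq_zero_iff (h0 x)).1 ((e.map_eq_zero_iff).1 hx)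

/-- The resolution is at most as long as the projective dimension of the trivial module. -/
theorem isEmpty_of_subsingleton_ext (hconn : IsConnectedGraded 𝒜) {n : ℕ}
    (h : Subsingleton (Abelian.Ext (ModuleCat.of A (TrivialModule 𝒜))
      (ModuleCat.of A (TrivialModule 𝒜)) (n + 1))) : IsEmpty (R.ι (n + 1)) := by
  classical
  obtain ⟨ε, hε⟩ := exists_augmentation hconn
  refine ⟨fun i => ?_⟩
  have hz (m : ℕ) (f : (R.ι m →₀ A) →ₗ[A] TrivialModule 𝒜) :
      f ∘ₗ Finsupp.linearCombination A (R.rel m) = 0 := by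
    obtain ⟨x, rfl⟩ := exists_linearCombination f
    refine Finsupp.lhom_ext fun i a => ?_
    rw [LinearMap.comp_apply, Finsupp.linearCombination_single, map_smul,
      Finsupp.linearCombination_apply, Finsupp.sum]
    rw [Finset.sum_eq_zero fun j _ => smul_trivialModule_eq_zero one_ne_zero (R.rel_mem m i j) _]
    simp
  let f : (R.ι (n + 1) →₀ A) →ₗ[A] TrivialModule 𝒜 :=
    Finsupp.linearCombination A (Pi.single i (Submodule.Quotient.mk 1))
  obtain ⟨g, hg⟩ := (R.extClass_succ_eq_zero_iff f (hz _ f)).1 (Subsingleton.elim _ _)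
  rw [hz] at hg
  have h1 := LinearMap.congr_fun hg (Finsupp.single i 1)
  simp only [f, Finsupp.linearCombination_single, Pi.single_eq_same, one_smul,
    LinearMap.zero_apply] at h1
  have h2 := ε.onTrivial_mk 1
  rw [← h1, map_zero, map_one] at h2
  exact zero_ne_one h2

end LinearResolution

end GradedHochschild

end

noncomputable section

open CategoryTheory

namespace GradedHochschild

variable {K : Type v} {A : Type u} [Field K] [Ring A] [Algebra K A]
variable {𝒜 : ℕ → Submodule K A} [GradedAlgebra 𝒜]

theorem eq_zero_of_smul_one_mem_geSubmodule [Nontrivial A] {c : K}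
    (h : c • (1 : A) ∈ geSubmodule 𝒜 1) : c = 0 := by
  have h1 := projComponent_of_geSubmodule (k := 0) one_pos h
  have h2 : c • (1 : A) ∈ 𝒜 0 := Submodule.smul_mem _ _ SetLike.GradedOne.one_mem
  have h3 := congrArg Subtype.val ((projComponent_same (⟨_, h2⟩ : 𝒜 0)).symm.trans h1)
  exact (smul_eq_zero.1 (h3 : c • (1 : A) = 0)).resolve_right one_ne_zero

section GeneratedInDegreeOne

theorem pow_le_component (m : ℕ) : 𝒜 1 ^ m ≤ 𝒜 m := by
  induction m with
  | zero =>
    rw [pow_zero, Submodule.one_le]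
    exact SetLike.GradedOne.one_mem
  | succ m ih =>
    rw [pow_succ, Submodule.mul_le]
    intro x hx y hy
    exact SetLike.mul_mem_graded (ih hx) hy

theorem component_eq_pow (h : IsGeneratedInDegreeOne 𝒜) (m : ℕ) : 𝒜 m = 𝒜 1 ^ m := by
  refine le_antisymm (fun x hx => ?_) (pow_le_component m)
  have hmul : (⨆ k, 𝒜 1 ^ k) * (⨆ k, 𝒜 1 ^ k) ≤ ⨆ k, 𝒜 1 ^ k := by
    simp only [Submodule.iSup_mul, Submodule.mul_iSup, ← pow_add]
    exact iSup_le fun i => iSup_le fun j => le_iSup (fun k => 𝒜 1 ^ k) _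
  have hT (y : A) : y ∈ ⨆ k, 𝒜 1 ^ k := by
    have hy : y ∈ Algebra.adjoin K (𝒜 1 : Set A) := by
      rw [show Algebra.adjoin K (𝒜 1 : Set A) = ⊤ from h]
      exact Algebra.mem_top
    induction hy using Algebra.adjoin_induction with
    | mem y hy => exact Submodule.mem_iSup_of_mem 1 (by rwa [pow_one])
    | algebraMap c =>
      exact Submodule.mem_iSup_of_mem 0 (by rw [pow_zero]; exact Submodule.algebraMap_mem c)
    | add y z _ _ hy hz => exact add_mem hy hz
    | mul y z _ _ hy hz => exact hmul (Submodule.mul_mem_mul hy hz)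
  have key (y : A) : (projComponent 𝒜 m y : A) ∈ 𝒜 1 ^ m := by
    induction hT y using Submodule.iSup_induction' with
    | mem k y hy =>
      by_cases hk : k = m
      · subst hk
        rwa [projComponent_same (⟨y, pow_le_component k hy⟩ : 𝒜 k)]
      · rw [projComponent_ne hk (pow_le_component k hy)]
        exact zero_mem _
    | zero => simp
    | add y z _ _ hy hz =>
      rw [map_add]
      exact add_mem hy hz
  have := key x
  rwa [projComponent_same (⟨x, hx⟩ : 𝒜 m)] at this

theorem finite_component (h : IsGeneratedInDegreeOne 𝒜) (h1 : (𝒜 1).FG) (m : ℕ) :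
    Module.Finite K (𝒜 m) := by
  rw [Module.Finite.iff_fg, component_eq_pow h]
  exact h1.pow m

end GeneratedInDegreeOne

namespace LinearResolution

variable (R : LinearResolution 𝒜)

theorem linearCombination_rel_mem (n : ℕ) (y : R.ι (n + 1) →₀ A) (i : R.ι n) :
    Finsupp.linearCombination A (R.rel n) y i ∈ geSubmodule 𝒜 1 := by
  rw [Finsupp.linearCombination_apply, Finsupp.sum, Finsupp.finsetSum_apply]
  exact sum_mem fun j _ => mul_mem_geSubmodule_left _ (mem_geSubmodule le_rfl (R.rel_mem n j i))

/-- Combinations of the generators with coefficients in `K` are not boundaries. -/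
theorem eq_zero_of_mapRange [Nontrivial A] {n : ℕ} {c : R.ι n →₀ K} {y : R.ι (n + 1) →₀ A}
    (h : Finsupp.linearCombination A (R.rel n) y = c.mapRange (algebraMap K A) (map_zero _)) :
    c = 0 := by
  ext i
  have := R.linearCombination_rel_mem n y i
  rw [h, Finsupp.mapRange_apply, Algebra.algebraMap_eq_smul_one] at this
  exact eq_zero_of_smul_one_mem_geSubmodule this

theorem linearCombination_mapRange {ι Y : Type*} [AddCommGroup Y] [Module K Y] [Module A Y]
    [IsScalarTower K A Y] (b : ι → Y) (c : ι →₀ K) :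
    Finsupp.linearCombination A b (c.mapRange (algebraMap K A) (map_zero _)) =
      Finsupp.linearCombination K b c := by
  rw [Finsupp.linearCombination_apply, Finsupp.sum_mapRange_index (by simp),
    Finsupp.linearCombination_apply]
  exact Finsupp.sum_congr fun i _ => algebraMap_smul _ _ _

/-- The modules of the resolution have finite rank. -/
theorem finite_ι (hconn : IsConnectedGraded 𝒜) (h1 : Module.Finite K (𝒜 1)) (n : ℕ) :
    Finite (R.ι n) := by
  have := hconn.1
  induction n with
  | zero =>
    obtain ⟨ε, hε⟩ := exists_augmentation hconn
    have : Module.Finite K (TrivialModule 𝒜) :=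
      Module.Finite.of_surjective (LinearMap.toSpanSingleton K _ (Submodule.Quotient.mk 1))
        fun y => ⟨ε.onTrivial y, ε.onTrivial_smul hε y⟩
    have hli : LinearIndependent K fun i : R.ι 0 => R.aug (Finsupp.single i 1) := by
      refine linearIndependent_iff.2 fun c hc => ?_
      rw [← linearCombination_mapRange (A := A)] at hc
      have : R.aug (c.mapRange (algebraMap K A) (map_zero _)) = 0 := by
        rw [← hc]
        obtain ⟨x, hx⟩ := exists_linearCombination R.aug
        conv_lhs => rw [← hx]
        congr 2
        funext i
        rw [← hx, Finsupp.linearCombination_single, one_smul]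
      obtain ⟨y, hy⟩ := (R.exact_zero _).1 this
      exact R.eq_zero_of_mapRange hy
    exact hli.finite
  | succ n ih =>
    have hli : LinearIndependent K fun i : R.ι (n + 1) =>
        fun j : R.ι n => (⟨R.rel n i j, R.rel_mem n i j⟩ : 𝒜 1) := by
      refine linearIndependent_iff.2 fun c hc => ?_
      have : Finsupp.linearCombination A (R.rel n)
          (c.mapRange (algebraMap K A) (map_zero _)) = 0 := by
        rw [linearCombination_mapRange]
        ext j
        have := congrArg Subtype.val (congrFun hc j)
        rw [Finsupp.linearCombination_apply, Finsupp.sum, Finset.sum_apply,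
          Submodule.coe_sum] at this
        rw [Finsupp.linearCombination_apply, Finsupp.sum, Finsupp.finsetSum_apply]
        exact this
      obtain ⟨y, hy⟩ := (R.exact_succ n _).1 this
      exact R.eq_zero_of_mapRange hy
    exact hli.finite

/-- The part of internal degree `r` of the dual complex. -/
def strand (n : ℕ) (r : ℤ) : Submodule K (R.ι n → A) :=
  Submodule.pi Set.univ fun _ => intComponent 𝒜 (n + r)

theorem mem_strand {n : ℕ} {r : ℤ} {x : R.ι n → A} :
    x ∈ R.strand n r ↔ ∀ i, x i ∈ intComponent 𝒜 (n + r) := by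
  simp [strand, Submodule.mem_pi]

theorem dual_mem_strand {n : ℕ} {r : ℤ} {x : R.ι n → A} (hx : x ∈ R.strand n r) :
    R.dual n x ∈ R.strand (n + 1) r := by
  rw [mem_strand] at hx ⊢
  intro i
  rw [dual_apply]
  refine sum_mem fun j _ => ?_
  have := mul_mem_intComponent_left 𝒜 (R.rel_mem n i j) (hx j)
  convert this using 1
  push_cast
  ring_nf

/-- The projection of the dual complex to its part of internal degree `r`. -/
def strandProj (n : ℕ) (r : ℤ) : (R.ι n → A) →ₗ[K] (R.ι n → A) :=
  LinearMap.pi fun i => intProj 𝒜 (n + r) ∘ₗ LinearMap.proj i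

theorem strandProj_apply (n : ℕ) (r : ℤ) (x : R.ι n → A) (i : R.ι n) :
    R.strandProj n r x i = intProj 𝒜 (n + r) (x i) := rfl

theorem strandProj_mem (n : ℕ) (r : ℤ) (x : R.ι n → A) : R.strandProj n r x ∈ R.strand n r :=
  R.mem_strand.2 fun i => intProj_mem _ (x i)

theorem strandProj_of_mem {n : ℕ} {r s : ℤ} {x : R.ι n → A} (hx : x ∈ R.strand n r) :
    R.strandProj n s x = if r = s then x else 0 := by
  funext i
  rw [strandProj_apply, intProj_of_mem_intComponent (R.mem_strand.1 hx i)]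
  split_ifs with h1 h2 h2
  · rfl
  · lia
  · lia
  · rfl

theorem dual_strandProj (n : ℕ) (r : ℤ) (x : R.ι n → A) :
    R.dual n (R.strandProj n r x) = R.strandProj (n + 1) r (R.dual n x) := by
  funext i
  rw [strandProj_apply, dual_apply, dual_apply, map_sum]
  refine Finset.sum_congr rfl fun j _ => ?_
  rw [strandProj_apply, ← intProj_mul (R.rel_mem n i j)]
  congr 2
  push_cast
  ring

/-- The boundaries of internal degree `r` of the dual complex. -/
def strandBoundaries (r : ℤ) : ∀ n, Submodule K (R.ι n → A)
  | 0 => ⊥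
  | n + 1 => (R.strand n r).map (R.dual n)

theorem strandProj_mem_strandBoundaries {n : ℕ} {x : R.ι n → A} (hx : x ∈ R.boundaries n) (r : ℤ) :
    R.strandProj n r x ∈ R.strandBoundaries r n := by
  cases n with
  | zero =>
    obtain rfl : x = 0 := hx
    rw [map_zero]
    exact zero_mem _
  | succ n =>
    obtain ⟨y, rfl⟩ := hx
    exact ⟨_, R.strandProj_mem n r y, R.dual_strandProj n r y⟩

theorem mem_geSubmodule_of_mem_boundaries {n : ℕ} {x : R.ι n → A} (hx : x ∈ R.boundaries n)
    (i : R.ι n) : x i ∈ geSubmodule 𝒜 1 := by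
  cases n with
  | zero =>
    obtain rfl : x = 0 := hx
    exact zero_mem _
  | succ n =>
    obtain ⟨y, rfl⟩ := hx
    rw [dual_apply]
    exact sum_mem fun j _ => mul_mem_geSubmodule_right _ (mem_geSubmodule le_rfl (R.rel_mem n i j))

section Gorenstein

variable {d : ℕ} {Θ : (R.ι d → A) →ₗ[K] K}

open Classical in
theorem functional_single_ne_zero [Nontrivial A] (hΘ : ∀ x, Θ x = 0 → x ∈ R.boundaries d)
    (i : R.ι d) : Θ (Pi.single i 1) ≠ 0 := by
  intro h
  have := R.mem_geSubmodule_of_mem_boundaries (hΘ _ h) i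
  rw [Pi.single_eq_same, ← one_smul K (1 : A)] at this
  exact one_ne_zero (eq_zero_of_smul_one_mem_geSubmodule this)

theorem subsingleton_ι_top [Nontrivial A] (hΘ : ∀ x, Θ x = 0 → x ∈ R.boundaries d) :
    Subsingleton (R.ι d) := by
  classical
  refine ⟨fun i j => ?_⟩
  by_contra hij
  have h : Θ (Θ (Pi.single j 1) • (Pi.single i 1 : R.ι d → A) -
      Θ (Pi.single i 1) • (Pi.single j 1 : R.ι d → A)) = 0 := by
    rw [map_sub, map_smul, map_smul, smul_eq_mul, smul_eq_mul, mul_comm, sub_self]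
  have := R.mem_geSubmodule_of_mem_boundaries (hΘ _ h) i
  rw [Pi.sub_apply, Pi.smul_apply, Pi.smul_apply, Pi.single_eq_same, Pi.single_eq_of_ne hij,
    smul_zero, sub_zero] at this
  exact R.functional_single_ne_zero hΘ j (eq_zero_of_smul_one_mem_geSubmodule this)

theorem nonempty_ι_top (hs : Function.Surjective Θ) : Nonempty (R.ι d) := by
  by_contra h
  rw [not_nonempty_iff] at h
  obtain ⟨x, hx⟩ := hs 1
  rw [Subsingleton.elim x 0, map_zero] at hx
  exact zero_ne_one hx

theorem mem_strandBoundaries_top [Nontrivial A] (hΘ : ∀ x, Θ x = 0 → x ∈ R.boundaries d)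
    (hs : Function.Surjective Θ) {r : ℤ}
    (hr : r + d ≠ 0) {x : R.ι d → A} (hx : x ∈ R.strand d r) : x ∈ R.strandBoundaries r d := by
  classical
  obtain ⟨i⟩ := R.nonempty_ι_top hs
  let e : R.ι d → A := (Θ x / Θ (Pi.single i 1)) • Pi.single i 1
  have he : e ∈ R.strand d (-d) := by
    refine Submodule.smul_mem _ _ (R.mem_strand.2 fun j => ?_)
    rw [add_neg_cancel]
    change _ ∈ 𝒜 0
    by_cases h : j = i
    · subst h
      rw [Pi.single_eq_same]
      exact SetLike.GradedOne.one_mem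
    · rw [Pi.single_eq_of_ne h]
      exact zero_mem _
  have h : Θ (x - e) = 0 := by
    rw [map_sub, map_smul, smul_eq_mul, div_mul_cancel₀ _ (R.functional_single_ne_zero hΘ i),
      sub_self]
  have := R.strandProj_mem_strandBoundaries (hΘ _ h) r
  rwa [map_sub, R.strandProj_of_mem hx, if_pos rfl, R.strandProj_of_mem he, if_neg (by lia),
    sub_zero] at this

/-- The component of degree one is spanned by the entries of the last differential. -/
theorem fg_component_one (hΘ : ∀ x, Θ x = 0 → x ∈ R.boundaries d)
    (hconn : IsConnectedGraded 𝒜) (hs : Function.Surjective Θ) :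
    (𝒜 1).FG := by
  classical
  have := hconn.1
  obtain ⟨i⟩ := R.nonempty_ι_top hs
  have hmem {a : A} (ha : a ∈ 𝒜 1) : Pi.single i a ∈ R.strandBoundaries (1 - d) d := by
    refine R.mem_strandBoundaries_top hΘ hs (by lia) (R.mem_strand.2 fun j => ?_)
    rw [add_sub_cancel]
    change _ ∈ 𝒜 1
    by_cases h : j = i
    · subst h
      rwa [Pi.single_eq_same]
    · rw [Pi.single_eq_of_ne h]
      exact zero_mem _
  obtain ⟨ε, hε⟩ := exists_augmentation hconn
  cases d with
  | zero =>
    have : 𝒜 1 = ⊥ := by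
      refine (Submodule.eq_bot_iff _).2 fun a ha => ?_
      have h : Pi.single i a = 0 := hmem ha
      exact Pi.single_eq_zero_iff.1 h
    rw [this]
    exact Submodule.fg_bot
  | succ p =>
    have : 𝒜 1 = Submodule.span K ((R.rel p i).support.image (R.rel p i)) := by
      refine le_antisymm (fun a ha => ?_) (Submodule.span_le.2 ?_)
      · obtain ⟨y, hy, e⟩ := hmem ha
        have e' := congrFun e i
        rw [Pi.single_eq_same, dual_apply] at e'
        rw [← e']
        refine sum_mem fun j hj => ?_
        have hyj : y j ∈ 𝒜 0 := by
          have := R.mem_strand.1 hy j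
          rwa [show (p : ℤ) + (1 - (p + 1 : ℕ)) = (0 : ℕ) by push_cast; ring] at this
        rw [← hε _ hyj, ← Algebra.commutes, ← Algebra.smul_def]
        exact Submodule.smul_mem _ _ (Submodule.subset_span (Finset.mem_image_of_mem _ hj))
      · intro a ha
        obtain ⟨j, -, rfl⟩ := Finset.mem_image.1 ha
        exact R.rel_mem p i j
    rw [this]
    exact ⟨_, rfl⟩

end Gorenstein

section EulerCharacteristic

theorem dual_dual (n : ℕ) (x : R.ι n → A) : R.dual (n + 1) (R.dual n x) = 0 := by
  refine linearCombination_injective (A := A) ?_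
  rw [← linearCombination_dual, ← linearCombination_dual, LinearMap.comp_assoc,
    linearCombination_rel_comp, LinearMap.comp_zero]
  exact Finsupp.lhom_ext fun i a => by simp

theorem finrank_strand (n : ℕ) (hι : Finite (R.ι n)) (hA : ∀ m, Module.Finite K (𝒜 m)) (r : ℤ) :
    Module.Finite K (R.strand n r) ∧
    Module.finrank K (R.strand n r) =
      Nat.card (R.ι n) * Module.finrank K (intComponent 𝒜 (n + r)) := by
  have := Fintype.ofFinite (R.ι n)
  have hfin : Module.Finite K (intComponent 𝒜 (n + r)) := by
    rcases lt_or_ge ((n : ℤ) + r) 0 with h | h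
    · rw [intComponent_of_neg h]
      infer_instance
    · obtain ⟨m, hm⟩ := Int.eq_ofNat_of_zero_le h
      rw [hm]
      exact hA m
  let e : R.strand n r ≃ₗ[K] (R.ι n → intComponent 𝒜 (n + r)) :=
    { toFun := fun x i => ⟨x.1 i, R.mem_strand.1 x.2 i⟩
      invFun := fun x => ⟨fun i => (x i).1, R.mem_strand.2 fun i => (x i).2⟩
      map_add' := fun _ _ => rfl
      map_smul' := fun _ _ => rfl }
  refine ⟨Module.Finite.equiv e.symm, ?_⟩
  rw [e.finrank_eq, Module.finrank_pi_fintype, Finset.sum_const, Finset.card_univ,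
    Nat.card_eq_fintype_card, smul_eq_mul]

/-- The Euler characteristic of an exact strand of the dual complex is zero. -/
theorem sum_finrank_strand {d : ℕ} {r : ℤ} (hfin : ∀ n, Module.Finite K (R.strand n r))
    (hd : IsEmpty (R.ι (d + 1)))
    (hex : ∀ n, n ≤ d → ∀ x ∈ R.strand n r, R.dual n x = 0 → x ∈ R.strandBoundaries r n) :
    ∑ n ∈ Finset.range (d + 1), (-1 : ℤ) ^ n * (Module.finrank K (R.strand n r) : ℤ) = 0 := by
  let δ (n : ℕ) : R.strand n r →ₗ[K] R.strand (n + 1) r :=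
    (R.dual n).restrict fun _ hx => R.dual_mem_strand hx
  let z (n : ℕ) : ℕ := Module.finrank K (LinearMap.ker (δ n))
  have h0 : z 0 = 0 := by
    refine Submodule.finrank_eq_zero.2 ((Submodule.eq_bot_iff _).2 fun x hx => ?_)
    exact Subtype.ext (hex 0 (Nat.zero_le d) _ x.2 (congrArg Subtype.val hx))
  have hz (n : ℕ) (hn : n ≤ d) : Module.finrank K (R.strand n r) = z n + z (n + 1) := by
    have hr : Module.finrank K (LinearMap.range (δ n)) = z (n + 1) := by
      by_cases hnd : n = d
      · subst hnd
        have : Subsingleton (R.strand (n + 1) r) :=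
          ⟨fun x y => Subtype.ext (Subsingleton.elim _ _)⟩
        rw [Module.finrank_zero_of_subsingleton]
        exact Module.finrank_zero_of_subsingleton.symm
      · have : LinearMap.range (δ n) = LinearMap.ker (δ (n + 1)) := by
          ext x
          constructor
          · rintro ⟨y, rfl⟩
            exact Subtype.ext (R.dual_dual n y.1)
          · intro hx
            obtain ⟨y, hy, e⟩ := hex (n + 1) (by lia) _ x.2 (congrArg Subtype.val hx)
            exact ⟨⟨y, hy⟩, Subtype.ext e⟩
        rw [this]
    rw [← LinearMap.finrank_range_add_finrank_ker (δ n), hr, add_comm]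
  have key (D : ℕ) (hD : D ≤ d + 1) :
      ∑ n ∈ Finset.range D, (-1 : ℤ) ^ n * (Module.finrank K (R.strand n r) : ℤ) =
        -(-1) ^ D * z D := by
    induction D with
    | zero => simp [h0]
    | succ D ih =>
      rw [Finset.sum_range_succ, ih (by lia), hz D (by lia)]
      push_cast
      ring
  have hlast : z (d + 1) = 0 := by
    have : Subsingleton (R.strand (d + 1) r) := ⟨fun x y => Subtype.ext (Subsingleton.elim _ _)⟩
    exact Module.finrank_zero_of_subsingleton
  rw [key (d + 1) le_rfl, hlast]
  simp

end EulerCharacteristic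

end LinearResolution

end GradedHochschild

end

noncomputable section

open CategoryTheory

namespace GradedHochschild

variable {K : Type v} {A : Type u} [Field K] [Ring A] [Algebra K A]
variable {𝒜 : ℕ → Submodule K A} [GradedAlgebra 𝒜]

theorem finrank_component_zero {𝒜 : ℕ → Submodule K A} (h : IsConnectedGraded 𝒜) : Module.finrank K (𝒜 0) = 1 := by
  have := h.1
  rw [h.2, Submodule.one_eq_span, finrank_span_singleton one_ne_zero]

theorem subsingleton_ext_of_globalDimension {d : ℕ} (h : globalDimension A = d)
    (X Y : ModuleCat.{u} A) {n : ℕ} (hn : d < n) : Subsingleton (Abelian.Ext X Y n) := by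
  have h1 : projectiveDimension X ≤ d := h ▸ le_iSup (fun M : ModuleCat.{u} A =>
    projectiveDimension M) X
  have := (projectiveDimension_le_iff X d).1 h1
  exact HasProjectiveDimensionLT.subsingleton X (d + 1) n hn Y

/-- The Euler characteristic of the strands of the dual of the resolution. -/
theorem LinearResolution.sum_card_mul_finrank (R : LinearResolution 𝒜) {d : ℕ}
    (hconn : IsConnectedGraded 𝒜) (hd : ∀ n, d < n → IsEmpty (R.ι n))
    (hι : ∀ n, Finite (R.ι n)) (hA : ∀ m, Module.Finite K (𝒜 m))
    (hex : ∀ n, n ≠ d → ∀ x, R.dual n x = 0 → x ∈ R.boundaries n)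
    {Θ : (R.ι d → A) →ₗ[K] K} (hs : Function.Surjective Θ)
    (hΘ : ∀ x, Θ x = 0 → x ∈ R.boundaries d) (r : ℤ) :
    ∑ i ∈ Finset.range (d + 1), (-1 : ℤ) ^ i *
      ((Nat.card (R.ι i) * Module.finrank K (intComponent 𝒜 (i + r)) : ℕ) : ℤ) =
      if r + (d : ℤ) = 0 then (-1 : ℤ) ^ d else 0 := by
  have := hconn.1
  split_ifs with hr
  · rw [Finset.sum_range_succ, Finset.sum_eq_zero, zero_add]
    · have h1 : Nat.card (R.ι d) = 1 :=
        Nat.card_eq_one_iff_unique.2 ⟨R.subsingleton_ι_top hΘ, R.nonempty_ι_top hs⟩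
      rw [h1, add_comm, hr]
      change (-1 : ℤ) ^ d * ((1 * Module.finrank K (𝒜 0) : ℕ) : ℤ) = _
      rw [finrank_component_zero hconn]
      simp
    · intro i hi
      have := Finset.mem_range.1 hi
      rw [intComponent_of_neg (by lia), finrank_bot]
      simp
  · have h1 := fun n => R.finrank_strand n (hι n) hA r
    rw [← R.sum_finrank_strand (fun n => (h1 n).1) (hd _ (Nat.lt_succ_self d)) (r := r)]
    · exact Finset.sum_congr rfl fun n _ => by rw [(h1 n).2]
    · intro n hn x hx hx0
      by_cases h : n = d
      · subst h
        exact R.mem_strandBoundaries_top hΘ hs hr hx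
      · have := R.strandProj_mem_strandBoundaries (hex n h x hx0) r
        rwa [R.strandProj_of_mem hx, if_pos rfl] at this

end GradedHochschild

end

theorem proposition2p5 {K : Type v} {A : Type u} [Field K] [Ring A] [Algebra K A]
    (𝒜 : ℕ → Submodule K A) [GradedAlgebra 𝒜] (d : ℕ)
    (hKoszul : GradedHochschild.IsKoszul 𝒜)
    (hRegular : GradedHochschild.IsWeaklyASRegular 𝒜 d) :
    (∀ i r : ℤ, i < 0 ∨ (d : ℤ) < i → Subsingleton (GradedHochschild.HH 𝒜 i r)) ∧
    (∀ i r : ℤ, Module.Finite K (GradedHochschild.HH 𝒜 i r)) ∧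
    (∀ r : ℤ, ∑ i ∈ Finset.range (d + 1),
        (-1 : ℤ) ^ i * (Module.finrank K (GradedHochschild.HH 𝒜 (i : ℤ) r) : ℤ) =
      if r + (d : ℤ) = 0 then (-1 : ℤ) ^ d else 0) ∧
    (d ≠ 0 → ∑ i ∈ Finset.range (d + 1),
        (-1 : ℤ) ^ i * (Module.finrank K (GradedHochschild.HH 𝒜 (i : ℤ) 0) : ℤ) = 0) := by
  have hconn := hRegular.connected
  obtain ⟨R⟩ := hKoszul.nonempty_linearResolution hconn
  have hd (n : ℕ) (hn : d < n) : IsEmpty (R.ι n) := by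
    obtain ⟨n, rfl⟩ := Nat.exists_eq_add_of_le' (Nat.one_le_of_lt hn)
    exact R.isEmpty_of_subsingleton_ext hconn
      (GradedHochschild.subsingleton_ext_of_globalDimension hRegular.globalDimension_eq _ _ hn)
  obtain ⟨⟨e⟩, hvan⟩ := hRegular.gorenstein
  have hempty := hd (d + 1) (Nat.lt_succ_self d)
  obtain ⟨Θ, hs, hΘ⟩ := R.exists_functional (fun x => Subsingleton.elim (R.dual d x) 0) e
  have h1 := R.fg_component_one hΘ hconn hs
  have hA := GradedHochschild.finite_component hRegular.generated h1
  have hι := R.finite_ι hconn (hA 1)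
  obtain ⟨ε, hε⟩ := GradedHochschild.exists_augmentation hconn
  have hHH := GradedHochschild.HH_of_linearResolution R hε hd hι hA
  have hsum (r : ℤ) := (hHH r).2.2.trans (R.sum_card_mul_finrank hconn hd hι hA
    (fun n hn x hx => R.mem_boundaries_of_subsingleton_ext (hvan n hn) hx) hs hΘ r)
  refine ⟨fun i r => (hHH r).1 i, fun i r => (hHH r).2.1 i, hsum, fun hd0 => ?_⟩
  rw [hsum 0, if_neg (by lia)]
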